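/- Let $\mathbb{K}$ be $\mathbb{R}$ or $\mathbb{C}$, $\rho=[\mathbb{K}:\mathbb{R}]$, $|\cdot|_{\mathbb K}=|\cdot|^\rho$, $G=\mathrm{SL}_2(\mathbb{K})$, and let $K$ be $\mathrm{SO}_2(\mathbb{R})$ or $\mathrm{SU}_2(\mathbb{C})$, respectively. Put $a(t)=\mathrm{diag}(e^{t/2},e^{-t/2})$ and $n(x)=\begin{pmatrix}1&x\\0&1\end{pmatrix}$, and normalize the Haar measure of $G$ by $\int_G f(g)\,dg=\int_K\int_{\mathbb K}\int_{\mathbb R} f(a(t)n(x)k)\,dt\,dx\,dk$, where $dx$ is Lebesgue measure on $\mathbb{K}$ ($dx\,dy$ if $\mathbb K=\mathbb C$) and $dk$ is the Haar probability measure of $K$. The height $H(g)\ge 0$ of $g\in G$ is defined by $\cosh H(g)=\frac12\operatorname{tr}(gg^*)$ (equivalently $g\in K\,a(H(g))\,K$), and $B(R)=\{g\in G: H(g)\le R\}$. For $s\in\mathbb{C}$ let $\phi_s(g)=\int_K |y(kg)|_{\mathbb K}^{s+1/2}\,dk$ be the elementary spherical function of normalized Casimir eigenvalue $1/4-s^2$,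 where $y(g)>0$ is given by $g\in n(x)a(\log y(g))K$ for some $x\in\mathbb{K}$; and let $\widehat f(s)=\int_G f(g)\phi_s(g)\,dg$. Write $\check u(g)=\overline{u(g^{-1})}$ and $(u*v)(g)=\int_G u(h)v(h^{-1}g)\,dh$. Let $\Delta(\gamma)=\operatorname{tr}(\gamma)^2-4$ for $\gamma\in G$, and call $\gamma$ regular semisimple if its eigenvalues are distinct, i.e. $\Delta(\gamma)\ne0$. Its centralizer $G_\gamma$ is then conjugate in $G$ to the diagonal subgroup $D$ or (only if $\mathbb K=\mathbb R$) to $K$; it carries the Haar measure obtained by conjugation from $D=\{a(t)\}_{t\in\mathbb R}\times(D\cap K)$ with the product of $dt$ and the Haar probability measure, or from $K$ with its Haar probability measure. The orbital integral is $\mathbf{O}(\gamma,f)=\int_{G_\gamma\backslash G}f(g^{-1}\gamma g)\,d\dot g$, where $d\dot g$ is the quotient measure, $\int_G f(g)\,dg=\int_{G_\gamma\backslash G}\int_{G_\gamma}f(hg)\,dh\,d\dot g$. **Proposition.** There are absolute constants $c,C>0$ such that, for $\mathbb{K}\in\{\mathbb R,\mathbb C\}$ and every $t\in\mathbb{R}$,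 there exists a smooth, compactly supported, bi-$K$-invariant function $u:G\to\mathbb{C}$ for which $F:=u*\check u$ is smooth, compactly supported, bi-$K$-invariant and positive definite, and has the following properties: 1. $\widehat F(i\tau)$ is real and $\widehat F(i\tau)\ge c$ for every $\tau\in[t-1,t+1]$; 2. $F$ is supported in $B(2)$, and $|F(g)|\le C(1+|t|)^\rho$ for every $g\in G$; 3. for every regular semisimple $\gamma\in G$, the orbital integral $\mathbf{O}(\gamma,F)$ converges absolutely and $|\Delta(\gamma)|_{\mathbb K}^{1/2}\,|\mathbf{O}(\gamma,F)|\le C$. -/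

import Mathlib

open MeasureTheory
open scoped ContDiff ENNReal ComplexConjugate

noncomputable section

namespace SL2

/-! ### The group `SL₂(𝕂)` and its subgroups

Everything is written for `𝕂` with `[RCLike 𝕂] [MeasureSpace 𝕂]` and is used for `𝕂 = ℝ` and `𝕂 = ℂ`,
where `volume` is the Lebesgue measure `dx`, respectively `dx dy`. -/

/-- `G = SL₂(𝕂)`, with Mathlib's topology induced from the matrices. -/
abbrev G (𝕂 : Type) [RCLike 𝕂] : Type := Matrix.SpecialLinearGroup (Fin 2) 𝕂

/-- The Borel `σ`-algebra of `SL₂(𝕂)`. -/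
instance instMeasurableSpaceG (𝕂 : Type) [RCLike 𝕂] : MeasurableSpace (G 𝕂) := borel _

instance instBorelSpaceG (𝕂 : Type) [RCLike 𝕂] : BorelSpace (G 𝕂) := ⟨rfl⟩

/-- The degree `ρ = [𝕂 : ℝ]`. -/
def rho (𝕂 : Type) [RCLike 𝕂] : ℕ := Module.finrank ℝ 𝕂

/-- The module function `|x|_𝕂 = |x|^ρ`. -/
def absK {𝕂 : Type} [RCLike 𝕂] (x : 𝕂) : ℝ := ‖x‖ ^ rho 𝕂

/-- `a(t) = diag(e^{t/2}, e^{-t/2})`. -/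
def a (𝕂 : Type) [RCLike 𝕂] (t : ℝ) : G 𝕂 :=
  ⟨!![((Real.exp (t / 2) : ℝ) : 𝕂), 0; 0, ((Real.exp (-t / 2) : ℝ) : 𝕂)], by
    rw [Matrix.det_fin_two_of, ← RCLike.ofReal_mul, ← Real.exp_add]
    simp [neg_div]⟩

/-- `n(x)`, the upper triangular unipotent matrix with upper right entry `x`. -/
def n {𝕂 : Type} [RCLike 𝕂] (x : 𝕂) : G 𝕂 :=
  ⟨!![1, x; 0, 1], by simp [Matrix.det_fin_two_of]⟩

theorem coe_a (𝕂 : Type) [RCLike 𝕂] (t : ℝ) : (a 𝕂 t : Matrix (Fin 2) (Fin 2) 𝕂) =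
    !![((Real.exp (t / 2) : ℝ) : 𝕂), 0; 0, ((Real.exp (-t / 2) : ℝ) : 𝕂)] := rfl

theorem coe_n {𝕂 : Type} [RCLike 𝕂] (x : 𝕂) : (n x : Matrix (Fin 2) (Fin 2) 𝕂) =
    !![1, x; 0, 1] := rfl

/-- The maximal compact subgroup `K`: `SO₂(ℝ)` for `𝕂 = ℝ` and `SU₂(ℂ)` for `𝕂 = ℂ`. -/
def K (𝕂 : Type) [RCLike 𝕂] : Subgroup (G 𝕂) where
  carrier := {g | (g : Matrix (Fin 2) (Fin 2) 𝕂) ∈ Matrix.unitaryGroup (Fin 2) 𝕂}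
  mul_mem' {g h} hg hh := by
    simpa using mul_mem hg hh
  one_mem' := by
    simp [one_mem]
  inv_mem' {g} hg := by
    have h1 : star (g : Matrix (Fin 2) (Fin 2) 𝕂) * (g : Matrix (Fin 2) (Fin 2) 𝕂) = 1 :=
      Matrix.mem_unitaryGroup_iff'.mp hg
    have h2 : (g : Matrix (Fin 2) (Fin 2) 𝕂) *
        ((g⁻¹ : G 𝕂) : Matrix (Fin 2) (Fin 2) 𝕂) = 1 := by
      rw [← Matrix.SpecialLinearGroup.coe_mul]; simp
    have h3 : ((g⁻¹ : G 𝕂) : Matrix (Fin 2) (Fin 2) 𝕂)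
        = star (g : Matrix (Fin 2) (Fin 2) 𝕂) := (left_inv_eq_right_inv h1 h2).symm
    change ((g⁻¹ : G 𝕂) : Matrix (Fin 2) (Fin 2) 𝕂) ∈ Matrix.unitaryGroup (Fin 2) 𝕂
    rw [h3]
    exact Unitary.star_mem hg

/-- The subgroup `D` of diagonal matrices. -/
def D (𝕂 : Type) [RCLike 𝕂] : Subgroup (G 𝕂) where
  carrier := {g | g 0 1 = 0 ∧ g 1 0 = 0}
  mul_mem' {g h} hg hh := by
    obtain ⟨h1, h2⟩ := hg
    obtain ⟨h3, h4⟩ := hh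
    constructor <;> simp [Matrix.mul_apply, Fin.sum_univ_two, h1, h2, h3, h4]
  one_mem' := by constructor <;> simp
  inv_mem' {g} hg := by
    obtain ⟨h1, h2⟩ := hg
    constructor <;> simp [Matrix.SpecialLinearGroup.coe_inv, Matrix.adjugate_fin_two, h1, h2]

/-- The maximal compact subgroup `T = D ∩ K` of `D`. -/
def T (𝕂 : Type) [RCLike 𝕂] : Subgroup (G 𝕂) := D 𝕂 ⊓ K 𝕂

theorem isCompact_K (𝕂 : Type) [RCLike 𝕂] : IsCompact (K 𝕂 : Set (G 𝕂)) := by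
  have he : Topology.IsClosedEmbedding
      ((↑) : G 𝕂 → Matrix (Fin 2) (Fin 2) 𝕂) :=
    Matrix.SpecialLinearGroup.isClosedEmbedding_val
  have hU : IsCompact (Matrix.unitaryGroup (Fin 2) 𝕂 : Set (Matrix (Fin 2) (Fin 2) 𝕂)) := by
    have hpi : IsCompact (Set.univ.pi fun _ : Fin 2 => Set.univ.pi fun _ : Fin 2 =>
        Metric.closedBall (0 : 𝕂) 1) :=
      isCompact_univ_pi fun _ => isCompact_univ_pi fun _ => isCompact_closedBall _ _
    refine hpi.of_isClosed_subset ?_ ?_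
    · have : (Matrix.unitaryGroup (Fin 2) 𝕂 : Set (Matrix (Fin 2) (Fin 2) 𝕂))
          = {A | A * star A = 1} := by
        ext A; exact Matrix.mem_unitaryGroup_iff
      rw [this]
      exact isClosed_eq (continuous_id.matrix_mul continuous_id.matrix_conjTranspose)
        continuous_const
    · intro A hA i _ j _
      simpa using entry_norm_bound_of_unitary hA i j
  exact he.isCompact_preimage hU

instance instCompactSpaceK (𝕂 : Type) [RCLike 𝕂] : CompactSpace (K 𝕂) :=
  isCompact_iff_compactSpace.mp (isCompact_K 𝕂)

instance instCompactSpaceT (𝕂 : Type) [RCLike 𝕂] : CompactSpace (T 𝕂) := by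
  refine isCompact_iff_compactSpace.mp ((isCompact_K 𝕂).of_isClosed_subset ?_ fun g hg => hg.2)
  have hc : ∀ i j : Fin 2, Continuous fun g : G 𝕂 => g i j := fun i j => by fun_prop
  exact ((isClosed_eq (hc 0 1) continuous_const).inter
    (isClosed_eq (hc 1 0) continuous_const)).inter (isCompact_K 𝕂).isClosed

/-! ### Haar measures -/

/-- The Haar probability measure of a compact subgroup. -/
def haarProb {𝕂 : Type} [RCLike 𝕂] (C : Subgroup (G 𝕂)) [CompactSpace C] : Measure C :=
  Measure.haarMeasure ⊤

/-- The Haar measure of `G = ANK`: `∫_G f(g) dg = ∫_K ∫_N ∫_A f(ank) da dn dk`, where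
`da` is `dt` for `a = a(t)`, `dn` is Lebesgue measure for `n = n(x)` and `dk` has total mass `1`. -/
def haarG (𝕂 : Type) [RCLike 𝕂] [MeasureSpace 𝕂] : Measure (G 𝕂) :=
  Measure.map (fun p : ℝ × 𝕂 × K 𝕂 => a 𝕂 p.1 * n p.2.1 * (p.2.2 : G 𝕂))
    ((volume : Measure ℝ).prod ((volume : Measure 𝕂).prod (haarProb (K 𝕂))))

/-- The Haar measure of `D = AT` (as a measure on `G` carried by `D`): the product of `da` and the
Haar probability measure of `T`. -/
def haarD (𝕂 : Type) [RCLike 𝕂] : Measure (G 𝕂) :=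
  Measure.map (fun p : ℝ × T 𝕂 => a 𝕂 p.1 * (p.2 : G 𝕂))
    ((volume : Measure ℝ).prod (haarProb (T 𝕂)))

/-- The Haar probability measure of `K` (as a measure on `G` carried by `K`). -/
def haarK (𝕂 : Type) [RCLike 𝕂] : Measure (G 𝕂) :=
  Measure.map (fun k : K 𝕂 => (k : G 𝕂)) (haarProb (K 𝕂))

/-! ### Test functions -/

/-- `u ∈ C_c^∞(K\G/K)`. Smoothness refers to `G` as a closed submanifold of the space of matrices:
the smooth functions on it are the restrictions of smooth functions of the four entries. -/
structure IsSphericalTestFunction {𝕂 : Type} [RCLike 𝕂] (u : G 𝕂 → ℂ) : Prop where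
  smooth : ∃ U : (Fin 2 → Fin 2 → 𝕂) → ℂ, ContDiff ℝ ∞ U ∧ ∀ g : G 𝕂, u g = U fun i j => g i j
  compactSupport : HasCompactSupport u
  biinvariant : ∀ k₁ ∈ K 𝕂, ∀ k₂ ∈ K 𝕂, ∀ g, u (k₁ * g * k₂) = u g

/-- The function `g ↦ conj (u (g⁻¹))`. -/
def check {𝕂 : Type} [RCLike 𝕂] (u : G 𝕂 → ℂ) : G 𝕂 → ℂ := fun g => conj (u g⁻¹)

/-- The convolution `(u * v)(g) = ∫_G u(h) v(h⁻¹ g) dh`. -/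
def conv {𝕂 : Type} [RCLike 𝕂] [MeasureSpace 𝕂] (u v : G 𝕂 → ℂ) : G 𝕂 → ℂ :=
  fun g => ∫ h, u h * v (h⁻¹ * g) ∂haarG 𝕂

/-- Positive definite functions on the group `G`. -/
def IsPositiveDefinite {𝕂 : Type} [RCLike 𝕂] (F : G 𝕂 → ℂ) : Prop :=
  ∀ (m : ℕ) (g : Fin m → G 𝕂) (c : Fin m → ℂ),
    (∑ i, ∑ j, c i * conj (c j) * F ((g i)⁻¹ * g j)).im = 0 ∧
    0 ≤ (∑ i, ∑ j, c i * conj (c j) * F ((g i)⁻¹ * g j)).re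

/-! ### Height and balls -/

/-- The height `H(g) ≥ 0`, with `cosh H(g) = tr(g g*) / 2`. -/
def height {𝕂 : Type} [RCLike 𝕂] (g : G 𝕂) : ℝ :=
  Real.arcosh ((1 / 2) * RCLike.re ((g : Matrix (Fin 2) (Fin 2) 𝕂) *
    (g : Matrix (Fin 2) (Fin 2) 𝕂).conjTranspose).trace)

/-- `H(k₁ a(h) k₂) = h` for `h ≥ 0`. -/
theorem height_cartan {𝕂 : Type} [RCLike 𝕂] {k₁ k₂ : G 𝕂} (h₁ : k₁ ∈ K 𝕂) (h₂ : k₂ ∈ K 𝕂)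
    {h : ℝ} (hh : 0 ≤ h) : height (k₁ * a 𝕂 h * k₂) = h := by
  have e1 : (k₁ : Matrix (Fin 2) (Fin 2) 𝕂).conjTranspose * (k₁ : Matrix (Fin 2) (Fin 2) 𝕂) = 1 :=
    Matrix.mem_unitaryGroup_iff'.mp h₁
  have e2 : (k₂ : Matrix (Fin 2) (Fin 2) 𝕂) * (k₂ : Matrix (Fin 2) (Fin 2) 𝕂).conjTranspose = 1 :=
    Matrix.mem_unitaryGroup_iff.mp h₂
  have e3 : ((k₁ * a 𝕂 h * k₂ : G 𝕂) : Matrix (Fin 2) (Fin 2) 𝕂) *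
      ((k₁ * a 𝕂 h * k₂ : G 𝕂) : Matrix (Fin 2) (Fin 2) 𝕂).conjTranspose
      = (k₁ : Matrix (Fin 2) (Fin 2) 𝕂) * (((a 𝕂 h : G 𝕂) : Matrix (Fin 2) (Fin 2) 𝕂) *
        ((a 𝕂 h : G 𝕂) : Matrix (Fin 2) (Fin 2) 𝕂).conjTranspose) *
        (k₁ : Matrix (Fin 2) (Fin 2) 𝕂).conjTranspose := by
    simp only [Matrix.SpecialLinearGroup.coe_mul, Matrix.conjTranspose_mul, Matrix.mul_assoc]
    rw [← Matrix.mul_assoc (k₂ : Matrix (Fin 2) (Fin 2) 𝕂), e2, Matrix.one_mul]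
  have e4 : (1 / 2) * RCLike.re (((a 𝕂 h : G 𝕂) : Matrix (Fin 2) (Fin 2) 𝕂) *
        ((a 𝕂 h : G 𝕂) : Matrix (Fin 2) (Fin 2) 𝕂).conjTranspose).trace = Real.cosh h := by
    simp only [a, Matrix.trace_fin_two, Matrix.mul_apply, Fin.sum_univ_two,
      Matrix.conjTranspose_apply]
    simp [← RCLike.ofReal_mul, ← Real.exp_add, Real.cosh_eq, -map_mul]
    ring_nf
  rw [height, e3, Matrix.trace_mul_comm, ← Matrix.mul_assoc, e1, Matrix.one_mul, e4,
    Real.arcosh_cosh hh]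

/-- The ball `B(R) = {g : H(g) ≤ R}`. -/
def ball (𝕂 : Type) [RCLike 𝕂] (R : ℝ) : Set (G 𝕂) := {g | height g ≤ R}

/-! ### Spherical functions and the spherical transform -/

/-- The number `y > 0` with `g ∈ N a(log y) K`; it is `1 / (|c|² + |d|²)` for the bottom
row `(c, d)` of `g`. -/
def iwasawaY {𝕂 : Type} [RCLike 𝕂] (g : G 𝕂) : ℝ := (‖g 1 0‖ ^ 2 + ‖g 1 1‖ ^ 2)⁻¹

theorem iwasawaY_eq {𝕂 : Type} [RCLike 𝕂] (x : 𝕂) (t : ℝ) {k : G 𝕂} (hk : k ∈ K 𝕂) :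
    iwasawaY (n x * a 𝕂 t * k) = Real.exp t := by
  have e : (k : Matrix (Fin 2) (Fin 2) 𝕂) * (k : Matrix (Fin 2) (Fin 2) 𝕂).conjTranspose = 1 :=
    Matrix.mem_unitaryGroup_iff.mp hk
  have e1 := congrFun (congrFun e 1) 1
  simp only [Matrix.mul_apply, Fin.sum_univ_two, Matrix.conjTranspose_apply, Matrix.one_apply_eq,
    RCLike.star_def, RCLike.mul_conj] at e1
  have e2 : ‖k 1 0‖ ^ 2 + ‖k 1 1‖ ^ 2 = 1 := by exact_mod_cast e1
  have e3 : ∀ j, (n x * a 𝕂 t * k : G 𝕂) 1 j = ((Real.exp (-t / 2) : ℝ) : 𝕂) * k 1 j := by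
    intro j
    simp only [Matrix.SpecialLinearGroup.coe_mul, coe_n, coe_a, Matrix.mul_apply,
      Fin.sum_univ_two]
    simp
  rw [iwasawaY, e3, e3, norm_mul, norm_mul, mul_pow, mul_pow, ← mul_add, e2, mul_one,
    RCLike.norm_ofReal, abs_of_pos (Real.exp_pos _), ← Real.exp_nat_mul, ← Real.exp_neg]
  congr 1
  push_cast
  ring

/-- The elementary spherical function `φ_s` of normalized Casimir eigenvalue `1/4 - s²`, as the matrix
coefficient `⟨π_s(g) v, v⟩` of the principal series induced from `diag(y^{1/2}, y^{-1/2}) ↦ |y|_𝕂^s`.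
In the induced model the `K`-invariant unit vector is `v(g) = |y(g)|_𝕂^{s + 1/2}`, and the matrix
coefficient is `∫_K v(kg) dk`. -/
def phi {𝕂 : Type} [RCLike 𝕂] (s : ℂ) (g : G 𝕂) : ℂ :=
  ∫ k : K 𝕂, (((iwasawaY ((k : G 𝕂) * g)) ^ rho 𝕂 : ℝ) : ℂ) ^ (s + 1 / 2) ∂haarProb (K 𝕂)

/-- The spherical transform `f̂(s) = ∫_G f(g) φ_s(g) dg`. -/
def sphericalTransform {𝕂 : Type} [RCLike 𝕂] [MeasureSpace 𝕂] (f : G 𝕂 → ℂ) (s : ℂ) : ℂ :=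
  ∫ g, f g * phi s g ∂haarG 𝕂

/-! ### Orbital integrals -/

/-- The Weyl discriminant `Δ(γ) = (w - w⁻¹)² = tr(γ)² - 4`, where `w, w⁻¹` are the eigenvalues. -/
def weylDisc {𝕂 : Type} [RCLike 𝕂] (γ : G 𝕂) : 𝕂 :=
  (γ : Matrix (Fin 2) (Fin 2) 𝕂).trace ^ 2 - 4

/-- Regular semisimple elements: the eigenvalues `w, w⁻¹` are distinct, that is `Δ(γ) ≠ 0`. -/
def IsRegularSemisimple {𝕂 : Type} [RCLike 𝕂] (γ : G 𝕂) : Prop := weylDisc γ ≠ 0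

/-- The centralizer `G_γ`. -/
def centr {𝕂 : Type} [RCLike 𝕂] (γ : G 𝕂) : Subgroup (G 𝕂) := Subgroup.centralizer {γ}

/-- The space of cosets `G_γ g`, that is `G_γ\G`, with the quotient `σ`-algebra. -/
abbrev CosetSpace {𝕂 : Type} [RCLike 𝕂] (γ : G 𝕂) : Type :=
  Quotient (QuotientGroup.rightRel (centr γ))

/-- `μ` is the Haar measure of `G_γ` (as a measure on `G` carried by `G_γ`): an inner automorphism
`h ↦ x h x⁻¹` maps `G_γ` to `D` or to `K`, and `μ` is the measure transported back from there. -/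
def IsCentralizerMeasure {𝕂 : Type} [RCLike 𝕂] (γ : G 𝕂) (μ : Measure (G 𝕂)) : Prop :=
  (∃ x : G 𝕂, (∀ h, h ∈ centr γ ↔ x * h * x⁻¹ ∈ D 𝕂) ∧
    μ = Measure.map (fun d => x⁻¹ * d * x) (haarD 𝕂)) ∨
  (∃ x : G 𝕂, (∀ h, h ∈ centr γ ↔ x * h * x⁻¹ ∈ K 𝕂) ∧
    μ = Measure.map (fun k => x⁻¹ * k * x) (haarK 𝕂))

/-- `ν` is the quotient measure on `G_γ\G` of `dg` by the measure `μ = dh` on `G_γ`: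
`∫_G f(g) dg = ∫_{G_γ\G} (∫_{G_γ} f(hg) dh) dġ`. The formula is required for all nonnegative Borel
functions `f`, which determines `ν`; it then holds for `f ∈ C_c(G)`, and the right invariance of `ν`
follows from that of `dg`. -/
def IsQuotientMeasure {𝕂 : Type} [RCLike 𝕂] [MeasureSpace 𝕂] (γ : G 𝕂) (μ : Measure (G 𝕂))
    (ν : Measure (CosetSpace γ)) : Prop :=
  ∀ f : G 𝕂 → ℝ≥0∞, Measurable f →
    ∫⁻ g, f g ∂haarG 𝕂 = ∫⁻ q : CosetSpace γ, ∫⁻ h, f (h * q.out) ∂μ ∂ν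

/-- The orbital integral `O(γ, f) = ∫_{G_γ\G} f(g⁻¹ γ g) dġ` exists (as an absolutely convergent
integral) and has the value `O`. -/
def HasOrbitalIntegral {𝕂 : Type} [RCLike 𝕂] [MeasureSpace 𝕂] (γ : G 𝕂) (f : G 𝕂 → ℂ) (O : ℂ) :
    Prop :=
  ∃ (μ : Measure (G 𝕂)) (ν : Measure (CosetSpace γ)),
    IsCentralizerMeasure γ μ ∧ IsQuotientMeasure γ μ ν ∧
    Integrable (fun q : CosetSpace γ => f ((q.out)⁻¹ * γ * q.out)) ν ∧
    ∫ q : CosetSpace γ, f ((q.out)⁻¹ * γ * q.out) ∂ν = O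

end SL2

end

/-! Everything is governed by the Abel transform `abel f s = e^{ρs/2} ∫ f(a(s)n(x)) dx` of
bi-`K`-invariant functions. It turns the spherical transform at `iτ` into the Fourier transform at
frequency `ρτ` (`sphericalTransform_eq_abel`), and it turns `u * ǔ` into an autocorrelation on the
real line (`abel_autocorr`). So `u` is chosen through its Abel transform `A(s) = cos(ρts) bump(s)`,
where `bump` is a fixed even cutoff supported in `[-1/2, 1/2]`. Then `F̂(iτ) = |Â(ρτ)|²`, and this
stays away from `0` for `|τ - t| ≤ 1`: the peak of `Â` near `ρt` dominates, because the cosine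
transform of a decreasing even bump is never very negative (`integral_cos_mul_cos_mul_bump_ge`).
Moreover `|abel F| ≤ 1` for all `t`.

This uniform bound controls the orbital integrals. For diagonalizable `γ` the normalized orbital
integral is, in absolute value, a value of `abel F` (`exists_hasOrbitalIntegral_of_diagonalizable`).
For elliptic `γ`, which occur only over `ℝ`, it is an average of values of `abel F` against a
Poisson kernel, so it costs only a factor `π` (`abs_integral_conj_rot_le`).

The sup norm of `F` is at most `‖u‖₂²`. Write `u = φ(cosh H)` and `A(s) = ψ(cosh s)`; the Abel
equation becomes `∫ φ(v + |x|²/2) dx = ψ(v)`. Over `ℂ` it is solved by a multiple of `ψ'`, over `ℝ`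
by a line integral of `ψ'`, which acts as a half-derivative. Since `ψ` oscillates with frequency
about `|t|`, the square of `φ` has size `|t|^ρ`, up to a power of `v - 1` that is singular at the
identity but integrable there (`exists_radial_real`, `exists_radial_complex`).

Positive definiteness, support and smoothness are those of any `u * ǔ`. The left invariance of the
measure, which is given only in Iwasawa coordinates, is checked on generators of `G`. -/

noncomputable section

namespace SL2

/-! ### The radial coordinate `cH = cosh H` and computations in the subgroups `A` and `N`. -/

section Invariants

variable {𝕂 : Type} [RCLike 𝕂]

/-- The matrix of `g` has entries with `cH g = (∑ |g i j|²) / 2 = cosh (height g)`. -/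
def cH (g : G 𝕂) : ℝ := (‖g 0 0‖ ^ 2 + ‖g 0 1‖ ^ 2 + ‖g 1 0‖ ^ 2 + ‖g 1 1‖ ^ 2) / 2

theorem re_mul_star (z : 𝕂) : RCLike.re (z * star z) = ‖z‖ ^ 2 := by
  rw [RCLike.star_def, RCLike.mul_conj, ← RCLike.ofReal_pow, RCLike.ofReal_re]

theorem cH_eq_trace (g : G 𝕂) : cH g = (1 / 2) * RCLike.re ((g : Matrix (Fin 2) (Fin 2) 𝕂) *
    (g : Matrix (Fin 2) (Fin 2) 𝕂).conjTranspose).trace := by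
  simp only [Matrix.trace_fin_two, Matrix.mul_apply, Fin.sum_univ_two,
    Matrix.conjTranspose_apply, map_add, re_mul_star, cH]
  ring

theorem height_eq (g : G 𝕂) : height g = Real.arcosh (cH g) := by rw [cH_eq_trace, height]

theorem continuous_cH : Continuous (cH : G 𝕂 → ℝ) := by
  unfold cH; fun_prop

theorem mem_K_iff (k : G 𝕂) : k ∈ K 𝕂 ↔
    (k : Matrix (Fin 2) (Fin 2) 𝕂) * (k : Matrix (Fin 2) (Fin 2) 𝕂).conjTranspose = 1 :=
  Matrix.mem_unitaryGroup_iff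

theorem cH_mul_K (g : G 𝕂) {k : G 𝕂} (hk : k ∈ K 𝕂) : cH (g * k) = cH g := by
  rw [cH_eq_trace, cH_eq_trace, Matrix.SpecialLinearGroup.coe_mul, Matrix.conjTranspose_mul,
    Matrix.mul_assoc, ← Matrix.mul_assoc (k : Matrix (Fin 2) (Fin 2) 𝕂), (mem_K_iff k).1 hk,
    Matrix.one_mul]

theorem inv_apply (g : G 𝕂) : g⁻¹ 0 0 = g 1 1 ∧ g⁻¹ 0 1 = -g 0 1 ∧ g⁻¹ 1 0 = -g 1 0 ∧
    g⁻¹ 1 1 = g 0 0 := by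
  simp [Matrix.SpecialLinearGroup.coe_inv, Matrix.adjugate_fin_two]

theorem cH_inv (g : G 𝕂) : cH g⁻¹ = cH g := by
  obtain ⟨h1, h2, h3, h4⟩ := inv_apply g
  simp only [cH, h1, h2, h3, h4, norm_neg]
  ring

theorem cH_K_mul (g : G 𝕂) {k : G 𝕂} (hk : k ∈ K 𝕂) : cH (k * g) = cH g := by
  rw [← cH_inv, mul_inv_rev, cH_mul_K _ (inv_mem hk), cH_inv]

theorem mul_apply' (g h : G 𝕂) (i j : Fin 2) : (g * h) i j = g i 0 * h 0 j + g i 1 * h 1 j := by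
  simp [Matrix.mul_apply, Fin.sum_univ_two]

theorem norm_sq_add_le (a b c d : 𝕂) :
    ‖a * b + c * d‖ ^ 2 ≤ (‖a‖ ^ 2 + ‖c‖ ^ 2) * (‖b‖ ^ 2 + ‖d‖ ^ 2) := by
  have h : ‖a * b + c * d‖ ≤ ‖a‖ * ‖b‖ + ‖c‖ * ‖d‖ := by
    simpa using norm_add_le (a * b) (c * d)
  have h' := pow_le_pow_left₀ (norm_nonneg _) h 2
  nlinarith [sq_nonneg (‖a‖ * ‖d‖ - ‖c‖ * ‖b‖)]

/-- `2 * cH` is the squared Frobenius norm, which is submultiplicative by Cauchy-Schwarz in each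
entry. This controls the supports of convolutions. -/
theorem cH_mul_le (g h : G 𝕂) : cH (g * h) ≤ 2 * cH g * cH h := by
  simp only [cH, mul_apply']
  have h1 := norm_sq_add_le (g 0 0) (h 0 0) (g 0 1) (h 1 0)
  have h2 := norm_sq_add_le (g 0 0) (h 0 1) (g 0 1) (h 1 1)
  have h3 := norm_sq_add_le (g 1 0) (h 0 0) (g 1 1) (h 1 0)
  have h4 := norm_sq_add_le (g 1 0) (h 0 1) (g 1 1) (h 1 1)
  nlinarith

theorem det_eq (g : G 𝕂) : g 0 0 * g 1 1 - g 0 1 * g 1 0 = 1 := by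
  have := g.2
  rwa [Matrix.det_fin_two] at this

/-- AM-GM applied to the two products in `det g = 1`. -/
theorem one_le_cH (g : G 𝕂) : 1 ≤ cH g := by
  have h : ‖g 0 0 * g 1 1 - g 0 1 * g 1 0‖ = 1 := by rw [det_eq]; simp
  have h2 : ‖g 0 0 * g 1 1 - g 0 1 * g 1 0‖ ≤ ‖g 0 0‖ * ‖g 1 1‖ + ‖g 0 1‖ * ‖g 1 0‖ := by
    simpa using norm_sub_le (g 0 0 * g 1 1) (g 0 1 * g 1 0)
  unfold cH
  nlinarith [sq_nonneg (‖g 0 0‖ - ‖g 1 1‖), sq_nonneg (‖g 0 1‖ - ‖g 1 0‖)]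

theorem height_le_iff (g : G 𝕂) {R : ℝ} (hR : 0 ≤ R) : height g ≤ R ↔ cH g ≤ Real.cosh R := by
  have h1 := one_le_cH g
  have h2 := Real.one_le_cosh R
  rw [height_eq, ← Real.arcosh_cosh hR, Real.arcosh_le_arcosh (by linarith)
    (by linarith), Real.arcosh_cosh hR]

theorem isCompact_cH_le (R : ℝ) : IsCompact {g : G 𝕂 | cH g ≤ R} := by
  have he : Topology.IsClosedEmbedding
      ((↑) : G 𝕂 → Matrix (Fin 2) (Fin 2) 𝕂) :=
    Matrix.SpecialLinearGroup.isClosedEmbedding_val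
  have hpi : IsCompact (Set.univ.pi fun _ : Fin 2 => Set.univ.pi fun _ : Fin 2 =>
      Metric.closedBall (0 : 𝕂) (2 * |R| + 1)) :=
    isCompact_univ_pi fun _ => isCompact_univ_pi fun _ => isCompact_closedBall _ _
  refine (he.isCompact_preimage hpi).of_isClosed_subset
    (isClosed_le continuous_cH continuous_const) ?_
  intro (g : G 𝕂) hg i _ j _
  have hg' : cH g ≤ R := hg
  unfold cH at hg'
  have hR := le_abs_self R
  have hR0 := abs_nonneg R
  rw [mem_closedBall_zero_iff]
  refine le_of_sq_le_sq ?_ (by positivity)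
  fin_cases i <;> fin_cases j <;> simp <;>
    nlinarith [sq_nonneg ‖g 0 0‖, sq_nonneg ‖g 0 1‖, sq_nonneg ‖g 1 0‖, sq_nonneg ‖g 1 1‖]

theorem a_apply (t : ℝ) : a 𝕂 t 0 0 = ((Real.exp (t / 2) : ℝ) : 𝕂) ∧ a 𝕂 t 0 1 = 0 ∧
    a 𝕂 t 1 0 = 0 ∧ a 𝕂 t 1 1 = ((Real.exp (-t / 2) : ℝ) : 𝕂) := by
  simp [coe_a]

theorem n_apply (x : 𝕂) : n x 0 0 = 1 ∧ n x 0 1 = x ∧ n x 1 0 = 0 ∧ n x 1 1 = 1 := by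
  simp [coe_n]

theorem G_ext {g h : G 𝕂} (h00 : g 0 0 = h 0 0) (h01 : g 0 1 = h 0 1) (h10 : g 1 0 = h 1 0)
    (h11 : g 1 1 = h 1 1) : g = h := by
  ext i j
  fin_cases i <;> fin_cases j <;> assumption

theorem an_apply (t : ℝ) (x : 𝕂) : (a 𝕂 t * n x) 0 0 = ((Real.exp (t / 2) : ℝ) : 𝕂) ∧
    (a 𝕂 t * n x) 0 1 = ((Real.exp (t / 2) : ℝ) : 𝕂) * x ∧ (a 𝕂 t * n x) 1 0 = 0 ∧
    (a 𝕂 t * n x) 1 1 = ((Real.exp (-t / 2) : ℝ) : 𝕂) := by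
  obtain ⟨h1, h2, h3, h4⟩ := a_apply (𝕂 := 𝕂) t
  obtain ⟨k1, k2, k3, k4⟩ := n_apply x
  simp only [mul_apply', h1, h2, h3, h4, k1, k2, k3, k4]
  simp

theorem exp_half_sq (t : ℝ) : Real.exp (t / 2) ^ 2 = Real.exp t := by
  rw [← Real.exp_nat_mul]; push_cast; ring_nf

theorem exp_half_mul (t : ℝ) : Real.exp (t / 2) * Real.exp (-t / 2) = 1 := by
  rw [← Real.exp_add]; ring_nf; simp

theorem ofReal_exp_half_mul (t : ℝ) :
    ((Real.exp (t / 2) : ℝ) : 𝕂) * ((Real.exp (-t / 2) : ℝ) : 𝕂) = 1 := by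
  rw [← RCLike.ofReal_mul, exp_half_mul, RCLike.ofReal_one]

theorem cH_an (t : ℝ) (x : 𝕂) :
    cH (a 𝕂 t * n x) = Real.cosh t + Real.exp t * ‖x‖ ^ 2 / 2 := by
  obtain ⟨h1, h2, h3, h4⟩ := an_apply t x
  rw [cH, h1, h2, h3, h4]
  simp only [norm_mul, RCLike.norm_ofReal, abs_of_pos (Real.exp_pos _), mul_pow, exp_half_sq,
    norm_zero, Real.cosh_eq]
  ring

theorem a_add (s t : ℝ) : a 𝕂 (s + t) = a 𝕂 s * a 𝕂 t := by
  obtain ⟨h1, h2, h3, h4⟩ := a_apply (𝕂 := 𝕂) t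
  obtain ⟨k1, k2, k3, k4⟩ := a_apply (𝕂 := 𝕂) s
  obtain ⟨l1, l2, l3, l4⟩ := a_apply (𝕂 := 𝕂) (s + t)
  apply G_ext <;> simp only [mul_apply', h1, h2, h3, h4, k1, k2, k3, k4, l1, l2, l3, l4] <;>
    simp [← RCLike.ofReal_mul, ← Real.exp_add] <;> ring_nf

theorem n_add (x y : 𝕂) : n (x + y) = n x * n y := by
  obtain ⟨h1, h2, h3, h4⟩ := n_apply x
  obtain ⟨k1, k2, k3, k4⟩ := n_apply y
  obtain ⟨l1, l2, l3, l4⟩ := n_apply (x + y)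
  apply G_ext <;> simp only [mul_apply', h1, h2, h3, h4, k1, k2, k3, k4, l1, l2, l3, l4] <;>
    simp [add_comm]

theorem a_zero : a 𝕂 0 = 1 := by
  obtain ⟨h1, h2, h3, h4⟩ := a_apply (𝕂 := 𝕂) 0
  apply G_ext <;> simp [h1, h2, h3, h4]

theorem n_zero : n (0 : 𝕂) = 1 := by
  obtain ⟨h1, h2, h3, h4⟩ := n_apply (0 : 𝕂)
  apply G_ext <;> simp [h1, h2, h3, h4]

theorem a_neg (t : ℝ) : a 𝕂 (-t) = (a 𝕂 t)⁻¹ := by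
  rw [eq_inv_iff_mul_eq_one, ← a_add, neg_add_cancel, a_zero]

theorem n_neg (x : 𝕂) : n (-x) = (n x)⁻¹ := by
  rw [eq_inv_iff_mul_eq_one, ← n_add, neg_add_cancel, n_zero]

theorem n_mul_a (x : 𝕂) (t : ℝ) : n x * a 𝕂 t = a 𝕂 t * n (((Real.exp (-t) : ℝ) : 𝕂) * x) := by
  obtain ⟨h1, h2, h3, h4⟩ := a_apply (𝕂 := 𝕂) t
  obtain ⟨k1, k2, k3, k4⟩ := n_apply x
  obtain ⟨l1, l2, l3, l4⟩ := an_apply t (((Real.exp (-t) : ℝ) : 𝕂) * x)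
  have e : x * ((Real.exp (-t / 2) : ℝ) : 𝕂) =
      ((Real.exp (t / 2) : ℝ) : 𝕂) * (((Real.exp (-t) : ℝ) : 𝕂) * x) := by
    rw [← mul_assoc, ← RCLike.ofReal_mul, ← Real.exp_add, mul_comm]
    congr 3
    ring
  apply G_ext
  · rw [l1, mul_apply', h1, h3, k1]; simp
  · rw [l2, mul_apply', h2, h4, k2, mul_zero, zero_add, e]
  · rw [l3, mul_apply', h1, h3, k3]; simp
  · rw [l4, mul_apply', h2, h4, k4]; simp

/-- The Haar measure uses the order `ANK` and `iwasawaY_eq` the order `NAK`. Passing `a(t)` across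
`n(x)` rescales `x` but leaves `t` alone. -/
theorem iwasawaY_an (t : ℝ) (x : 𝕂) {k : G 𝕂} (hk : k ∈ K 𝕂) :
    iwasawaY (a 𝕂 t * n x * k) = Real.exp t := by
  have h := n_mul_a (((Real.exp t : ℝ) : 𝕂) * x) t
  rw [← mul_assoc, ← RCLike.ofReal_mul, ← Real.exp_add, neg_add_cancel, Real.exp_zero,
    RCLike.ofReal_one, one_mul] at h
  rw [← h, iwasawaY_eq _ _ hk]

end Invariants

end SL2
end

noncomputable section

namespace SL2

/-! ### Iwasawa coordinates, the action of the Weyl element on them, and Bruhat generators. -/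

section Decompositions

variable {𝕂 : Type} [RCLike 𝕂]

theorem mem_K_iff_entries (k : G 𝕂) : k ∈ K 𝕂 ↔ k 0 0 = conj (k 1 1) ∧ k 0 1 = -conj (k 1 0) := by
  obtain ⟨i1, i2, i3, i4⟩ := inv_apply k
  have h : k ∈ K 𝕂 ↔ ((k⁻¹ : G 𝕂) : Matrix (Fin 2) (Fin 2) 𝕂) =
      (k : Matrix (Fin 2) (Fin 2) 𝕂).conjTranspose := by
    have e : (k : Matrix (Fin 2) (Fin 2) 𝕂) * ((k⁻¹ : G 𝕂) : Matrix (Fin 2) (Fin 2) 𝕂) = 1 := by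
      rw [← Matrix.SpecialLinearGroup.coe_mul]; simp
    have e' : ((k⁻¹ : G 𝕂) : Matrix (Fin 2) (Fin 2) 𝕂) * (k : Matrix (Fin 2) (Fin 2) 𝕂) = 1 := by
      rw [← Matrix.SpecialLinearGroup.coe_mul]; simp
    rw [mem_K_iff]
    exact ⟨fun h => left_inv_eq_right_inv e' h, fun h => h ▸ e⟩
  rw [h]
  constructor
  · intro h
    have h0 := congrFun (congrFun h 1) 1
    have h1 := congrFun (congrFun h 0) 1
    rw [i4] at h0
    rw [i2] at h1
    rw [Matrix.conjTranspose_apply, RCLike.star_def] at h0 h1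
    exact ⟨h0, by rw [← h1, neg_neg]⟩
  · rintro ⟨h0, h1⟩
    ext i j
    rw [Matrix.conjTranspose_apply, RCLike.star_def]
    fin_cases i <;> fin_cases j
    · exact i1.trans (by simp [h0])
    · exact i2.trans (by simp [h1])
    · exact i3.trans (by simp [h1])
    · exact i4.trans (by simp [h0])

/-- Right multiplication by `K` preserves the Hermitian products of the rows. For `a(t)n(x)` the
bottom row has squared norm `e^{-t}` and the product of the top row with the bottom one is `x`, so
these two invariants must be the Iwasawa coordinates of `g`. -/
theorem a_n_inv_mul_mem_K (g : G 𝕂) :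
    (a 𝕂 (Real.log (iwasawaY g)) * n (g 0 0 * conj (g 1 0) + g 0 1 * conj (g 1 1)))⁻¹ * g ∈ K 𝕂 := by
  set N : ℝ := ‖g 1 0‖ ^ 2 + ‖g 1 1‖ ^ 2 with hN
  set x := g 0 0 * conj (g 1 0) + g 0 1 * conj (g 1 1) with hx
  have hN0 : 0 < N := by
    rcases eq_or_ne (g 1 0) 0 with h | h
    · rcases eq_or_ne (g 1 1) 0 with h' | h'
      · have := det_eq g
        simp [h, h'] at this
      · have := norm_pos_iff.2 h'
        positivity
    · have := norm_pos_iff.2 h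
      positivity
  set t := Real.log (iwasawaY g) with ht
  have hexp : Real.exp (-t) = N := by
    rw [ht, iwasawaY, ← hN, Real.log_inv, neg_neg, Real.exp_log hN0]
  have hE : ((Real.exp (-t / 2) : ℝ) : 𝕂) * ((Real.exp (-t / 2) : ℝ) : 𝕂) = (N : 𝕂) := by
    rw [← RCLike.ofReal_mul, ← sq, exp_half_sq, hexp]
  have hNe : (N : 𝕂) = g 1 0 * conj (g 1 0) + g 1 1 * conj (g 1 1) := by
    rw [RCLike.mul_conj, RCLike.mul_conj, hN]; push_cast; rfl
  obtain ⟨l1, l2, l3, l4⟩ := an_apply t x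
  obtain ⟨i1, i2, i3, i4⟩ := inv_apply (a 𝕂 t * n x)
  have hu := ofReal_exp_half_mul (𝕂 := 𝕂) t
  have hdet := det_eq g
  rw [mem_K_iff_entries]
  simp only [mul_apply', i1, i2, i3, i4, l1, l2, l3, l4]
  generalize ((Real.exp (-t / 2) : ℝ) : 𝕂) = v at *
  have hcu : conj ((Real.exp (t / 2) : ℝ) : 𝕂) = ((Real.exp (t / 2) : ℝ) : 𝕂) := RCLike.conj_ofReal _
  generalize ((Real.exp (t / 2) : ℝ) : 𝕂) = u at *
  have hu2 : u * u * (N : 𝕂) = 1 := by rw [← hE]; linear_combination (u * v + 1) * hu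
  have hv : v = u * (N : 𝕂) := by rw [← hE]; linear_combination (-v) * hu
  rw [hv, hx, hNe]
  constructor
  · simp only [map_add, map_mul, map_neg, map_zero, hcu]
    linear_combination (u * conj (g 1 1)) * hdet
  · simp only [map_add, map_mul, map_neg, map_zero, hcu]
    linear_combination (-u * conj (g 1 0)) * hdet

theorem exists_iwasawa (g : G 𝕂) : ∃ k ∈ K 𝕂,
    g = a 𝕂 (Real.log (iwasawaY g)) * n (g 0 0 * conj (g 1 0) + g 0 1 * conj (g 1 1)) * k :=
  ⟨_, a_n_inv_mul_mem_K g, by rw [mul_inv_cancel_left]⟩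

/-- A representative of the nontrivial element of the Weyl group. -/
def weyl (𝕂 : Type) [RCLike 𝕂] : G 𝕂 := ⟨!![0, -1; 1, 0], by simp [Matrix.det_fin_two_of]⟩

theorem weyl_apply : weyl 𝕂 0 0 = 0 ∧ weyl 𝕂 0 1 = -1 ∧ weyl 𝕂 1 0 = 1 ∧ weyl 𝕂 1 1 = 0 := by
  simp [weyl]

theorem weyl_mem_K : weyl 𝕂 ∈ K 𝕂 := by
  obtain ⟨h1, h2, h3, h4⟩ := weyl_apply (𝕂 := 𝕂)
  rw [mem_K_iff_entries, h1, h2, h3, h4]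
  simp

/-- In Iwasawa coordinates the Weyl element acts, for fixed `x`, by a reflection and a translation
in `t`, and it moves `x` by an isometry. Both visibly preserve Lebesgue measure, which is what the
invariance of `haarG` needs. -/
theorem exists_weyl_mul (t : ℝ) (x : 𝕂) : ∃ k ∈ K 𝕂, weyl 𝕂 * (a 𝕂 t * n x) =
    a 𝕂 (-(t + Real.log (1 + ‖x‖ ^ 2))) * n (-conj x) * k := by
  obtain ⟨l1, l2, l3, l4⟩ := an_apply t x
  obtain ⟨h1, h2, h3, h4⟩ := weyl_apply (𝕂 := 𝕂)
  have e00 : (weyl 𝕂 * (a 𝕂 t * n x)) 0 0 = 0 := by rw [mul_apply', h1, h2, l3]; simp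
  have e01 : (weyl 𝕂 * (a 𝕂 t * n x)) 0 1 = -((Real.exp (-t / 2) : ℝ) : 𝕂) := by
    rw [mul_apply', h1, h2, l4]; simp
  have e10 : (weyl 𝕂 * (a 𝕂 t * n x)) 1 0 = ((Real.exp (t / 2) : ℝ) : 𝕂) := by
    rw [mul_apply', h3, h4, l1]; simp
  have e11 : (weyl 𝕂 * (a 𝕂 t * n x)) 1 1 = ((Real.exp (t / 2) : ℝ) : 𝕂) * x := by
    rw [mul_apply', h3, h4, l2]; simp
  obtain ⟨k, hk, e⟩ := exists_iwasawa (weyl 𝕂 * (a 𝕂 t * n x))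
  refine ⟨k, hk, ?_⟩
  rw [e]
  congr 3
  · rw [iwasawaY, e10, e11, norm_mul, RCLike.norm_ofReal, abs_of_pos (Real.exp_pos _), mul_pow,
      exp_half_sq, Real.log_inv, ← mul_one_add, Real.log_mul (Real.exp_pos _).ne' (by positivity),
      Real.log_exp]
  · rw [e00, e01, e10, e11, zero_mul, zero_add, map_mul, RCLike.conj_ofReal, ← mul_assoc, neg_mul,
      mul_comm ((Real.exp (-t / 2) : ℝ) : 𝕂), ofReal_exp_half_mul, neg_one_mul]

theorem D_mul_comm {d e : G 𝕂} (hd : d ∈ D 𝕂) (he : e ∈ D 𝕂) : d * e = e * d := by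
  obtain ⟨h1, h2⟩ := hd
  obtain ⟨h3, h4⟩ := he
  apply G_ext <;> simp [mul_apply', h1, h2, h3, h4, mul_comm]

theorem a_mem_D (t : ℝ) : a 𝕂 t ∈ D 𝕂 := ⟨(a_apply t).2.1, (a_apply t).2.2.1⟩

theorem D_mul_n {d : G 𝕂} (hd : d ∈ D 𝕂) (x : 𝕂) : d * n x = n (d 0 0 ^ 2 * x) * d := by
  obtain ⟨h1, h2⟩ := hd
  have h := det_eq d
  rw [h1, zero_mul, sub_zero] at h
  obtain ⟨k1, k2, k3, k4⟩ := n_apply x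
  obtain ⟨l1, l2, l3, l4⟩ := n_apply (d 0 0 ^ 2 * x)
  apply G_ext
  · simp only [mul_apply', h1, h2, k1, k3, l1, l2]; simp
  · simp only [mul_apply', h1, k2, k4, l1, l2]
    linear_combination (-d 0 0 * x) * h
  · simp only [mul_apply', h2, k1, k3, l3, l4]; simp
  · simp only [mul_apply', h1, h2, k2, k4, l3, l4]; simp

theorem D_apply_mul {d : G 𝕂} (hd : d ∈ D 𝕂) : d 0 0 * d 1 1 = 1 := by
  have h := det_eq d
  rwa [hd.1, zero_mul, sub_zero] at h

theorem norm_T_apply {d : G 𝕂} (hd : d ∈ T 𝕂) : ‖d 0 0‖ = 1 := by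
  have h := D_apply_mul hd.1
  have h' := ((mem_K_iff_entries d).1 hd.2).1
  have h2 := congrArg norm h
  rw [norm_mul, h', RCLike.norm_conj, norm_one] at h2
  rw [h', RCLike.norm_conj]
  nlinarith [norm_nonneg (d 1 1)]

theorem exists_D_decomposition {d : G 𝕂} (hd : d ∈ D 𝕂) :
    ∃ τ ∈ T 𝕂, d = a 𝕂 (2 * Real.log ‖d 0 0‖) * τ := by
  have h := D_apply_mul hd
  have h0 : d 0 0 ≠ 0 := left_ne_zero_of_mul_eq_one h
  have hn : 0 < ‖d 0 0‖ := norm_pos_iff.2 h0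
  refine ⟨(a 𝕂 (2 * Real.log ‖d 0 0‖))⁻¹ * d,
    Subgroup.mem_inf.2 ⟨mul_mem (inv_mem (a_mem_D _)) hd, ?_⟩, by rw [mul_inv_cancel_left]⟩
  obtain ⟨l1, l2, l3, l4⟩ := a_apply (𝕂 := 𝕂) (-(2 * Real.log ‖d 0 0‖))
  have e1 : Real.exp (-(2 * Real.log ‖d 0 0‖) / 2) = ‖d 0 0‖⁻¹ := by
    rw [← Real.exp_log (inv_pos.2 hn), Real.log_inv]; ring_nf
  have e2 : Real.exp (-(-(2 * Real.log ‖d 0 0‖)) / 2) = ‖d 0 0‖ := by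
    rw [← Real.exp_log hn, Real.log_exp]; ring_nf
  have h11 : d 1 1 = (d 0 0)⁻¹ := eq_inv_of_mul_eq_one_right h
  have hc : d 0 0 * conj (d 0 0) = (‖d 0 0‖ : 𝕂) ^ 2 := RCLike.mul_conj _
  have hc0 : conj (d 0 0) ≠ 0 := by simpa using h0
  have hn' : (‖d 0 0‖ : 𝕂) ≠ 0 := by exact_mod_cast hn.ne'
  rw [← a_neg, mem_K_iff_entries]
  simp only [mul_apply', l1, l2, l3, l4, e1, e2, hd.1, hd.2, h11]
  constructor
  · simp only [zero_mul, add_zero, zero_add, map_mul, map_inv₀, RCLike.conj_ofReal]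
    field_simp
    rw [hc]
  · simp

/-- A Bruhat-type description of `G` by generators. -/
theorem generation {S : Set (G 𝕂)} (hmul : ∀ g ∈ S, ∀ h ∈ S, g * h ∈ S) (ha : ∀ t, a 𝕂 t ∈ S)
    (hn : ∀ x, n x ∈ S) (hT : ∀ τ ∈ T 𝕂, τ ∈ S) (hw : weyl 𝕂 ∈ S) (g : G 𝕂) : g ∈ S := by
  have hD : ∀ d ∈ D 𝕂, d ∈ S := by
    intro d hd
    obtain ⟨τ, hτ, e⟩ := exists_D_decomposition hd
    rw [e]
    exact hmul _ (ha _) _ (hT _ hτ)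
  have hB : ∀ g : G 𝕂, g 1 0 = 0 → g ∈ S := by
    intro g hg
    have hdet := det_eq g
    rw [hg, mul_zero, sub_zero] at hdet
    have e : g = n (g 0 1 * g 0 0) * (n (-(g 0 1 * g 0 0)) * g) := by
      rw [n_neg, mul_inv_cancel_left]
    rw [e]
    refine hmul _ (hn _) _ (hD _ ?_)
    obtain ⟨k1, k2, k3, k4⟩ := n_apply (-(g 0 1 * g 0 0))
    constructor
    · rw [mul_apply', k1, k2]
      linear_combination (-g 0 1) * hdet
    · rw [mul_apply', k3, k4, hg]; simp
  rcases eq_or_ne (g 1 0) 0 with h | h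
  · exact hB g h
  -- Bruhat cell: the unipotent factor clears the top left entry, and the inverse Weyl element then
  -- moves this zero to the bottom left.
  · have e : g = n (g 0 0 / g 1 0) * (weyl 𝕂 * ((weyl 𝕂)⁻¹ * (n (-(g 0 0 / g 1 0)) * g))) := by
      rw [mul_inv_cancel_left, n_neg, mul_inv_cancel_left]
    rw [e]
    refine hmul _ (hn _) _ (hmul _ hw _ (hB _ ?_))
    obtain ⟨k1, k2, k3, k4⟩ := n_apply (-(g 0 0 / g 1 0))
    obtain ⟨h1, h2, h3, h4⟩ := weyl_apply (𝕂 := 𝕂)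
    obtain ⟨i1, i2, i3, i4⟩ := inv_apply (weyl 𝕂)
    rw [mul_apply', i3, i4, h3, h1, mul_apply', k1, k2]
    field_simp
    ring

end Decompositions

end SL2
end

noncomputable section

namespace SL2

set_option linter.unusedSectionVars false

/-! ### Left invariance of `haarG`, verified on generators. -/

section Haar

variable {𝕂 : Type} [RCLike 𝕂]

instance instSecondCountableG : SecondCountableTopology (G 𝕂) :=
  have : SecondCountableTopology (Matrix (Fin 2) (Fin 2) 𝕂) :=
    inferInstanceAs (SecondCountableTopology (Fin 2 → Fin 2 → 𝕂))
  (Matrix.SpecialLinearGroup.isClosedEmbedding_val (R := 𝕂)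
    (n := Fin 2)).isEmbedding.secondCountableTopology

instance instIsProbabilityMeasureHaarProb (C : Subgroup (G 𝕂)) [CompactSpace C] :
    IsProbabilityMeasure (haarProb C) :=
  ⟨by
    have h := Measure.haarMeasure_self (G := C) (K₀ := ⊤)
    simpa [haarProb] using h⟩

instance instIsHaarMeasureHaarProb (C : Subgroup (G 𝕂)) [CompactSpace C] :
    (haarProb C).IsHaarMeasure := by unfold haarProb; infer_instance

theorem continuous_a : Continuous (a 𝕂) := by
  refine (Matrix.SpecialLinearGroup.isClosedEmbedding_val (R := 𝕂)
    (n := Fin 2)).isEmbedding.continuous_iff.2 ?_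
  refine continuous_matrix fun i j => ?_
  fin_cases i <;> fin_cases j <;> simp <;> fun_prop

theorem continuous_n : Continuous (n : 𝕂 → G 𝕂) := by
  refine (Matrix.SpecialLinearGroup.isClosedEmbedding_val (R := 𝕂)
    (n := Fin 2)).isEmbedding.continuous_iff.2 ?_
  refine continuous_matrix fun i j => ?_
  fin_cases i <;> fin_cases j <;> simp <;> fun_prop

theorem continuous_an : Continuous fun p : ℝ × 𝕂 => a 𝕂 p.1 * n p.2 :=
  (continuous_a.comp continuous_fst).mul (continuous_n.comp continuous_snd)

theorem continuous_ank : Continuous fun p : ℝ × 𝕂 × K 𝕂 => a 𝕂 p.1 * n p.2.1 * (p.2.2 : G 𝕂) := by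
  have := continuous_a (𝕂 := 𝕂)
  have := continuous_n (𝕂 := 𝕂)
  fun_prop

theorem lintegral_K_mul (f : G 𝕂 → ℝ≥0∞) (g : G 𝕂) {k : G 𝕂} (hk : k ∈ K 𝕂) :
    ∫⁻ l : K 𝕂, f (g * k * l) ∂haarProb (K 𝕂) = ∫⁻ l : K 𝕂, f (g * l) ∂haarProb (K 𝕂) := by
  have h := lintegral_mul_left_eq_self (μ := haarProb (K 𝕂)) (fun l : K 𝕂 => f (g * l)) ⟨k, hk⟩
  rw [← h]
  refine lintegral_congr fun l => ?_
  rw [Subgroup.coe_mul, mul_assoc]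

section LinearIsometry

variable [MeasureSpace 𝕂] [BorelSpace 𝕂] [(volume : Measure 𝕂).IsAddHaarMeasure]

/-- The image measure is again an additive Haar measure, hence a multiple of `volume`, and the
factor is `1` because the unit ball is preserved. -/
theorem measurePreserving_linearIsometryEquiv (e : 𝕂 ≃ₗᵢ[ℝ] 𝕂) :
    MeasurePreserving e (volume : Measure 𝕂) volume := by
  refine ⟨e.continuous.measurable, ?_⟩
  have h : (Measure.map e (volume : Measure 𝕂)).IsAddHaarMeasure :=
    e.toContinuousLinearEquiv.isAddHaarMeasure_map volume
  have h1 := Measure.isAddLeftInvariant_eq_smul (Measure.map e (volume : Measure 𝕂)) volume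
  have h2 := congrArg (fun μ => μ (Metric.closedBall (0 : 𝕂) 1)) h1
  have h3 : e ⁻¹' Metric.closedBall (0 : 𝕂) 1 = Metric.closedBall 0 1 := by
    ext z; simp
  simp only [Measure.smul_apply] at h2
  rw [Measure.map_apply e.continuous.measurable measurableSet_closedBall, h3] at h2
  have h4 : (volume : Measure 𝕂) (Metric.closedBall (0 : 𝕂) 1) ≠ 0 :=
    (Metric.measure_closedBall_pos _ _ one_pos).ne'
  have h5 : (volume : Measure 𝕂) (Metric.closedBall (0 : 𝕂) 1) ≠ ⊤ :=
    measure_closedBall_lt_top.ne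
  rw [h1]
  set c := Measure.addHaarScalarFactor (Measure.map e (volume : Measure 𝕂)) volume
  have h6 : (c : ℝ≥0∞) = 1 := by
    rw [ENNReal.smul_def, smul_eq_mul] at h2
    exact ((ENNReal.mul_left_inj h4 h5).1 ((one_mul _).trans h2)).symm
  rw [show c = 1 by exact_mod_cast h6, one_smul]

theorem measurePreserving_conj :
    MeasurePreserving (fun z : 𝕂 => conj z) (volume : Measure 𝕂) volume :=
  measurePreserving_linearIsometryEquiv RCLike.conjLIE

theorem measurePreserving_unit_mul {z : 𝕂} (hz : ‖z‖ = 1) :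
    MeasurePreserving (fun x : 𝕂 => z * x) (volume : Measure 𝕂) volume := by
  have hz0 : z ≠ 0 := by rintro rfl; simp at hz
  let e : 𝕂 ≃ₗᵢ[ℝ] 𝕂 :=
    { toFun := fun x => z * x
      invFun := fun x => z⁻¹ * x
      map_add' := fun x y => mul_add _ _ _
      map_smul' := fun r x => by simp
      left_inv := fun x => by simp [hz0]
      right_inv := fun x => by simp [hz0]
      norm_map' := fun x => by simp [hz] }
  exact measurePreserving_linearIsometryEquiv e

theorem lintegral_unit_mul {z : 𝕂} (hz : ‖z‖ = 1) {f : 𝕂 → ℝ≥0∞} (hf : Measurable f) :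
    ∫⁻ x, f (z * x) = ∫⁻ x, f x :=
  (measurePreserving_unit_mul hz).lintegral_comp hf

theorem lintegral_haarG {f : G 𝕂 → ℝ≥0∞} (hf : Measurable f) :
    ∫⁻ g, f g ∂haarG 𝕂 =
      ∫⁻ t : ℝ, ∫⁻ x : 𝕂, ∫⁻ k : K 𝕂, f (a 𝕂 t * n x * k) ∂haarProb (K 𝕂) := by
  have hm := continuous_ank.measurable (α := ℝ × 𝕂 × K 𝕂) (γ := G 𝕂)
  rw [haarG, lintegral_map hf hm]
  refine (lintegral_prod _ (hf.comp hm).aemeasurable).trans ?_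
  refine lintegral_congr fun t => ?_
  exact lintegral_prod _ ((hf.comp hm).comp measurable_prodMk_left).aemeasurable

theorem lintegral_haarG_mul {f : G 𝕂 → ℝ≥0∞} (hf : Measurable f) (g : G 𝕂) :
    ∫⁻ h, f (g * h) ∂haarG 𝕂 =
      ∫⁻ t : ℝ, ∫⁻ x : 𝕂, ∫⁻ k : K 𝕂, f (g * (a 𝕂 t * n x * k)) ∂haarProb (K 𝕂) :=
  lintegral_haarG (hf.comp (measurable_const_mul g))

/-- The elements by which left translation preserves `haarG`. -/
def leftInvariant (𝕂 : Type) [RCLike 𝕂] [MeasureSpace 𝕂] : Set (G 𝕂) :=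
  {g | ∀ f : G 𝕂 → ℝ≥0∞, Measurable f → ∫⁻ h, f (g * h) ∂haarG 𝕂 = ∫⁻ h, f h ∂haarG 𝕂}

theorem measurable_lintegral_K {f : G 𝕂 → ℝ≥0∞} (hf : Measurable f) :
    Measurable fun p : ℝ × 𝕂 => ∫⁻ k : K 𝕂, f (a 𝕂 p.1 * n p.2 * k) ∂haarProb (K 𝕂) := by
  have : Measurable fun q : (ℝ × 𝕂) × K 𝕂 => f (a 𝕂 q.1.1 * n q.1.2 * (q.2 : G 𝕂)) :=
    hf.comp ((continuous_an.comp continuous_fst).mul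
      (continuous_subtype_val.comp continuous_snd)).measurable
  exact this.lintegral_prod_right'

theorem leftInvariant_mul {g h : G 𝕂} (hg : g ∈ leftInvariant 𝕂) (hh : h ∈ leftInvariant 𝕂) :
    g * h ∈ leftInvariant 𝕂 := by
  intro f hf
  have h1 := hh (fun x => f (g * x)) (hf.comp (measurable_const_mul g))
  rw [← hg f hf, ← h1]
  simp only [mul_assoc]

theorem leftInvariant_a (s : ℝ) : a 𝕂 s ∈ leftInvariant 𝕂 := by
  intro f hf
  rw [lintegral_haarG hf, lintegral_haarG_mul hf]
  have h := lintegral_add_left_eq_self (μ := (volume : Measure ℝ)) (fun t => ∫⁻ x : 𝕂,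
    ∫⁻ k : K 𝕂, f (a 𝕂 t * n x * k) ∂haarProb (K 𝕂)) s
  rw [← h]
  simp only [a_add, mul_assoc]

theorem leftInvariant_n (y : 𝕂) : n y ∈ leftInvariant 𝕂 := by
  intro f hf
  rw [lintegral_haarG hf, lintegral_haarG_mul hf]
  refine lintegral_congr fun t => ?_
  have h := lintegral_add_left_eq_self (μ := (volume : Measure 𝕂)) (fun x =>
    ∫⁻ k : K 𝕂, f (a 𝕂 t * n x * k) ∂haarProb (K 𝕂)) (((Real.exp (-t) : ℝ) : 𝕂) * y)
  rw [← h]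
  simp only [n_add, ← mul_assoc, n_mul_a]

theorem leftInvariant_T {τ : G 𝕂} (hτ : τ ∈ T 𝕂) : τ ∈ leftInvariant 𝕂 := by
  intro f hf
  rw [lintegral_haarG hf, lintegral_haarG_mul hf]
  refine lintegral_congr fun t => ?_
  have hm := (measurable_lintegral_K hf).comp (measurable_prodMk_left (x := t))
  refine Eq.trans (lintegral_congr fun x => ?_)
    (lintegral_unit_mul (z := τ 0 0 ^ 2) (by rw [norm_pow, norm_T_apply hτ, one_pow]) hm)
  have e : ∀ k : G 𝕂, τ * (a 𝕂 t * n x * k) = a 𝕂 t * n (τ 0 0 ^ 2 * x) * τ * k := by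
    intro k
    rw [mul_assoc (a 𝕂 t) (n (τ 0 0 ^ 2 * x)) τ, ← D_mul_n hτ.1, ← mul_assoc (a 𝕂 t),
      ← D_mul_comm hτ.1 (a_mem_D t)]
    simp only [mul_assoc]
  simp only [e]
  exact lintegral_K_mul f _ hτ.2

theorem leftInvariant_weyl : weyl 𝕂 ∈ leftInvariant 𝕂 := by
  intro f hf
  rw [lintegral_haarG hf, lintegral_haarG_mul hf]
  set J : ℝ × 𝕂 → ℝ≥0∞ := fun p => ∫⁻ k : K 𝕂, f (a 𝕂 p.1 * n p.2 * k) ∂haarProb (K 𝕂) with hJ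
  have hJm : Measurable J := measurable_lintegral_K hf
  have e : ∀ t x, ∫⁻ k : K 𝕂, f (weyl 𝕂 * (a 𝕂 t * n x * (k : G 𝕂))) ∂haarProb (K 𝕂) =
      J (-(t + Real.log (1 + ‖x‖ ^ 2)), -conj x) := by
    intro t x
    obtain ⟨κ, hκ, h⟩ := exists_weyl_mul t x
    simp only [← mul_assoc] at h ⊢
    rw [h]
    exact lintegral_K_mul f _ hκ
  simp only [e]
  change _ = ∫⁻ t, ∫⁻ x, J (t, x)
  have hc : Measurable fun x : 𝕂 => conj x := RCLike.continuous_conj.measurable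
  have hm1 : Measurable fun p : ℝ × 𝕂 => J (-(p.1 + Real.log (1 + ‖p.2‖ ^ 2)), -conj p.2) := by
    refine hJm.comp (Measurable.prodMk ?_ ?_)
    · fun_prop
    · exact (hc.comp measurable_snd).neg
  -- The variable `t` is integrated first, since the shift `log(1 + |x|²)` is constant only when `x`
  -- is fixed.
  rw [lintegral_lintegral_swap hm1.aemeasurable,
    lintegral_lintegral_swap (f := fun t x => J (t, x)) hJm.aemeasurable]
  have e1 : ∀ x : 𝕂, ∫⁻ t : ℝ, J (-(t + Real.log (1 + ‖x‖ ^ 2)), -conj x) =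
      ∫⁻ t : ℝ, J (t, -conj x) := by
    intro x
    rw [lintegral_add_right_eq_self (μ := (volume : Measure ℝ)) (fun t => J (-t, -conj x)),
      lintegral_neg_eq_self (μ := (volume : Measure ℝ)) (fun t => J (t, -conj x))]
  simp only [e1]
  have hm2 : Measurable fun x : 𝕂 => ∫⁻ t : ℝ, J (t, x) := hJm.lintegral_prod_left'
  rw [measurePreserving_conj.lintegral_comp (f := fun x : 𝕂 => ∫⁻ t : ℝ, J (t, -x))
    (hm2.comp measurable_neg), lintegral_neg_eq_self (fun x : 𝕂 => ∫⁻ t : ℝ, J (t, x))]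

instance instIsMulLeftInvariantHaarG : (haarG 𝕂).IsMulLeftInvariant := by
  have h : ∀ g : G 𝕂, g ∈ leftInvariant 𝕂 :=
    generation (fun _ hg _ hh => leftInvariant_mul hg hh) leftInvariant_a leftInvariant_n
      (fun _ hτ => leftInvariant_T hτ) leftInvariant_weyl
  refine ⟨fun g => Measure.ext_of_lintegral _ fun f hf => ?_⟩
  rw [lintegral_map hf (measurable_const_mul g)]
  exact h g f hf

instance instSFiniteHaarG : SFinite (haarG 𝕂) := by unfold haarG; infer_instance

end LinearIsometry

end Haar
end SL2
end

noncomputable section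

namespace SL2

set_option linter.unusedSectionVars false

/-! ### Integrals over `G` of right `K`-invariant functions. -/

section Integration

variable {𝕂 : Type} [RCLike 𝕂]

theorem abs_le_two_mul_cosh (t : ℝ) : |t| ≤ 2 * Real.cosh t := by
  have h := Real.add_one_le_exp |t|
  rw [← Real.cosh_abs, Real.cosh_eq]
  have := Real.exp_pos (-|t|)
  linarith

theorem exp_neg_le_two_mul_cosh (t : ℝ) : Real.exp (-t) ≤ 2 * Real.cosh t := by
  rw [Real.cosh_eq]
  have := Real.exp_pos t
  linarith

/-- By `cH_an`, `cosh t ≤ R` bounds both `|t|` and `e^{-t}` by `2R`, and then `|x|² ≤ 2R e^{-t} ≤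
(2R)²`. Thus compact supports on `G` remain compact in the coordinates `(t, x)`. -/
theorem isCompact_cH_an_le (R : ℝ) :
    IsCompact {p : ℝ × 𝕂 | cH (a 𝕂 p.1 * n p.2) ≤ R} := by
  have hc : IsCompact (Metric.closedBall (0 : ℝ) (2 * R) ×ˢ Metric.closedBall (0 : 𝕂) (2 * R)) :=
    (isCompact_closedBall _ _).prod (isCompact_closedBall _ _)
  refine hc.of_isClosed_subset (isClosed_le (continuous_cH.comp continuous_an) continuous_const) ?_
  rintro ⟨t, x⟩ h
  have h' : Real.cosh t + Real.exp t * ‖x‖ ^ 2 / 2 ≤ R := by rw [← cH_an]; exact h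
  have h1 : Real.cosh t ≤ R := by
    have : 0 ≤ Real.exp t * ‖x‖ ^ 2 / 2 := by positivity
    linarith
  have h2 : Real.exp t * ‖x‖ ^ 2 / 2 ≤ R := by linarith [Real.cosh_pos t]
  have h3 := Real.cosh_pos t
  have h4 := abs_le_two_mul_cosh t
  have h5 := exp_neg_le_two_mul_cosh t
  refine ⟨?_, ?_⟩
  · rw [mem_closedBall_zero_iff, Real.norm_eq_abs]
    linarith
  · rw [mem_closedBall_zero_iff]
    have h6 : ‖x‖ ^ 2 ≤ 2 * R * (2 * R) := by
      calc ‖x‖ ^ 2 = (Real.exp t * ‖x‖ ^ 2 / 2) * (2 * Real.exp (-t)) := by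
            rw [Real.exp_neg]; field_simp
        _ ≤ R * (2 * (2 * R)) := by
            have h7 : Real.exp (-t) ≤ 2 * R := by linarith
            have h8 : 0 ≤ R := by linarith
            gcongr
        _ = _ := by ring
    refine le_of_sq_le_sq ?_ (by linarith)
    nlinarith

section Measure

variable [MeasureSpace 𝕂] [BorelSpace 𝕂] [(volume : Measure 𝕂).IsAddHaarMeasure]

theorem measurePreserving_fst_snd_fst :
    MeasurePreserving (fun p : ℝ × 𝕂 × K 𝕂 => (p.1, p.2.1))
      ((volume : Measure ℝ).prod ((volume : Measure 𝕂).prod (haarProb (K 𝕂))))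
      ((volume : Measure ℝ).prod (volume : Measure 𝕂)) :=
  (MeasurePreserving.id _).prod measurePreserving_fst

instance instIsFiniteMeasureOnCompactsHaarG : IsFiniteMeasureOnCompacts (haarG 𝕂) := by
  refine ⟨fun C hC => ?_⟩
  obtain ⟨R, hR⟩ := hC.bddAbove_image continuous_cH.continuousOn
  have hsub : C ⊆ {g : G 𝕂 | cH g ≤ R} := fun g hg => hR ⟨g, hg, rfl⟩
  refine (measure_mono hsub).trans_lt ?_
  have hms : MeasurableSet {g : G 𝕂 | cH g ≤ R} :=
    (isClosed_le continuous_cH continuous_const).measurableSet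
  have hms' : MeasurableSet {p : ℝ × 𝕂 | cH (a 𝕂 p.1 * n p.2) ≤ R} :=
    (isCompact_cH_an_le R).isClosed.measurableSet
  rw [haarG, Measure.map_apply continuous_ank.measurable hms]
  have e : (fun p : ℝ × 𝕂 × K 𝕂 => a 𝕂 p.1 * n p.2.1 * (p.2.2 : G 𝕂)) ⁻¹' {g | cH g ≤ R} =
      (fun p : ℝ × 𝕂 × K 𝕂 => (p.1, p.2.1)) ⁻¹' {p | cH (a 𝕂 p.1 * n p.2) ≤ R} := by
    ext p
    simp [cH_mul_K _ p.2.2.2]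
  rw [e, measurePreserving_fst_snd_fst.measure_preimage hms'.nullMeasurableSet]
  exact (isCompact_cH_an_le R).measure_lt_top

theorem hasCompactSupport_of_cH {E : Type*} [Zero E] {f : G 𝕂 → E} {R : ℝ}
    (h : ∀ g, R < cH g → f g = 0) : HasCompactSupport f :=
  HasCompactSupport.intro (isCompact_cH_le R) fun g hg => h g (not_le.1 hg)

theorem hasCompactSupport_an {E : Type*} [Zero E] {f : G 𝕂 → E} (h : HasCompactSupport f) :
    HasCompactSupport fun p : ℝ × 𝕂 => f (a 𝕂 p.1 * n p.2) := by
  obtain ⟨R, hR⟩ := IsCompact.bddAbove_image h continuous_cH.continuousOn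
  refine HasCompactSupport.intro (isCompact_cH_an_le R) fun p hp => ?_
  by_contra hne
  exact hp (hR ⟨_, subset_closure hne, rfl⟩)

variable {E : Type*} [NormedAddCommGroup E] [NormedSpace ℝ E]

/-- The integral of a right `K`-invariant function in Iwasawa coordinates. -/
theorem integral_haarG {f : G 𝕂 → E} (hf : Continuous f) (hK : ∀ g, ∀ k ∈ K 𝕂, f (g * k) = f g)
    (hs : HasCompactSupport f) : ∫ g, f g ∂haarG 𝕂 = ∫ p : ℝ × 𝕂, f (a 𝕂 p.1 * n p.2) := by
  have hi : Integrable f (haarG 𝕂) := hf.integrable_of_hasCompactSupport hs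
  have hi2 : Integrable (fun p : ℝ × 𝕂 => f (a 𝕂 p.1 * n p.2)) :=
    (hf.comp continuous_an).integrable_of_hasCompactSupport (hasCompactSupport_an hs)
  have h1 : ∫ g, f g ∂haarG 𝕂 = ∫ p : ℝ × 𝕂 × K 𝕂, f (a 𝕂 p.1 * n p.2.1 * (p.2.2 : G 𝕂))
      ∂((volume : Measure ℝ).prod ((volume : Measure 𝕂).prod (haarProb (K 𝕂)))) := by
    rw [haarG, integral_map continuous_ank.aemeasurable]
    exact hi.aestronglyMeasurable
  rw [h1]
  have h2 : ∀ p : ℝ × 𝕂 × K 𝕂, f (a 𝕂 p.1 * n p.2.1 * (p.2.2 : G 𝕂)) =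
      (fun p : ℝ × 𝕂 => f (a 𝕂 p.1 * n p.2)) (p.1, p.2.1) := fun p => hK _ _ p.2.2.2
  simp only [h2]
  have hmp := measurePreserving_fst_snd_fst (𝕂 := 𝕂)
  rw [Measure.volume_eq_prod]
  refine Eq.trans ?_ (congrArg (fun μ => ∫ p : ℝ × 𝕂, f (a 𝕂 p.1 * n p.2) ∂μ) hmp.map_eq)
  rw [integral_map hmp.measurable.aemeasurable]
  rw [hmp.map_eq]
  exact hi2.aestronglyMeasurable

end Measure
end Integration

/-! ### The function `u * ǔ`: invariance, support, sup norm, positive definiteness. -/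

section Autocorrelation

variable {𝕂 : Type} [RCLike 𝕂]

/-- The function `u * ǔ` for `u = φ ∘ cH`, with real values. -/
def autocorr (𝕂 : Type) [RCLike 𝕂] [MeasureSpace 𝕂] (φ : ℝ → ℝ) (g : G 𝕂) : ℝ :=
  ∫ h, φ (cH h) * φ (cH (g⁻¹ * h)) ∂haarG 𝕂

variable [MeasureSpace 𝕂] [BorelSpace 𝕂] [(volume : Measure 𝕂).IsAddHaarMeasure]

variable {φ : ℝ → ℝ} {V : ℝ}

theorem conv_check (φ : ℝ → ℝ) : (fun g : G 𝕂 => ((autocorr 𝕂 φ g : ℝ) : ℂ)) =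
    conv (fun g => ((φ (cH g) : ℝ) : ℂ)) (check fun g => ((φ (cH g) : ℝ) : ℂ)) := by
  funext g
  rw [autocorr, conv, ← integral_complex_ofReal]
  refine integral_congr_ae (Filter.Eventually.of_forall fun h => ?_)
  simp [check, mul_inv_rev]

theorem hasCompactSupport_radial (hV : ∀ v, V < v → φ v = 0) :
    HasCompactSupport fun g : G 𝕂 => φ (cH g) :=
  hasCompactSupport_of_cH (R := V) fun _ hg => hV _ hg

theorem continuous_radial (hφ : Continuous φ) : Continuous fun g : G 𝕂 => φ (cH g) :=
  hφ.comp continuous_cH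

theorem integrable_radial_mul (hφ : Continuous φ) (hV : ∀ v, V < v → φ v = 0) (x y : G 𝕂) :
    Integrable (fun h => φ (cH (x * h)) * φ (cH (y * h))) (haarG 𝕂) := by
  refine Continuous.integrable_of_hasCompactSupport ?_ ?_
  · exact ((continuous_radial hφ).comp (continuous_const_mul x)).mul
      ((continuous_radial hφ).comp (continuous_const_mul y))
  · have h := (hasCompactSupport_radial (𝕂 := 𝕂) hV).comp_homeomorph (Homeomorph.mulLeft x)
    exact h.mul_right

/-- By left invariance, `F(x⁻¹y)` is the `L²` inner product of the translates of `u` by `x` and by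
`y`. Bi-invariance and positive definiteness are read off from this form. -/
theorem autocorr_inv_mul (φ : ℝ → ℝ) (x y : G 𝕂) : autocorr 𝕂 φ (x⁻¹ * y) =
    ∫ h, φ (cH (x⁻¹ * h)) * φ (cH (y⁻¹ * h)) ∂haarG 𝕂 := by
  rw [autocorr, ← integral_mul_left_eq_self _ x⁻¹]
  refine integral_congr_ae (Filter.Eventually.of_forall fun h => ?_)
  simp [mul_inv_rev, mul_assoc]

theorem autocorr_biinvariant (φ : ℝ → ℝ) {k₁ k₂ : G 𝕂} (h₁ : k₁ ∈ K 𝕂) (h₂ : k₂ ∈ K 𝕂) (g : G 𝕂) :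
    autocorr 𝕂 φ (k₁ * g * k₂) = autocorr 𝕂 φ g := by
  have e : k₁ * g * k₂ = k₁⁻¹⁻¹ * (g * k₂) := by rw [inv_inv, mul_assoc]
  rw [e, autocorr_inv_mul, autocorr]
  refine integral_congr_ae (Filter.Eventually.of_forall fun h => ?_)
  simp only [mul_inv_rev, inv_inv, mul_assoc]
  rw [cH_K_mul _ h₁, cH_K_mul _ (inv_mem h₂)]

/-- If the integrand is nonzero at `h`, then `g = h (g⁻¹h)⁻¹` is a product of two elements with `cH
≤ V`, and `cH_mul_le` applies. -/
theorem autocorr_eq_zero (hV : ∀ v, V < v → φ v = 0) {g : G 𝕂} (hg : 2 * V ^ 2 < cH g) :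
    autocorr 𝕂 φ g = 0 := by
  rw [autocorr]
  refine (integral_congr_ae (Filter.Eventually.of_forall fun h => ?_)).trans (integral_zero' _ _)
  simp only [Pi.zero_apply]
  by_contra hne
  have h1 : cH h ≤ V := not_lt.1 fun h' => hne (by rw [hV _ h', zero_mul])
  have h2 : cH (g⁻¹ * h) ≤ V := not_lt.1 fun h' => hne (by rw [hV _ h', mul_zero])
  have h3 := cH_mul_le h (g⁻¹ * h)⁻¹
  rw [cH_inv, mul_inv_rev, inv_inv, mul_inv_cancel_left] at h3
  have := one_le_cH h
  have := one_le_cH (g⁻¹ * h)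
  nlinarith

theorem integral_radial_sq_translate (φ : ℝ → ℝ) (g : G 𝕂) :
    ∫ h, φ (cH (g * h)) ^ 2 ∂haarG 𝕂 = ∫ h, φ (cH h) ^ 2 ∂haarG 𝕂 :=
  integral_mul_left_eq_self (fun h : G 𝕂 => φ (cH h) ^ 2) g

/-- The inequality `|ab| ≤ a²/2 + b²/2` under the integral replaces Cauchy-Schwarz: the two
translates of `u` have the same `L²` norm. -/
theorem abs_autocorr_le (hφ : Continuous φ) (hV : ∀ v, V < v → φ v = 0) (g : G 𝕂) :
    |autocorr 𝕂 φ g| ≤ ∫ h : G 𝕂, φ (cH h) ^ 2 ∂haarG 𝕂 := by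
  have h1 : Integrable (fun h => φ (cH h) ^ 2) (haarG 𝕂) := by
    simpa [sq] using integrable_radial_mul hφ hV (1 : G 𝕂) 1
  have h2 : Integrable (fun h => φ (cH (g⁻¹ * h)) ^ 2) (haarG 𝕂) := by
    simpa [sq] using integrable_radial_mul hφ hV g⁻¹ g⁻¹
  calc |autocorr 𝕂 φ g| ≤ ∫ h, |φ (cH h) * φ (cH (g⁻¹ * h))| ∂haarG 𝕂 := abs_integral_le_integral_abs
    _ ≤ ∫ h, (φ (cH h) ^ 2 / 2 + φ (cH (g⁻¹ * h)) ^ 2 / 2) ∂haarG 𝕂 := by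
      refine integral_mono ?_ ((h1.div_const 2).add (h2.div_const 2)) fun h => ?_
      · simpa using (integrable_radial_mul hφ hV (1 : G 𝕂) g⁻¹).abs
      · simp only [abs_mul]
        nlinarith [sq_nonneg (|φ (cH h)| - |φ (cH (g⁻¹ * h))|), sq_abs (φ (cH h)),
          sq_abs (φ (cH (g⁻¹ * h)))]
    _ = _ := by
      rw [integral_add (h1.div_const 2) (h2.div_const 2), integral_div, integral_div,
        integral_radial_sq_translate]
      ring

/-- The quadratic form is that of a Gram matrix, namely the squared `L²` norm of the combination of
translates of `u` with coefficients `c i`. -/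
theorem isPositiveDefinite_autocorr (hφ : Continuous φ) (hV : ∀ v, V < v → φ v = 0) :
    IsPositiveDefinite fun g : G 𝕂 => ((autocorr 𝕂 φ g : ℝ) : ℂ) := by
  intro m g c
  have key : ∑ i, ∑ j, c i * conj (c j) * ((autocorr 𝕂 φ ((g i)⁻¹ * g j) : ℝ) : ℂ) =
      ((∫ h, ‖∑ i, c i * ((φ (cH ((g i)⁻¹ * h)) : ℝ) : ℂ)‖ ^ 2 ∂haarG 𝕂 : ℝ) : ℂ) := by
    rw [← integral_complex_ofReal]
    have e : ∀ h : G 𝕂, ((‖∑ i, c i * ((φ (cH ((g i)⁻¹ * h)) : ℝ) : ℂ)‖ ^ 2 : ℝ) : ℂ) =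
        ∑ i, ∑ j, c i * conj (c j) *
          ((φ (cH ((g i)⁻¹ * h)) * φ (cH ((g j)⁻¹ * h)) : ℝ) : ℂ) := by
      intro h
      push_cast
      rw [← Complex.mul_conj', map_sum, Finset.sum_mul_sum]
      refine Finset.sum_congr rfl fun i _ => Finset.sum_congr rfl fun j _ => ?_
      rw [map_mul, Complex.conj_ofReal]
      ring
    have hint : ∀ i j, Integrable (fun h : G 𝕂 => c i * conj (c j) *
          ((φ (cH ((g i)⁻¹ * h)) * φ (cH ((g j)⁻¹ * h)) : ℝ) : ℂ)) (haarG 𝕂) := fun i j =>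
      ((integrable_radial_mul hφ hV (g i)⁻¹ (g j)⁻¹).ofReal).const_mul _
    refine Eq.trans ?_ (integral_congr_ae (Filter.Eventually.of_forall fun h => (e h).symm))
    rw [integral_finsetSum _ fun i _ => integrable_finsetSum _ fun j _ => hint i j]
    refine Finset.sum_congr rfl fun i _ => ?_
    rw [integral_finsetSum _ fun j _ => hint i j]
    refine Finset.sum_congr rfl fun j _ => ?_
    rw [integral_const_mul, autocorr_inv_mul, ← integral_complex_ofReal]
  simp only
  rw [key]
  refine ⟨Complex.ofReal_im _, ?_⟩
  rw [Complex.ofReal_re]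
  exact integral_nonneg fun h => by positivity

end Autocorrelation

end SL2
end

noncomputable section

namespace SL2

set_option linter.unusedSectionVars false

/-- Integrals of compactly supported smooth functions depend smoothly on parameters. -/
theorem contDiffOn_integral_param {P X : Type*} [NormedAddCommGroup P] [NormedSpace ℝ P]
    [NormedAddCommGroup X] [NormedSpace ℝ X] [MeasurableSpace X] [BorelSpace X]
    {μ : Measure X} [IsLocallyFiniteMeasure μ] [μ.IsNegInvariant]
    {g : P → X → ℝ} {s : Set P} {k : Set X} (hs : IsOpen s) (hk : IsCompact k)
    (hgs : ∀ p x, p ∈ s → x ∉ k → g p x = 0)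
    (hg : ContDiffOn ℝ ∞ (Function.uncurry g) (s ×ˢ Set.univ)) :
    ContDiffOn ℝ ∞ (fun p => ∫ x, g p x ∂μ) s := by
  -- The integral is the value at `0` of the convolution with the constant `1`, up to the reflection
  -- `x ↦ -x`.
  have h := contDiffOn_convolution_right_with_param (n := ⊤) (μ := μ) (f := fun _ : X => (1 : ℝ))
    (ContinuousLinearMap.mul ℝ ℝ) hs hk hgs (locallyIntegrable_const 1) hg
  have h2 : ContDiffOn ℝ ∞ (fun p : P => (p, (0 : X))) s := by fun_prop
  refine (h.comp h2 fun p hp => ⟨hp, Set.mem_univ _⟩).congr fun p _ => ?_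
  simp only [Function.comp, convolution_def, zero_sub, ContinuousLinearMap.mul_apply', one_mul]
  exact (integral_neg_eq_self (fun x => g p x) μ).symm

/-! ### Smooth extension of radial functions and of `u * ǔ` to the space of all matrices. -/

section Smooth

variable {𝕂 : Type} [RCLike 𝕂]

theorem contDiff_norm_sq' : ContDiff ℝ ∞ fun z : 𝕂 => ‖z‖ ^ 2 := by
  have e : (fun z : 𝕂 => ‖z‖ ^ 2) = fun z => RCLike.reCLM z ^ 2 + RCLike.imCLM z ^ 2 := by
    funext z
    rw [RCLike.norm_sq_eq_def]
    simp [sq]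
  rw [e]
  fun_prop

/-- `cH` on matrices. -/
def frob (M : Fin 2 → Fin 2 → 𝕂) : ℝ :=
  (‖M 0 0‖ ^ 2 + ‖M 0 1‖ ^ 2 + ‖M 1 0‖ ^ 2 + ‖M 1 1‖ ^ 2) / 2

theorem contDiff_frob : ContDiff ℝ ∞ (frob : (Fin 2 → Fin 2 → 𝕂) → ℝ) := by
  have h : ∀ i j : Fin 2, ContDiff ℝ ∞ fun M : Fin 2 → Fin 2 → 𝕂 => ‖M i j‖ ^ 2 := fun i j =>
    contDiff_norm_sq'.comp (by fun_prop)
  exact ((((h 0 0).add (h 0 1)).add (h 1 0)).add (h 1 1)).div_const 2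

/-- The function `cH (g⁻¹ a(t) n(x))`, extended to matrices `g`. -/
def frobInvMul (M : Fin 2 → Fin 2 → 𝕂) (p : ℝ × 𝕂) : ℝ :=
  (‖((Real.exp (p.1 / 2) : ℝ) : 𝕂) * M 1 1‖ ^ 2
    + ‖((Real.exp (p.1 / 2) : ℝ) : 𝕂) * M 1 1 * p.2 - ((Real.exp (-p.1 / 2) : ℝ) : 𝕂) * M 0 1‖ ^ 2
    + ‖((Real.exp (p.1 / 2) : ℝ) : 𝕂) * M 1 0‖ ^ 2
    + ‖((Real.exp (-p.1 / 2) : ℝ) : 𝕂) * M 0 0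
      - ((Real.exp (p.1 / 2) : ℝ) : 𝕂) * M 1 0 * p.2‖ ^ 2) / 2

theorem frobInvMul_eq (g : G 𝕂) (p : ℝ × 𝕂) :
    cH (g⁻¹ * (a 𝕂 p.1 * n p.2)) = frobInvMul (fun i j => g i j) p := by
  obtain ⟨i1, i2, i3, i4⟩ := inv_apply g
  obtain ⟨l1, l2, l3, l4⟩ := an_apply p.1 p.2
  have e1 : (g⁻¹ * (a 𝕂 p.1 * n p.2)) 0 0 = ((Real.exp (p.1 / 2) : ℝ) : 𝕂) * g 1 1 := by
    rw [mul_apply', i1, i2, l1, l3]; ring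
  have e2 : (g⁻¹ * (a 𝕂 p.1 * n p.2)) 0 1 = ((Real.exp (p.1 / 2) : ℝ) : 𝕂) * g 1 1 * p.2
      - ((Real.exp (-p.1 / 2) : ℝ) : 𝕂) * g 0 1 := by
    rw [mul_apply', i1, i2, l2, l4]; ring
  have e3 : (g⁻¹ * (a 𝕂 p.1 * n p.2)) 1 0 = -(((Real.exp (p.1 / 2) : ℝ) : 𝕂) * g 1 0) := by
    rw [mul_apply', i3, i4, l1, l3]; ring
  have e4 : (g⁻¹ * (a 𝕂 p.1 * n p.2)) 1 1 = ((Real.exp (-p.1 / 2) : ℝ) : 𝕂) * g 0 0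
      - ((Real.exp (p.1 / 2) : ℝ) : 𝕂) * g 1 0 * p.2 := by
    rw [mul_apply', i3, i4, l2, l4]; ring
  rw [cH, frobInvMul, e1, e2, e3, e4, norm_neg]

theorem contDiff_frobInvMul : ContDiff ℝ ∞
    fun q : (Fin 2 → Fin 2 → 𝕂) × (ℝ × 𝕂) => frobInvMul q.1 q.2 := by
  have hE : ContDiff ℝ ∞ fun q : (Fin 2 → Fin 2 → 𝕂) × (ℝ × 𝕂) =>
      ((Real.exp (q.2.1 / 2) : ℝ) : 𝕂) :=
    (RCLike.ofRealCLM (K := 𝕂)).contDiff.comp (by fun_prop)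
  have hE' : ContDiff ℝ ∞ fun q : (Fin 2 → Fin 2 → 𝕂) × (ℝ × 𝕂) =>
      ((Real.exp (-q.2.1 / 2) : ℝ) : 𝕂) :=
    (RCLike.ofRealCLM (K := 𝕂)).contDiff.comp (by fun_prop)
  have hM : ∀ i j : Fin 2, ContDiff ℝ ∞ fun q : (Fin 2 → Fin 2 → 𝕂) × (ℝ × 𝕂) => q.1 i j :=
    fun i j => by fun_prop
  have hx : ContDiff ℝ ∞ fun q : (Fin 2 → Fin 2 → 𝕂) × (ℝ × 𝕂) => q.2.2 := by fun_prop
  refine ContDiff.div_const (((ContDiff.add ?_ ?_).add ?_).add ?_) 2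
  · exact contDiff_norm_sq'.comp (hE.mul (hM 1 1))
  · exact contDiff_norm_sq'.comp (((hE.mul (hM 1 1)).mul hx).sub (hE'.mul (hM 0 1)))
  · exact contDiff_norm_sq'.comp (hE.mul (hM 1 0))
  · exact contDiff_norm_sq'.comp ((hE'.mul (hM 0 0)).sub ((hE.mul (hM 1 0)).mul hx))

variable [MeasureSpace 𝕂] [BorelSpace 𝕂] [(volume : Measure 𝕂).IsAddHaarMeasure]

variable {φ : ℝ → ℝ} {V : ℝ}

theorem autocorr_eq_integral (hφ : Continuous φ) (hV : ∀ v, V < v → φ v = 0) (g : G 𝕂) :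
    autocorr 𝕂 φ g = ∫ p : ℝ × 𝕂, φ (cH (a 𝕂 p.1 * n p.2)) * φ (cH (g⁻¹ * (a 𝕂 p.1 * n p.2))) := by
  refine integral_haarG ?_ (fun h k hk => ?_) ?_
  · exact (continuous_radial hφ).mul ((continuous_radial hφ).comp (continuous_const_mul g⁻¹))
  · rw [← mul_assoc, cH_mul_K _ hk, cH_mul_K _ hk]
  · exact (hasCompactSupport_radial hV).mul_right

/-- For `g` of determinant `1` the inverse is the adjugate, so `cH (g⁻¹ a(t) n(x))` is a polynomial
in the real coordinates of the entries of `g` and makes sense for every matrix. The other factor `φ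
(cH (a(t) n(x)))` confines the integral to a compact set that does not depend on the matrix. -/
theorem exists_contDiff_autocorr (hφ : ContDiff ℝ ∞ φ) (hV : ∀ v, V < v → φ v = 0) :
    ∃ U : (Fin 2 → Fin 2 → 𝕂) → ℝ, ContDiff ℝ ∞ U ∧
      ∀ g : G 𝕂, autocorr 𝕂 φ g = U fun i j => g i j := by
  refine ⟨fun M => ∫ p : ℝ × 𝕂, φ (Real.cosh p.1 + Real.exp p.1 * ‖p.2‖ ^ 2 / 2) *
    φ (frobInvMul M p), ?_, fun g => ?_⟩
  · have : (volume : Measure (ℝ × 𝕂)).IsAddHaarMeasure := Measure.prod.instIsAddHaarMeasure _ _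
    rw [← contDiffOn_univ]
    refine contDiffOn_integral_param isOpen_univ (isCompact_cH_an_le V) (fun M p _ hp => ?_) ?_
    · rw [← cH_an, hV _ (not_le.1 hp), zero_mul]
    · refine ContDiff.contDiffOn ?_
      refine ContDiff.mul (hφ.comp ?_) (hφ.comp contDiff_frobInvMul)
      have h1 : ContDiff ℝ ∞ fun q : (Fin 2 → Fin 2 → 𝕂) × (ℝ × 𝕂) => ‖q.2.2‖ ^ 2 :=
        contDiff_norm_sq'.comp (by fun_prop)
      have h2 : ContDiff ℝ ∞ fun q : (Fin 2 → Fin 2 → 𝕂) × (ℝ × 𝕂) => Real.exp q.2.1 := by fun_prop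
      have h3 : ContDiff ℝ ∞ fun q : (Fin 2 → Fin 2 → 𝕂) × (ℝ × 𝕂) => Real.cosh q.2.1 :=
        Real.contDiff_cosh.comp (by fun_prop)
      exact h3.add ((h2.mul h1).div_const 2)
  · rw [autocorr_eq_integral hφ.continuous hV]
    simp only [frobInvMul_eq, cH_an]

theorem isSphericalTestFunction_radial (hφ : ContDiff ℝ ∞ φ) (hV : ∀ v, V < v → φ v = 0) :
    IsSphericalTestFunction fun g : G 𝕂 => ((φ (cH g) : ℝ) : ℂ) := by
  refine ⟨⟨fun M => ((φ (frob M) : ℝ) : ℂ), ?_, fun g => rfl⟩, ?_, ?_⟩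
  · exact Complex.ofRealCLM.contDiff.comp (hφ.comp contDiff_frob)
  · exact (hasCompactSupport_radial hV).comp_left Complex.ofReal_zero
  · intro k₁ h₁ k₂ h₂ g
    rw [cH_mul_K _ h₂, cH_K_mul _ h₁]

theorem continuous_of_exists_contDiff {f : G 𝕂 → ℝ} (h : ∃ U : (Fin 2 → Fin 2 → 𝕂) → ℝ,
    ContDiff ℝ ∞ U ∧ ∀ g : G 𝕂, f g = U fun i j => g i j) : Continuous f := by
  obtain ⟨U, hU, e⟩ := h
  have : f = fun g => U fun i j => g i j := funext e
  rw [this]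
  exact hU.continuous.comp (by fun_prop)

theorem continuous_autocorr (hφ : ContDiff ℝ ∞ φ) (hV : ∀ v, V < v → φ v = 0) :
    Continuous (autocorr 𝕂 φ) := continuous_of_exists_contDiff (exists_contDiff_autocorr hφ hV)

theorem hasCompactSupport_autocorr (hV : ∀ v, V < v → φ v = 0) :
    HasCompactSupport (autocorr 𝕂 φ) :=
  hasCompactSupport_of_cH (R := 2 * V ^ 2) fun _ hg => autocorr_eq_zero hV hg

theorem isSphericalTestFunction_autocorr (hφ : ContDiff ℝ ∞ φ) (hV : ∀ v, V < v → φ v = 0) :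
    IsSphericalTestFunction fun g : G 𝕂 => ((autocorr 𝕂 φ g : ℝ) : ℂ) := by
  obtain ⟨U, hU, e⟩ := exists_contDiff_autocorr (𝕂 := 𝕂) hφ hV
  refine ⟨⟨fun M => ((U M : ℝ) : ℂ), Complex.ofRealCLM.contDiff.comp hU, fun g => by rw [e]⟩,
    ?_, ?_⟩
  · exact (hasCompactSupport_autocorr hV).comp_left Complex.ofReal_zero
  · intro k₁ h₁ k₂ h₂ g
    rw [autocorr_biinvariant φ h₁ h₂]

end Smooth

/-! ### The Abel transform of radial functions and of autocorrelations. -/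

section Abel

variable {𝕂 : Type} [RCLike 𝕂] [MeasureSpace 𝕂] [BorelSpace 𝕂]
  [(volume : Measure 𝕂).IsAddHaarMeasure]

variable {φ : ℝ → ℝ} {V : ℝ}

/-- The Abel (Harish-Chandra) transform. -/
def abel {𝕂 : Type} [RCLike 𝕂] [MeasureSpace 𝕂] (f : G 𝕂 → ℝ) (s : ℝ) : ℝ :=
  Real.exp (rho 𝕂 * s / 2) * ∫ x : 𝕂, f (a 𝕂 s * n x)

theorem integral_comp_exp_mul {E : Type*} [NormedAddCommGroup E] [NormedSpace ℝ E] (f : 𝕂 → E)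
    (r : ℝ) : ∫ x : 𝕂, f (((Real.exp r : ℝ) : 𝕂) * x) = Real.exp (-(rho 𝕂 * r)) • ∫ x : 𝕂, f x := by
  have h := Measure.integral_comp_smul (volume : Measure 𝕂) f (Real.exp r)
  simp only [RCLike.real_smul_eq_coe_mul] at h
  rw [h, abs_of_pos (by positivity), ← rho, ← Real.exp_nat_mul, ← Real.exp_neg]

/-- The substitution `x ↦ e^{s/2} x` has a Jacobian that exactly cancels the normalizing factor
`e^{ρs/2}`. -/
theorem abel_radial (φ : ℝ → ℝ) (s : ℝ) : abel (fun g : G 𝕂 => φ (cH g)) s =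
    ∫ x : 𝕂, φ (Real.cosh s + ‖x‖ ^ 2 / 2) := by
  have h := integral_comp_exp_mul (𝕂 := 𝕂) (fun x : 𝕂 => φ (Real.cosh s + ‖x‖ ^ 2 / 2)) (s / 2)
  have e : ∀ x : 𝕂, ‖((Real.exp (s / 2) : ℝ) : 𝕂) * x‖ ^ 2 = Real.exp s * ‖x‖ ^ 2 := by
    intro x
    rw [norm_mul, RCLike.norm_ofReal, abs_of_pos (Real.exp_pos _), mul_pow, exp_half_sq]
  simp only [e] at h
  simp only [abel, cH_an]
  rw [h, smul_eq_mul, ← mul_assoc, ← Real.exp_add]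
  ring_nf
  simp

end Abel

end SL2
end

noncomputable section

namespace SL2

set_option linter.unusedSectionVars false

section AbelAutocorr

variable {𝕂 : Type} [RCLike 𝕂] [MeasureSpace 𝕂] [BorelSpace 𝕂]
  [(volume : Measure 𝕂).IsAddHaarMeasure]

variable {φ : ℝ → ℝ} {V : ℝ}

theorem an_inv_mul_an (s r : ℝ) (x y : 𝕂) : (a 𝕂 s * n x)⁻¹ * (a 𝕂 r * n y) =
    a 𝕂 (r - s) * n (y - ((Real.exp (s - r) : ℝ) : 𝕂) * x) := by
  rw [mul_inv_rev, ← n_neg, ← a_neg, mul_assoc, ← mul_assoc (a 𝕂 (-s)), ← a_add, ← mul_assoc,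
    n_mul_a, mul_assoc, ← n_add]
  ring_nf

/-- Needed for Fubini. The two factors confine `(r, y)` and `(r - s, y - e^{s-r}x)` to a compact
set, and `x` is a continuous function of these coordinates. -/
theorem hasCompactSupport_autocorr_integrand (hV : ∀ v, V < v → φ v = 0) (s : ℝ) :
    HasCompactSupport (Function.uncurry fun (x : 𝕂) (p : ℝ × 𝕂) => φ (cH (a 𝕂 p.1 * n p.2)) *
      φ (cH (a 𝕂 (p.1 - s) * n (p.2 - ((Real.exp (s - p.1) : ℝ) : 𝕂) * x)))) := by
  have hc : Continuous fun q : 𝕂 × (ℝ × 𝕂) =>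
      ((((Real.exp (q.2.1 - s) : ℝ) : 𝕂) * (q.2.2 - q.1), q.2) : 𝕂 × (ℝ × 𝕂)) := by fun_prop
  have hkc := isCompact_cH_an_le (𝕂 := 𝕂) V
  generalize hk : {p : ℝ × 𝕂 | cH (a 𝕂 p.1 * n p.2) ≤ V} = k at hkc
  have hmem : ∀ p : ℝ × 𝕂, cH (a 𝕂 p.1 * n p.2) ≤ V → p ∈ k := fun p hp => hk ▸ hp
  refine HasCompactSupport.intro (((hkc.image continuous_snd).prod hkc).image hc) ?_
  rintro ⟨x, p⟩ hq
  by_contra hne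
  have hne' : φ (cH (a 𝕂 p.1 * n p.2)) *
      φ (cH (a 𝕂 (p.1 - s) * n (p.2 - ((Real.exp (s - p.1) : ℝ) : 𝕂) * x))) ≠ 0 := hne
  have h1 : cH (a 𝕂 p.1 * n p.2) ≤ V := not_lt.1 fun h' => hne' (by rw [hV _ h', zero_mul])
  have h2 : cH (a 𝕂 (p.1 - s) * n (p.2 - ((Real.exp (s - p.1) : ℝ) : 𝕂) * x)) ≤ V :=
    not_lt.1 fun h' => hne' (by rw [hV _ h', mul_zero])
  have h3 : ((Real.exp (p.1 - s) : ℝ) : 𝕂) * (((Real.exp (s - p.1) : ℝ) : 𝕂) * x) = x := by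
    rw [← mul_assoc, ← RCLike.ofReal_mul, ← Real.exp_add]
    simp
  apply hq
  rw [Set.mem_image]
  refine ⟨(p.2 - ((Real.exp (s - p.1) : ℝ) : 𝕂) * x, p), Set.mk_mem_prod
    (Set.mem_image_of_mem Prod.snd (hmem (p.1 - s, _) h2)) (hmem p h1), ?_⟩
  simp only [sub_sub_cancel, h3]

/-- The Abel transform carries convolution on `G` to convolution on `A`. After integrating over `x`
first, the Jacobian `e^{ρ(r-s)}` and the factor `e^{ρs/2}` recombine into the two normalizing
factors `e^{ρr/2}` and `e^{ρ(r-s)/2}`. -/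
theorem abel_autocorr (hφ : Continuous φ) (hV : ∀ v, V < v → φ v = 0) (s : ℝ) :
    abel (autocorr 𝕂 φ) s = ∫ r : ℝ, abel (fun g : G 𝕂 => φ (cH g)) r *
      abel (fun g : G 𝕂 => φ (cH g)) (r - s) := by
  set I : ℝ → ℝ := fun r => ∫ x : 𝕂, φ (cH (a 𝕂 r * n x)) with hI
  set f : 𝕂 → ℝ × 𝕂 → ℝ := fun (x : 𝕂) (p : ℝ × 𝕂) => φ (cH (a 𝕂 p.1 * n p.2)) *
      φ (cH (a 𝕂 (p.1 - s) * n (p.2 - ((Real.exp (s - p.1) : ℝ) : 𝕂) * x))) with hf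
  have hfc : Continuous (Function.uncurry f) := by
    have hr := continuous_radial (𝕂 := 𝕂) hφ
    have h1 : Continuous fun q : 𝕂 × (ℝ × 𝕂) => a 𝕂 q.2.1 * n q.2.2 :=
      continuous_an.comp continuous_snd
    have h2 : Continuous fun q : 𝕂 × (ℝ × 𝕂) =>
        a 𝕂 (q.2.1 - s) * n (q.2.2 - ((Real.exp (s - q.2.1) : ℝ) : 𝕂) * q.1) :=
      continuous_an.comp (f := fun q : 𝕂 × (ℝ × 𝕂) =>
        (q.2.1 - s, q.2.2 - ((Real.exp (s - q.2.1) : ℝ) : 𝕂) * q.1)) (by fun_prop)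
    exact (hr.comp h1).mul (hr.comp h2)
  have hfs : HasCompactSupport (Function.uncurry f) := hasCompactSupport_autocorr_integrand hV s
  have hfi : Integrable (Function.uncurry f)
      ((volume : Measure 𝕂).prod (volume : Measure (ℝ × 𝕂))) := by
    have : IsFiniteMeasureOnCompacts ((volume : Measure 𝕂).prod (volume : Measure (ℝ × 𝕂))) := by
      rw [Measure.volume_eq_prod ℝ 𝕂]; infer_instance
    exact hfc.integrable_of_hasCompactSupport hfs
  have hinner : ∀ p : ℝ × 𝕂, ∫ x : 𝕂, f x p =
      φ (cH (a 𝕂 p.1 * n p.2)) * (Real.exp (rho 𝕂 * (p.1 - s)) * I (p.1 - s)) := by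
    intro p
    simp only [hf]
    rw [integral_const_mul]
    congr 1
    have h := integral_comp_exp_mul (𝕂 := 𝕂)
      (fun z : 𝕂 => φ (cH (a 𝕂 (p.1 - s) * n (p.2 - z)))) (s - p.1)
    rw [h, smul_eq_mul]
    have h' := integral_sub_left_eq_self (fun z : 𝕂 => φ (cH (a 𝕂 (p.1 - s) * n z))) volume p.2
    rw [h']
    congr 2
    ring
  have h1 : ∀ x : 𝕂, autocorr 𝕂 φ (a 𝕂 s * n x) = ∫ p, f x p := by
    intro x
    rw [autocorr_eq_integral hφ hV]
    simp only [an_inv_mul_an, hf]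
  have h2 : Integrable (fun p : ℝ × 𝕂 => ∫ x, f x p) (volume : Measure (ℝ × 𝕂)) :=
    hfi.integral_prod_right
  have h3 : ∫ x : 𝕂, autocorr 𝕂 φ (a 𝕂 s * n x) =
      ∫ r : ℝ, I r * (Real.exp (rho 𝕂 * (r - s)) * I (r - s)) := by
    simp only [h1]
    rw [integral_integral_swap hfi, Measure.volume_eq_prod, integral_prod]
    · refine integral_congr_ae (Filter.Eventually.of_forall fun r => ?_)
      simp only [hinner]
      rw [integral_mul_const]
    · rw [← Measure.volume_eq_prod]; exact h2
  rw [abel, h3, ← integral_const_mul]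
  refine integral_congr_ae (Filter.Eventually.of_forall fun r => ?_)
  simp only [abel]
  change _ = Real.exp (rho 𝕂 * r / 2) * I r * (Real.exp (rho 𝕂 * (r - s) / 2) * I (r - s))
  have e : Real.exp (rho 𝕂 * s / 2) * Real.exp (rho 𝕂 * (r - s)) =
      Real.exp (rho 𝕂 * r / 2) * Real.exp (rho 𝕂 * (r - s) / 2) := by
    rw [← Real.exp_add, ← Real.exp_add]; ring_nf
  linear_combination I r * I (r - s) * e

end AbelAutocorr

/-! ### The spherical transform as a Fourier transform of the Abel transform. -/

section SphericalTransform

variable {𝕂 : Type} [RCLike 𝕂]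

theorem iwasawaY_mul_K (g : G 𝕂) {k : G 𝕂} (hk : k ∈ K 𝕂) : iwasawaY (g * k) = iwasawaY g := by
  obtain ⟨l, hl, e⟩ := exists_iwasawa g
  rw [e, mul_assoc, iwasawaY_an _ _ (mul_mem hl hk), iwasawaY_an _ _ hl]

theorem iwasawaY_pos (g : G 𝕂) : 0 < iwasawaY g := by
  obtain ⟨l, hl, e⟩ := exists_iwasawa g
  rw [e, iwasawaY_an _ _ hl]
  exact Real.exp_pos _

theorem continuous_iwasawaY : Continuous (iwasawaY : G 𝕂 → ℝ) := by
  have h : ∀ g : G 𝕂, ‖g 1 0‖ ^ 2 + ‖g 1 1‖ ^ 2 ≠ 0 := fun g =>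
    (inv_pos.1 (iwasawaY_pos g)).ne'
  unfold iwasawaY
  exact Continuous.inv₀ (by fun_prop) h

/-- The function `|y(g)|_𝕂 ^ (s + 1/2)`. -/
def iwasawaPow (s : ℂ) (g : G 𝕂) : ℂ := (((iwasawaY g) ^ rho 𝕂 : ℝ) : ℂ) ^ (s + 1 / 2)

theorem iwasawaPow_eq (s : ℂ) (g : G 𝕂) :
    iwasawaPow s g = Complex.exp (((rho 𝕂 * Real.log (iwasawaY g) : ℝ) : ℂ) * (s + 1 / 2)) := by
  have h := pow_pos (iwasawaY_pos g) (rho 𝕂)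
  rw [iwasawaPow, Complex.cpow_def_of_ne_zero (by exact_mod_cast h.ne'), ← Complex.ofReal_log h.le,
    Real.log_pow]

theorem continuous_iwasawaPow (s : ℂ) : Continuous (iwasawaPow s : G 𝕂 → ℂ) := by
  have h : Continuous fun g : G 𝕂 => Real.log (iwasawaY g) :=
    continuous_iwasawaY.log fun g => (iwasawaY_pos g).ne'
  have e : (iwasawaPow s : G 𝕂 → ℂ) = fun g =>
    Complex.exp (((rho 𝕂 * Real.log (iwasawaY g) : ℝ) : ℂ) * (s + 1 / 2)) :=
      funext (iwasawaPow_eq s)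
  rw [e]
  fun_prop

variable [MeasureSpace 𝕂] [BorelSpace 𝕂] [(volume : Measure 𝕂).IsAddHaarMeasure]

/-- `φ_s` is a `K`-average of translates of `|y|^{s+1/2}`. After an exchange of integrals, the left
invariance of `f` and of `haarG` removes the average, and `y` is `e^t` in Iwasawa coordinates. -/
theorem sphericalTransform_eq {f : G 𝕂 → ℂ} (hf : Continuous f) (hs : HasCompactSupport f)
    (hK : ∀ k₁ ∈ K 𝕂, ∀ k₂ ∈ K 𝕂, ∀ g, f (k₁ * g * k₂) = f g) (s : ℂ) :
    sphericalTransform f s =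
      ∫ p : ℝ × 𝕂, f (a 𝕂 p.1 * n p.2) * Complex.exp (((rho 𝕂 * p.1 : ℝ) : ℂ) * (s + 1 / 2)) := by
  have hl : ∀ k ∈ K 𝕂, ∀ g, f (k * g) = f g := fun k hk g => by
    simpa using hK k hk 1 (one_mem _) g
  have hr : ∀ g, ∀ k ∈ K 𝕂, f (g * k) = f g := fun g k hk => by
    simpa using hK 1 (one_mem _) k hk g
  have h1 : sphericalTransform f s =
      ∫ g : G 𝕂, ∫ k : K 𝕂, f g * iwasawaPow s ((k : G 𝕂) * g) ∂haarProb (K 𝕂) ∂haarG 𝕂 := by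
    rw [sphericalTransform]
    refine integral_congr_ae (Filter.Eventually.of_forall fun g => ?_)
    simp only [phi]
    rw [← integral_const_mul]
    rfl
  have h2 := integral_integral_swap_of_hasCompactSupport (μ := haarG 𝕂) (ν := haarProb (K 𝕂))
    (f := fun (g : G 𝕂) (k : K 𝕂) => f g * iwasawaPow s ((k : G 𝕂) * g)) (by
      refine (hf.comp continuous_fst).mul ((continuous_iwasawaPow s).comp ?_)
      exact (continuous_subtype_val.comp continuous_snd).mul continuous_fst) (by
      refine HasCompactSupport.intro (IsCompact.prod hs isCompact_univ) ?_
      rintro ⟨g, k⟩ hq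
      have : f g = 0 := image_eq_zero_of_notMem_tsupport fun h => hq ⟨h, Set.mem_univ _⟩
      simp [Function.uncurry, this])
  have h3 : ∀ k : K 𝕂, ∫ g : G 𝕂, f g * iwasawaPow s ((k : G 𝕂) * g) ∂haarG 𝕂 =
      ∫ g : G 𝕂, f g * iwasawaPow s g ∂haarG 𝕂 := by
    intro k
    rw [← integral_mul_left_eq_self (fun g : G 𝕂 => f g * iwasawaPow s g) (k : G 𝕂)]
    simp only [hl _ k.2]
  rw [h1, h2]
  simp only [h3]
  rw [integral_const, probReal_univ, one_smul, integral_haarG]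
  · refine integral_congr_ae (Filter.Eventually.of_forall fun p => ?_)
    have := iwasawaY_an p.1 p.2 (one_mem (K 𝕂))
    rw [mul_one] at this
    simp only [iwasawaPow_eq, this, Real.log_exp]
  · exact hf.mul (continuous_iwasawaPow s)
  · intro g k hk
    rw [hr g k hk, iwasawaPow, iwasawaPow, iwasawaY_mul_K g hk]
  · exact hs.mul_right

/-- The shift `1/2` in the exponent of `φ_s` is the factor `e^{ρt/2}` of the Abel transform; what
remains is the character of frequency `ρτ`. -/
theorem sphericalTransform_eq_abel {f : G 𝕂 → ℝ} (hf : Continuous f) (hs : HasCompactSupport f)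
    (hK : ∀ k₁ ∈ K 𝕂, ∀ k₂ ∈ K 𝕂, ∀ g, f (k₁ * g * k₂) = f g) (τ : ℝ) :
    sphericalTransform (fun g => ((f g : ℝ) : ℂ)) (Complex.I * (τ : ℂ)) =
      ∫ t : ℝ, ((abel f t : ℝ) : ℂ) * Complex.exp (((rho 𝕂 * τ * t : ℝ) : ℂ) * Complex.I) := by
  have hs' : HasCompactSupport fun g => ((f g : ℝ) : ℂ) := hs.comp_left Complex.ofReal_zero
  have hf' : Continuous fun g => ((f g : ℝ) : ℂ) := Complex.continuous_ofReal.comp hf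
  rw [sphericalTransform_eq hf' hs' (fun k₁ h₁ k₂ h₂ g => by rw [hK k₁ h₁ k₂ h₂]),
    Measure.volume_eq_prod, integral_prod]
  · refine integral_congr_ae (Filter.Eventually.of_forall fun t => ?_)
    simp only
    rw [integral_mul_const, integral_complex_ofReal, abel]
    have e : Complex.exp (((rho 𝕂 * t : ℝ) : ℂ) * (Complex.I * (τ : ℂ) + 1 / 2)) =
        ((Real.exp (rho 𝕂 * t / 2) : ℝ) : ℂ) *
          Complex.exp (((rho 𝕂 * τ * t : ℝ) : ℂ) * Complex.I) := by
      rw [Complex.ofReal_exp, ← Complex.exp_add]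
      congr 1
      push_cast
      ring
    rw [e, Complex.ofReal_mul (Real.exp _)]
    ring
  · rw [← Measure.volume_eq_prod]
    refine Continuous.integrable_of_hasCompactSupport ?_ ?_
    · exact (hf'.comp continuous_an).mul (by fun_prop)
    · exact (hasCompactSupport_an hs').mul_right

end SphericalTransform

/-! ### Fourier analysis on the real line. -/

section OneDim

/-- The Fourier transform of an autocorrelation. -/
theorem integral_autocorrelation {A : ℝ → ℝ} (hA : Continuous A) {M : ℝ}
    (hM : ∀ r, M < |r| → A r = 0) (l : ℝ) :
    ∫ t : ℝ, ((∫ r : ℝ, A r * A (r - t) : ℝ) : ℂ) * Complex.exp (((l * t : ℝ) : ℂ) * Complex.I) =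
      ((Complex.normSq (∫ r : ℝ, (A r : ℂ) * Complex.exp (((l * r : ℝ) : ℂ) * Complex.I)) : ℝ) :
        ℂ) := by
  set E : ℝ → ℂ := fun r => Complex.exp (((l * r : ℝ) : ℂ) * Complex.I) with hE
  have hEc : Continuous E := by simp only [hE]; fun_prop
  have h1 : ∀ t : ℝ, ((∫ r : ℝ, A r * A (r - t) : ℝ) : ℂ) * E t =
      ∫ r : ℝ, (A r : ℂ) * (A (r - t) : ℂ) * E t := by
    intro t
    rw [← integral_complex_ofReal, ← integral_mul_const]
    push_cast
    rfl
  change ∫ t : ℝ, ((∫ r : ℝ, A r * A (r - t) : ℝ) : ℂ) * E t =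
    ((Complex.normSq (∫ r : ℝ, (A r : ℂ) * E r) : ℝ) : ℂ)
  simp only [h1]
  have h2 := integral_integral_swap_of_hasCompactSupport (μ := (volume : Measure ℝ))
    (ν := (volume : Measure ℝ)) (f := fun t r : ℝ => (A r : ℂ) * (A (r - t) : ℂ) * E t) (by
      simp only [Function.uncurry_def]
      fun_prop) (by
      refine HasCompactSupport.intro ((isCompact_closedBall (0 : ℝ) (2 * M)).prod
        (isCompact_closedBall (0 : ℝ) M)) ?_
      rintro ⟨t, r⟩ hq
      simp only [Function.uncurry]
      by_contra hne
      have h1 : |r| ≤ M := not_lt.1 fun h' => hne (by rw [hM _ h']; simp)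
      have h2 : |r - t| ≤ M := not_lt.1 fun h' => hne (by rw [hM _ h']; simp)
      refine hq ⟨?_, ?_⟩
      · rw [mem_closedBall_zero_iff, Real.norm_eq_abs]
        have := abs_sub r (r - t)
        rw [sub_sub_cancel] at this
        linarith
      · rwa [mem_closedBall_zero_iff, Real.norm_eq_abs])
  rw [h2]
  have h3 : ∀ r : ℝ, ∫ t : ℝ, (A r : ℂ) * (A (r - t) : ℂ) * E t =
      (A r : ℂ) * E r * conj (∫ q : ℝ, (A q : ℂ) * E q) := by
    intro r
    rw [← integral_conj, ← integral_const_mul,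
      ← integral_sub_left_eq_self (fun q : ℝ => (A r : ℂ) * E r * conj ((A q : ℂ) * E q)) volume r]
    refine integral_congr_ae (Filter.Eventually.of_forall fun t => ?_)
    have e : E t = E r * conj (E (r - t)) := by
      simp only [hE, ← Complex.exp_conj, map_mul, Complex.conj_ofReal, Complex.conj_I,
        ← Complex.exp_add]
      congr 1
      push_cast
      ring
    simp only [map_mul, Complex.conj_ofReal]
    rw [e]
    ring
  simp only [h3]
  rw [integral_mul_const, Complex.mul_conj]

theorem sq_integral_cos_le_normSq {A : ℝ → ℝ} (hA : Continuous A) (hs : HasCompactSupport A)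
    (l : ℝ) : (∫ r, A r * Real.cos (l * r)) ^ 2 ≤
      Complex.normSq (∫ r : ℝ, (A r : ℂ) * Complex.exp (((l * r : ℝ) : ℂ) * Complex.I)) := by
  have hi : Integrable fun r : ℝ => (A r : ℂ) * Complex.exp (((l * r : ℝ) : ℂ) * Complex.I) := by
    refine Continuous.integrable_of_hasCompactSupport (by fun_prop) ?_
    exact (hs.comp_left (g := fun x : ℝ => (x : ℂ)) Complex.ofReal_zero).mul_right
  have h : (∫ r : ℝ, (A r : ℂ) * Complex.exp (((l * r : ℝ) : ℂ) * Complex.I)).re =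
      ∫ r, A r * Real.cos (l * r) := by
    have h' := integral_re hi
    refine Eq.trans h'.symm (integral_congr_ae (Filter.Eventually.of_forall fun r => ?_))
    change ((A r : ℂ) * Complex.exp (((l * r : ℝ) : ℂ) * Complex.I)).re = _
    rw [Complex.re_ofReal_mul, Complex.exp_ofReal_mul_I_re]
  rw [← h, Complex.normSq_apply]
  nlinarith [mul_self_nonneg (∫ r : ℝ, (A r : ℂ) *
    Complex.exp (((l * r : ℝ) : ℂ) * Complex.I)).im]

end OneDim

end SL2
end

noncomputable section

namespace SL2

set_option linter.unusedSectionVars false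

/-! ### Orbital integrals computed from a family of coset representatives. -/

section Quotient

variable {𝕂 : Type} [RCLike 𝕂]

theorem exists_out_eq (γ g : G 𝕂) : ∃ h ∈ centr γ,
    (Quotient.mk (QuotientGroup.rightRel (centr γ)) g).out = h * g := by
  have h := Quotient.mk_out (s := QuotientGroup.rightRel (centr γ)) g
  have h' := QuotientGroup.rightRel_apply.1 h
  refine ⟨_, inv_mem h', ?_⟩
  rw [mul_inv_rev, inv_inv, inv_mul_cancel_right]

theorem conj_out_eq (γ g : G 𝕂) :
    ((Quotient.mk (QuotientGroup.rightRel (centr γ)) g).out)⁻¹ * γ *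
      (Quotient.mk (QuotientGroup.rightRel (centr γ)) g).out = g⁻¹ * γ * g := by
  obtain ⟨h, hh, e⟩ := exists_out_eq γ g
  have hc : h * γ = γ * h := Subgroup.mem_centralizer_singleton_iff.1 hh
  rw [e, mul_inv_rev, mul_assoc, mul_assoc, ← mul_assoc γ, ← hc]
  simp only [mul_assoc, inv_mul_cancel_left]

variable [MeasureSpace 𝕂]

/-- A parametrization `j : X → G` of coset representatives computes the orbital integral. -/
theorem hasOrbitalIntegral_of_param {γ : G 𝕂} {μ : Measure (G 𝕂)} [SFinite μ]
    (hμ : IsCentralizerMeasure γ μ)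
    (hinv : ∀ h₀ ∈ centr γ, ∀ f : G 𝕂 → ℝ≥0∞, Measurable f →
      ∫⁻ h, f (h * h₀) ∂μ = ∫⁻ h, f h ∂μ)
    {X : Type*} [MeasurableSpace X] (σ : Measure X) {j : X → G 𝕂} (hj : Measurable j)
    (hσ : ∀ f : G 𝕂 → ℝ≥0∞, Measurable f →
      ∫⁻ g, f g ∂haarG 𝕂 = ∫⁻ x, ∫⁻ h, f (h * j x) ∂μ ∂σ)
    {f : G 𝕂 → ℂ} (hf : Continuous f)
    (hi : Integrable (fun x => f ((j x)⁻¹ * γ * j x)) σ) :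
    HasOrbitalIntegral γ f (∫ x, f ((j x)⁻¹ * γ * j x) ∂σ) := by
  let π : G 𝕂 → CosetSpace γ := Quotient.mk (QuotientGroup.rightRel (centr γ))
  have hπ : Measurable π := measurable_quotient_mk''
  have hπj : Measurable (π ∘ j) := hπ.comp hj
  have hconj : Continuous fun g : G 𝕂 => f (g⁻¹ * γ * g) := hf.comp (by fun_prop)
  have hF : Measurable fun q : CosetSpace γ => f ((q.out)⁻¹ * γ * q.out) := by
    refine measurable_from_quotient.2 ?_
    have e : (fun q : CosetSpace γ => f ((q.out)⁻¹ * γ * q.out)) ∘ Quotient.mk'' =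
        fun g : G 𝕂 => f (g⁻¹ * γ * g) := funext fun g => congrArg f (conj_out_eq γ g)
    rw [e]
    exact hconj.measurable
  have e1 : ∀ x, f (((π (j x)).out)⁻¹ * γ * (π (j x)).out) = f ((j x)⁻¹ * γ * j x) := fun x =>
    congrArg f (conj_out_eq γ (j x))
  refine ⟨μ, σ.map (π ∘ j), hμ, ?_, ?_, ?_⟩
  · intro f hf
    -- The chosen representative differs from `g` by an element of `G_γ`, which the right invariance
    -- of `μ` absorbs.
    have e2 : ∀ g, ∫⁻ h, f (h * (π g).out) ∂μ = ∫⁻ h, f (h * g) ∂μ := by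
      intro g
      obtain ⟨h₀, hh₀, e⟩ := exists_out_eq γ g
      have h1 := hinv h₀ hh₀ (fun h => f (h * g)) (hf.comp (measurable_mul_const g))
      rw [← h1]
      refine lintegral_congr fun h => ?_
      change f (h * (Quotient.mk (QuotientGroup.rightRel (centr γ)) g).out) = _
      rw [e, mul_assoc]
    have hm : Measurable fun q : CosetSpace γ => ∫⁻ h, f (h * q.out) ∂μ := by
      refine measurable_from_quotient.2 ?_
      have e : (fun q : CosetSpace γ => ∫⁻ h, f (h * q.out) ∂μ) ∘ Quotient.mk'' =
        fun g : G 𝕂 => ∫⁻ h, f (h * g) ∂μ := funext e2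
      rw [e]
      have : Measurable fun p : G 𝕂 × G 𝕂 => f (p.2 * p.1) :=
        hf.comp (measurable_snd.mul measurable_fst)
      exact this.lintegral_prod_right'
    rw [lintegral_map hm hπj, hσ f hf]
    exact lintegral_congr fun x => (e2 (j x)).symm
  · rw [integrable_map_measure hF.aestronglyMeasurable hπj.aemeasurable]
    exact hi.congr (Filter.Eventually.of_forall fun x => (e1 x).symm)
  · rw [integral_map hπj.aemeasurable hF.aestronglyMeasurable]
    exact integral_congr_ae (Filter.Eventually.of_forall e1)

end Quotient

/-! ### Diagonalization and centralizers of regular elements. -/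

section Hyperbolic

variable {𝕂 : Type} [RCLike 𝕂]

theorem weylDisc_eq (γ : G 𝕂) : weylDisc γ = (γ 0 0 + γ 1 1) ^ 2 - 4 := by
  rw [weylDisc, Matrix.trace_fin_two]

theorem weylDisc_conj (x γ : G 𝕂) : weylDisc (x * γ * x⁻¹) = weylDisc γ := by
  rw [weylDisc, weylDisc]
  simp only [Matrix.SpecialLinearGroup.coe_mul]
  rw [Matrix.trace_mul_comm, ← mul_assoc, ← Matrix.SpecialLinearGroup.coe_mul, inv_mul_cancel,
    Matrix.SpecialLinearGroup.coe_one, one_mul]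

theorem weylDisc_D {d : G 𝕂} (hd : d ∈ D 𝕂) : weylDisc d = (d 0 0 - d 1 1) ^ 2 := by
  rw [weylDisc_eq]
  linear_combination 4 * D_apply_mul hd

theorem mem_centr_conj_iff (x γ h : G 𝕂) :
    h ∈ centr γ ↔ x * h * x⁻¹ ∈ centr (x * γ * x⁻¹) := by
  simp only [centr, Subgroup.mem_centralizer_singleton_iff]
  constructor
  · intro e
    simp only [mul_assoc, inv_mul_cancel_left]
    rw [← mul_assoc h, e, mul_assoc]
  · intro e
    simp only [mul_assoc, inv_mul_cancel_left, mul_right_inj] at e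
    simpa only [← mul_assoc, mul_left_inj] using e

theorem mem_centr_D_iff {d : G 𝕂} (hd : d ∈ D 𝕂) (hne : weylDisc d ≠ 0) (h : G 𝕂) :
    h ∈ centr d ↔ h ∈ D 𝕂 := by
  have hne' : d 0 0 - d 1 1 ≠ 0 := fun h0 => hne (by rw [weylDisc_D hd, h0]; ring)
  rw [centr, Subgroup.mem_centralizer_singleton_iff]
  refine ⟨fun e => ?_, fun hh => D_mul_comm hh hd⟩
  have e1 : (h * d) 0 1 = (d * h) 0 1 := by rw [e]
  have e2 : (h * d) 1 0 = (d * h) 1 0 := by rw [e]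
  rw [mul_apply', mul_apply', hd.1] at e1
  rw [mul_apply', mul_apply', hd.2] at e2
  constructor
  · have : h 0 1 * (d 0 0 - d 1 1) = 0 := by linear_combination -e1
    exact (mul_eq_zero.1 this).resolve_right hne'
  · have : h 1 0 * (d 0 0 - d 1 1) = 0 := by linear_combination e2
    exact (mul_eq_zero.1 this).resolve_right hne'

/-- An element whose Weyl discriminant is a nonzero square is diagonalizable. -/
theorem exists_conj_mem_D {γ : G 𝕂} {δ : 𝕂} (hδ : δ ^ 2 = weylDisc γ) (h0 : δ ≠ 0) :
    ∃ x : G 𝕂, x * γ * x⁻¹ ∈ D 𝕂 := by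
  have hdet := det_eq γ
  rw [weylDisc_eq] at hδ
  rcases eq_or_ne (γ 1 0) 0 with hc | hc
  · have had : γ 0 0 - γ 1 1 ≠ 0 := by
      intro h
      apply h0
      have : δ ^ 2 = 0 := by
        rw [hδ]
        linear_combination (γ 0 0 - γ 1 1) * h + 4 * hdet + 4 * γ 0 1 * hc
      exact pow_eq_zero_iff (two_ne_zero) |>.1 this
    refine ⟨n (γ 0 1 / (γ 0 0 - γ 1 1)), ?_⟩
    obtain ⟨k1, k2, k3, k4⟩ := n_apply (γ 0 1 / (γ 0 0 - γ 1 1))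
    obtain ⟨l1, l2, l3, l4⟩ := n_apply (-(γ 0 1 / (γ 0 0 - γ 1 1)))
    rw [← n_neg]
    constructor
    · rw [mul_apply', mul_apply', mul_apply', k1, k2, l2, l4, hc]
      field_simp
      ring
    · rw [mul_apply', mul_apply', mul_apply', k3, k4, l1, l3, hc]
      ring
  -- `w` and `w'` are the eigenvalues, with `w - w' = δ`. The columns of `y` are the corresponding
  -- eigenvectors, the second scaled so that `det y = 1`.
  · set w := (γ 0 0 + γ 1 1 + δ) / 2 with hw
    set w' := (γ 0 0 + γ 1 1 - δ) / 2 with hw'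
    let y : G 𝕂 := ⟨!![w - γ 1 1, (w' - γ 1 1) / (γ 1 0 * δ); γ 1 0, 1 / δ], by
      rw [Matrix.det_fin_two_of, hw, hw']
      field_simp
      ring⟩
    have y1 : y 0 0 = w - γ 1 1 := rfl
    have y2 : y 0 1 = (w' - γ 1 1) / (γ 1 0 * δ) := rfl
    have y3 : y 1 0 = γ 1 0 := rfl
    have y4 : y 1 1 = 1 / δ := rfl
    refine ⟨y⁻¹, ?_⟩
    obtain ⟨i1, i2, i3, i4⟩ := inv_apply y
    rw [inv_inv, mul_assoc]
    constructor
    · rw [mul_apply', mul_apply', mul_apply', i1, i2, y2, y4, hw']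
      field_simp
      linear_combination -hδ - 4 * hdet
    · rw [mul_apply', mul_apply', mul_apply', i3, i4, y1, y3, hw]
      linear_combination γ 1 0 / 4 * hδ + γ 1 0 * hdet

end Hyperbolic
end SL2
end

noncomputable section

namespace SL2

set_option linter.unusedSectionVars false

/-! ### Orbital integrals of diagonalizable elements. -/

section HyperbolicIntegral

variable {𝕂 : Type} [RCLike 𝕂]

theorem measurable_a_mul_T : Measurable fun p : ℝ × T 𝕂 => a 𝕂 p.1 * (p.2 : G 𝕂) :=
  ((continuous_a.comp continuous_fst).mul
    (continuous_subtype_val.comp continuous_snd)).measurable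

/-- The Haar measure of `x⁻¹ D x`. -/
def conjHaarD (x : G 𝕂) : Measure (G 𝕂) := Measure.map (fun d => x⁻¹ * d * x) (haarD 𝕂)

instance instSFiniteHaarD : SFinite (haarD 𝕂) := by unfold haarD; infer_instance

instance instSFiniteConjHaarD (x : G 𝕂) : SFinite (conjHaarD x) := by
  unfold conjHaarD; infer_instance

theorem measurable_conj (x : G 𝕂) : Measurable fun d : G 𝕂 => x⁻¹ * d * x :=
  (measurable_const_mul x⁻¹).mul_const x

theorem lintegral_conjHaarD (x : G 𝕂) {f : G 𝕂 → ℝ≥0∞} (hf : Measurable f) :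
    ∫⁻ h, f h ∂conjHaarD x =
      ∫⁻ t : ℝ, ∫⁻ τ : T 𝕂, f (x⁻¹ * (a 𝕂 t * τ) * x) ∂haarProb (T 𝕂) := by
  rw [conjHaarD, lintegral_map hf (measurable_conj x), haarD]
  refine (lintegral_map (hf.comp (measurable_conj x)) measurable_a_mul_T).trans ?_
  exact lintegral_prod _ ((hf.comp (measurable_conj x)).comp measurable_a_mul_T).aemeasurable

theorem lintegral_conjHaarD_mul_right (x : G 𝕂) {h₀ : G 𝕂} (hh : x * h₀ * x⁻¹ ∈ D 𝕂)
    {f : G 𝕂 → ℝ≥0∞} (hf : Measurable f) :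
    ∫⁻ h, f (h * h₀) ∂conjHaarD x = ∫⁻ h, f h ∂conjHaarD x := by
  rw [lintegral_conjHaarD x hf]
  refine (lintegral_conjHaarD x (hf.comp (measurable_mul_const h₀))).trans ?_
  simp only [Function.comp]
  obtain ⟨τ₀, hτ₀, e⟩ := exists_D_decomposition hh
  set s := 2 * Real.log ‖(x * h₀ * x⁻¹) 0 0‖
  have e1 : ∀ t : ℝ, ∀ τ : T 𝕂, x⁻¹ * (a 𝕂 t * τ) * x * h₀ =
      x⁻¹ * (a 𝕂 (s + t) * ((⟨τ₀, hτ₀⟩ * τ : T 𝕂) : G 𝕂)) * x := by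
    intro t τ
    have hd : a 𝕂 t * (τ : G 𝕂) ∈ D 𝕂 := mul_mem (a_mem_D t) τ.2.1
    have h1 : x⁻¹ * (a 𝕂 t * τ) * x * h₀ = x⁻¹ * ((a 𝕂 t * τ) * (x * h₀ * x⁻¹)) * x := by group
    rw [h1, D_mul_comm hd hh, e, a_add, Subgroup.coe_mul]
    congr 2
    rw [mul_assoc, mul_assoc, ← mul_assoc τ₀, D_mul_comm hτ₀.1 (a_mem_D t), mul_assoc]
  simp only [e1]
  have h2 : ∀ t : ℝ, ∫⁻ τ : T 𝕂, f (x⁻¹ * (a 𝕂 (s + t) * ((⟨τ₀, hτ₀⟩ * τ : T 𝕂) : G 𝕂)) * x)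
      ∂haarProb (T 𝕂) = ∫⁻ τ : T 𝕂, f (x⁻¹ * (a 𝕂 (s + t) * (τ : G 𝕂)) * x) ∂haarProb (T 𝕂) :=
    fun t => lintegral_mul_left_eq_self
      (fun τ : T 𝕂 => f (x⁻¹ * (a 𝕂 (s + t) * (τ : G 𝕂)) * x)) _
  simp only [h2]
  exact lintegral_add_left_eq_self (fun t => ∫⁻ τ : T 𝕂, f (x⁻¹ * (a 𝕂 t * (τ : G 𝕂)) * x)
    ∂haarProb (T 𝕂)) s

variable [MeasureSpace 𝕂] [BorelSpace 𝕂] [(volume : Measure 𝕂).IsAddHaarMeasure]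

theorem measurable_n_mul_K (x : G 𝕂) : Measurable fun p : 𝕂 × K 𝕂 => x⁻¹ * n p.1 * (p.2 : G 𝕂) :=
  ((continuous_const.mul (continuous_n.comp continuous_fst)).mul
    (continuous_subtype_val.comp continuous_snd)).measurable

/-- Moving `τ` to the right past `n(y)` multiplies `y` by a number of modulus one, and `τ` is then
absorbed by the integral over `K`. -/
theorem lintegral_T_mul_n_mul_K {f : G 𝕂 → ℝ≥0∞} (hf : Measurable f) (t : ℝ) {τ : G 𝕂}
    (hτ : τ ∈ T 𝕂) : ∫⁻ p : 𝕂 × K 𝕂, f (a 𝕂 t * τ * n p.1 * p.2)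
      ∂((volume : Measure 𝕂).prod (haarProb (K 𝕂))) =
      ∫⁻ y : 𝕂, ∫⁻ k : K 𝕂, f (a 𝕂 t * n y * k) ∂haarProb (K 𝕂) := by
  have hc : Continuous fun p : 𝕂 × K 𝕂 => a 𝕂 t * τ * n p.1 * (p.2 : G 𝕂) :=
    (continuous_const.mul (continuous_n.comp continuous_fst)).mul
      (continuous_subtype_val.comp continuous_snd)
  have h1 : ∫⁻ p : 𝕂 × K 𝕂, f (a 𝕂 t * τ * n p.1 * p.2)
      ∂((volume : Measure 𝕂).prod (haarProb (K 𝕂))) =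
      ∫⁻ y : 𝕂, ∫⁻ k : K 𝕂, f (a 𝕂 t * τ * n y * k) ∂haarProb (K 𝕂) :=
    lintegral_prod (fun p : 𝕂 × K 𝕂 => f (a 𝕂 t * τ * n p.1 * p.2))
      (hf.comp hc.measurable).aemeasurable
  have h2 : ∀ y : 𝕂, a 𝕂 t * τ * n y = a 𝕂 t * n (τ 0 0 ^ 2 * y) * τ := fun y => by
    rw [mul_assoc, D_mul_n hτ.1, mul_assoc]
  have h3 : ∀ y : 𝕂, ∫⁻ k : K 𝕂, f (a 𝕂 t * τ * n y * k) ∂haarProb (K 𝕂) =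
      ∫⁻ k : K 𝕂, f (a 𝕂 t * n (τ 0 0 ^ 2 * y) * k) ∂haarProb (K 𝕂) := fun y => by
    rw [h2 y]
    exact lintegral_K_mul f (a 𝕂 t * n (τ 0 0 ^ 2 * y)) hτ.2
  rw [h1]
  simp only [h3]
  have hm := (measurable_lintegral_K hf).comp (measurable_prodMk_left (x := t))
  exact lintegral_unit_mul (z := τ 0 0 ^ 2) (by rw [norm_pow, norm_T_apply hτ, one_pow]) hm

/-- In the order `ANK` the factor `A` stands on the left, so `N × K` parametrizes the cosets of `D =
AT`; the integral over `T` is harmless because its total mass is `1`. Conjugation by `x` only adds a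
left translation. -/
theorem lintegral_haarG_eq_conjHaarD (x : G 𝕂) {f : G 𝕂 → ℝ≥0∞} (hf : Measurable f) :
    ∫⁻ g, f g ∂haarG 𝕂 = ∫⁻ p : 𝕂 × K 𝕂, ∫⁻ h, f (h * (x⁻¹ * n p.1 * (p.2 : G 𝕂))) ∂conjHaarD x
      ∂((volume : Measure 𝕂).prod (haarProb (K 𝕂))) := by
  have hm : Measurable fun q : (𝕂 × K 𝕂) × G 𝕂 => f (q.2 * (x⁻¹ * n q.1.1 * (q.1.2 : G 𝕂))) :=
    hf.comp (measurable_snd.mul ((measurable_n_mul_K x).comp measurable_fst))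
  have hm' : Measurable fun h : G 𝕂 => ∫⁻ p : 𝕂 × K 𝕂, f (h * (x⁻¹ * n p.1 * (p.2 : G 𝕂)))
      ∂((volume : Measure 𝕂).prod (haarProb (K 𝕂))) := hm.lintegral_prod_left'
  rw [lintegral_lintegral_swap hm.aemeasurable, lintegral_conjHaarD x hm']
  have e1 : ∀ (t : ℝ) (τ : T 𝕂) (p : 𝕂 × K 𝕂),
      x⁻¹ * (a 𝕂 t * τ) * x * (x⁻¹ * n p.1 * (p.2 : G 𝕂)) =
        x⁻¹ * (a 𝕂 t * τ * n p.1 * p.2) := by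
    intro t τ p
    group
  have key : ∀ (t : ℝ) (τ : T 𝕂), ∫⁻ p : 𝕂 × K 𝕂, f (x⁻¹ * (a 𝕂 t * τ * n p.1 * p.2))
      ∂((volume : Measure 𝕂).prod (haarProb (K 𝕂))) =
      ∫⁻ y : 𝕂, ∫⁻ k : K 𝕂, f (x⁻¹ * (a 𝕂 t * n y * k)) ∂haarProb (K 𝕂) := fun t τ =>
    lintegral_T_mul_n_mul_K (hf.comp (measurable_const_mul x⁻¹)) t τ.2
  simp only [e1]
  simp only [key, lintegral_const, measure_univ, mul_one]
  rw [← lintegral_haarG_mul hf, lintegral_mul_left_eq_self]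

theorem integral_comp_mul {E : Type*} [NormedAddCommGroup E] [NormedSpace ℝ E] (f : 𝕂 → E)
    {c : 𝕂} (hc : c ≠ 0) : ∫ x : 𝕂, f (c * x) = (absK c)⁻¹ • ∫ x : 𝕂, f x := by
  have hn : 0 < ‖c‖ := norm_pos_iff.2 hc
  have hn' : (‖c‖ : 𝕂) ≠ 0 := by exact_mod_cast hn.ne'
  set z : 𝕂 := c / (‖c‖ : 𝕂) with hz
  have hz1 : ‖z‖ = 1 := by rw [hz, norm_div, RCLike.norm_ofReal, abs_norm, div_self hn.ne']
  have h1 := integral_comp_exp_mul (𝕂 := 𝕂) (fun y => f (z * y)) (Real.log ‖c‖)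
  have h2 : ∫ x : 𝕂, f (z * x) = ∫ x : 𝕂, f x := by
    have he : MeasurableEmbedding fun x : 𝕂 => z * x := by
      have hz0 : z ≠ 0 := by rintro h; simp [h] at hz1
      exact (MeasurableEquiv.mulLeft₀ z hz0).measurableEmbedding
    exact (measurePreserving_unit_mul hz1).integral_comp he f
  rw [h2, Real.exp_log hn] at h1
  have e : ∀ x : 𝕂, z * ((‖c‖ : 𝕂) * x) = c * x := by
    intro x
    rw [hz]
    field_simp
  simp only [e] at h1
  rw [h1, absK, Real.exp_neg, mul_comm, Real.exp_mul, Real.exp_log hn, Real.rpow_natCast]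

/-- The orbital integral of a diagonalizable element in terms of the Abel transform. -/
theorem exists_hasOrbitalIntegral_of_diagonalizable {f : G 𝕂 → ℝ} (hf : Continuous f)
    (hs : HasCompactSupport f) (hK : ∀ k₁ ∈ K 𝕂, ∀ k₂ ∈ K 𝕂, ∀ g, f (k₁ * g * k₂) = f g)
    {γ x : G 𝕂} (hγ : IsRegularSemisimple γ) (hx : x * γ * x⁻¹ ∈ D 𝕂) :
    ∃ (s : ℝ) (O : ℂ), HasOrbitalIntegral γ (fun g => ((f g : ℝ) : ℂ)) O ∧
      absK (weylDisc γ) ^ (1 / 2 : ℝ) * ‖O‖ = |abel f s| := by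
  set d := x * γ * x⁻¹ with hd
  have hΔ : weylDisc d = weylDisc γ := weylDisc_conj x γ
  have hreg : weylDisc d ≠ 0 := hΔ ▸ hγ
  have hdd := D_apply_mul hx
  obtain ⟨τ, hτ, e⟩ := exists_D_decomposition hx
  set s := 2 * Real.log ‖d 0 0‖ with hs'
  have hd0 : d 0 0 ≠ 0 := left_ne_zero_of_mul_eq_one hdd
  have hexp : Real.exp s = ‖d 0 0‖ ^ 2 := by
    rw [hs', mul_comm, Real.exp_mul, Real.exp_log (norm_pos_iff.2 hd0)]
    norm_cast
  have hl : ∀ k ∈ K 𝕂, ∀ g, f (k * g) = f g := fun k hk g => by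
    simpa using hK k hk 1 (one_mem _) g
  have hr : ∀ g, ∀ k ∈ K 𝕂, f (g * k) = f g := fun g k hk => by
    simpa using hK 1 (one_mem _) k hk g
  -- Conjugating `d` by `n(y)` gives `n((d₀₀² - 1)y) d`. Writing `d = a(s)τ` and passing `a(s)` to
  -- the left contributes the factor `e^{-s}`.
  set c : 𝕂 := ((Real.exp (-s) : ℝ) : 𝕂) * (d 0 0 ^ 2 - 1) with hc
  have hdisc : weylDisc d * d 0 0 ^ 2 = (d 0 0 ^ 2 - 1) ^ 2 := by
    rw [weylDisc_D hx]
    linear_combination (d 0 0 ^ 2 * (-2) + d 0 0 * d 1 1 + 1) * hdd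
  have hc0 : c ≠ 0 := by
    refine mul_ne_zero (by exact_mod_cast (Real.exp_pos _).ne') fun h => ?_
    rw [h] at hdisc
    have := mul_ne_zero hreg (pow_ne_zero 2 hd0)
    exact this (by rw [hdisc]; ring)
  have hval : ∀ y : 𝕂, ∀ k ∈ K 𝕂, f ((x⁻¹ * n y * k)⁻¹ * γ * (x⁻¹ * n y * k)) =
      f (a 𝕂 s * n (c * y)) := by
    intro y k hk
    have e1 : (x⁻¹ * n y * k)⁻¹ * γ * (x⁻¹ * n y * k) = k⁻¹ * (n (-y) * (d * n y)) * k := by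
      rw [n_neg, hd]; group
    have e2 : n (-y) * (d * n y) = n ((d 0 0 ^ 2 - 1) * y) * a 𝕂 s * τ := by
      rw [D_mul_n hx, ← mul_assoc, ← n_add, mul_assoc, ← e]
      congr 2
      ring
    rw [e1, hK _ (inv_mem hk) _ hk, e2, hr _ _ hτ.2, n_mul_a, hc, mul_assoc]
  have hsf : HasCompactSupport fun y : 𝕂 => f (a 𝕂 s * n (c * y)) := by
    obtain ⟨R, hR⟩ := IsCompact.bddAbove_image hs continuous_cH.continuousOn
    have hkc := (isCompact_cH_an_le (𝕂 := 𝕂) R).image (f := fun p => c⁻¹ * p.2) (by fun_prop)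
    refine HasCompactSupport.intro hkc fun y hy => ?_
    by_contra hne
    exact hy ⟨(s, c * y), hR ⟨_, subset_closure hne, rfl⟩, by simp [hc0]⟩
  have hcf : Continuous fun y : 𝕂 => f (a 𝕂 s * n (c * y)) :=
    hf.comp (continuous_const.mul (continuous_n.comp (by fun_prop)))
  have hint : Integrable (fun y : 𝕂 => ((f (a 𝕂 s * n (c * y)) : ℝ) : ℂ)) :=
    (hcf.integrable_of_hasCompactSupport hsf).ofReal
  have hμ : IsCentralizerMeasure γ (conjHaarD x) :=
    Or.inl ⟨x, fun h => by rw [mem_centr_conj_iff x, mem_centr_D_iff hx hreg], rfl⟩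
  have horb := hasOrbitalIntegral_of_param hμ (fun h₀ hh₀ f hf => lintegral_conjHaarD_mul_right x
      ((mem_centr_D_iff hx hreg _).1 ((mem_centr_conj_iff x γ h₀).1 hh₀)) hf)
    ((volume : Measure 𝕂).prod (haarProb (K 𝕂))) (measurable_n_mul_K x)
    (fun f hf => lintegral_haarG_eq_conjHaarD x hf) (f := fun g => ((f g : ℝ) : ℂ))
    (Complex.continuous_ofReal.comp hf) (by
      simp only [fun p : 𝕂 × K 𝕂 => hval p.1 p.2 p.2.2]
      exact hint.comp_fst _)
  refine ⟨s, _, horb, ?_⟩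
  simp only [fun p : 𝕂 × K 𝕂 => hval p.1 p.2 p.2.2]
  rw [integral_fun_fst (fun y : 𝕂 => ((f (a 𝕂 s * n (c * y)) : ℝ) : ℂ)), probReal_univ, one_smul,
    integral_complex_ofReal, Complex.norm_real, integral_comp_mul (fun y => f (a 𝕂 s * n y)) hc0,
    smul_eq_mul, Real.norm_eq_abs, abs_mul, abs_inv, abel, abs_mul, abs_of_pos (Real.exp_pos _),
    ← mul_assoc]
  congr 1
  have hn : 0 < ‖d 0 0‖ := norm_pos_iff.2 hd0
  have hcpos : 0 < absK c := pow_pos (norm_pos_iff.2 hc0) _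
  rw [abs_of_pos hcpos, ← div_eq_mul_inv, div_eq_iff hcpos.ne']
  -- This identity turns `|Δ|^{1/2}` divided by the Jacobian `|c|_𝕂` into `e^{ρs/2}`, the
  -- normalizing factor of the Abel transform.
  have hnd : ‖weylDisc γ‖ = Real.exp s * ‖c‖ ^ 2 := by
    have h1 := congrArg norm hdisc
    rw [norm_mul, norm_pow, norm_pow, ← hexp] at h1
    rw [hc, norm_mul, RCLike.norm_ofReal, abs_of_pos (Real.exp_pos _), mul_pow, ← h1, ← hΔ,
      Real.exp_neg]
    field_simp
  rw [absK, absK, hnd, ← Real.rpow_natCast, ← Real.rpow_mul (by positivity), mul_comm (rho 𝕂 : ℝ),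
    Real.rpow_mul (by positivity), Real.rpow_natCast, ← exp_half_sq, ← mul_pow,
    ← Real.sqrt_eq_rpow, Real.sqrt_sq (by positivity), mul_pow, ← Real.exp_nat_mul]
  congr 2
  ring

end HyperbolicIntegral
end SL2
end

noncomputable section

namespace SL2

/-! ### Polar integration in the plane, with and without a Poisson kernel. -/

section PlaneIntegrals

open Set

theorem lintegral_comp_mul_left {g : ℝ → ℝ≥0∞} (hg : Measurable g) {c : ℝ} (hc : c ≠ 0) :
    ∫⁻ x, g (c * x) = ENNReal.ofReal |c⁻¹| * ∫⁻ x, g x := by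
  rw [← lintegral_map hg (measurable_const_mul c), Real.map_volume_mul_left hc,
    lintegral_smul_measure, smul_eq_mul]

theorem lintegral_abs_mul_comp_sq (g : ℝ → ℝ≥0∞) :
    ∫⁻ x : ℝ, ENNReal.ofReal |x| * g (x ^ 2) = ∫⁻ q in Ioi (0 : ℝ), g q := by
  have himg : (fun x : ℝ => x ^ 2) '' Ioi 0 = Ioi 0 := by
    ext y
    constructor
    · rintro ⟨x, hx, rfl⟩
      exact pow_pos (mem_Ioi.1 hx) 2
    · intro hy
      exact ⟨Real.sqrt y, Real.sqrt_pos.2 hy, Real.sq_sqrt (le_of_lt hy)⟩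
  have h1 : ∫⁻ q in Ioi (0 : ℝ), g q = ∫⁻ x in Ioi (0 : ℝ), ENNReal.ofReal |2 * x| * g (x ^ 2) := by
    have h := lintegral_image_eq_lintegral_abs_deriv_mul (f := fun x : ℝ => x ^ 2)
      (f' := fun x => 2 * x) (measurableSet_Ioi (a := (0 : ℝ))) (fun x _ => by
        simpa using (hasDerivAt_pow 2 x).hasDerivWithinAt)
      (fun x hx y hy h => by
        have := mem_Ioi.1 hx
        have := mem_Ioi.1 hy
        exact (pow_left_inj₀ (by linarith) (by linarith) two_ne_zero).1 h) g
    rwa [himg] at h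
  have h2 : ∫⁻ x in Iio (0 : ℝ), ENNReal.ofReal |x| * g (x ^ 2) =
      ∫⁻ x in Ioi (0 : ℝ), ENNReal.ofReal |x| * g (x ^ 2) := by
    have h := lintegral_image_eq_lintegral_abs_deriv_mul (f := fun x : ℝ => -x)
      (f' := fun _ => -1) (measurableSet_Ioi (a := (0 : ℝ))) (fun x _ =>
        (hasDerivAt_neg x).hasDerivWithinAt) neg_injective.injOn
        (fun x => ENNReal.ofReal |x| * g (x ^ 2))
    simpa using h
  have h3 : ∫⁻ x : ℝ, ENNReal.ofReal |x| * g (x ^ 2) =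
      (∫⁻ x in Iio (0 : ℝ), ENNReal.ofReal |x| * g (x ^ 2)) +
      ∫⁻ x in Ioi (0 : ℝ), ENNReal.ofReal |x| * g (x ^ 2) := by
    rw [← lintegral_add_compl _ (measurableSet_Iio (a := (0 : ℝ))), compl_Iio,
      setLIntegral_congr Ioi_ae_eq_Ici.symm]
  rw [h3, h2, h1, ← two_mul, ← lintegral_const_mul' _ _ (by simp)]
  refine lintegral_congr fun x => ?_
  rw [abs_mul, ENNReal.ofReal_mul (abs_nonneg _), ← mul_assoc]
  simp

/-- Integration over the plane in the coordinates `R = x² + y²` and `p = y / x`. -/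
theorem lintegral_lintegral_comp_sq_add_sq {W g : ℝ → ℝ≥0∞} (hW : Measurable W)
    (hg : Measurable g) :
    ∫⁻ x : ℝ, ∫⁻ y : ℝ, W (x ^ 2) * g (x ^ 2 + y ^ 2) =
      ∫⁻ R in Ioi (0 : ℝ), (∫⁻ p : ℝ, ENNReal.ofReal (1 + p ^ 2)⁻¹ * W ((1 + p ^ 2)⁻¹ * R)) * g R := by
  -- The coordinates are reached in three substitutions: `y = xp` for fixed `x`, then `q = x²`, then
  -- `R = (1 + p²)q`.
  have h1 : ∀ x : ℝ, x ≠ 0 → ∫⁻ y : ℝ, W (x ^ 2) * g (x ^ 2 + y ^ 2) =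
      ∫⁻ p : ℝ, ENNReal.ofReal |x| * (W (x ^ 2) * g ((1 + p ^ 2) * x ^ 2)) := by
    intro x hx
    have h := lintegral_comp_mul_left (g := fun y => W (x ^ 2) * g (x ^ 2 + y ^ 2))
      (by fun_prop) hx
    have e : ∀ p : ℝ, x ^ 2 + (x * p) ^ 2 = (1 + p ^ 2) * x ^ 2 := fun p => by ring
    simp only [e] at h
    symm
    rw [lintegral_const_mul' _ _ (by simp), h, ← mul_assoc, ← ENNReal.ofReal_mul (abs_nonneg _),
      ← abs_mul, mul_inv_cancel₀ hx]
    simp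
  have h2 : ∫⁻ x : ℝ, ∫⁻ y : ℝ, W (x ^ 2) * g (x ^ 2 + y ^ 2) =
      ∫⁻ x : ℝ, ∫⁻ p : ℝ, ENNReal.ofReal |x| * (W (x ^ 2) * g ((1 + p ^ 2) * x ^ 2)) := by
    refine lintegral_congr_ae ?_
    filter_upwards [(countable_singleton (0 : ℝ)).ae_notMem volume] with x hx
    exact h1 x hx
  rw [h2, lintegral_lintegral_swap (by fun_prop)]
  have h3 : ∀ p : ℝ, ∫⁻ x : ℝ, ENNReal.ofReal |x| * (W (x ^ 2) * g ((1 + p ^ 2) * x ^ 2)) =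
      ∫⁻ R in Ioi (0 : ℝ), ENNReal.ofReal (1 + p ^ 2)⁻¹ * W ((1 + p ^ 2)⁻¹ * R) * g R := by
    intro p
    have hp : 0 < 1 + p ^ 2 := by positivity
    rw [lintegral_abs_mul_comp_sq (fun q => W q * g ((1 + p ^ 2) * q)),
      ← lintegral_indicator measurableSet_Ioi, ← lintegral_indicator measurableSet_Ioi]
    have h := lintegral_comp_mul_left (g := (Ioi (0 : ℝ)).indicator fun R =>
      W ((1 + p ^ 2)⁻¹ * R) * g R) (Measurable.indicator (by fun_prop) measurableSet_Ioi) hp.ne'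
    rw [abs_of_pos (inv_pos.2 hp), ← lintegral_const_mul' _ _ (by simp)] at h
    refine Eq.trans (lintegral_congr fun q => ?_) (h.trans (lintegral_congr fun R => ?_))
    · by_cases hq : 0 < q
      · rw [indicator_of_mem (mem_Ioi.2 hq), indicator_of_mem (mem_Ioi.2 (mul_pos hp hq)),
          inv_mul_cancel_left₀ hp.ne']
      · rw [indicator_of_notMem (by simpa using hq), indicator_of_notMem]
        rw [mem_Ioi, mul_pos_iff_of_pos_left hp]
        exact hq
    · by_cases hR : 0 < R
      · rw [indicator_of_mem (mem_Ioi.2 hR), indicator_of_mem (mem_Ioi.2 hR), mul_assoc]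
      · rw [indicator_of_notMem (by simpa using hR), indicator_of_notMem (by simpa using hR),
          mul_zero]
  simp only [h3]
  rw [lintegral_lintegral_swap (by fun_prop)]
  refine lintegral_congr fun R => ?_
  rw [lintegral_mul_const]
  fun_prop

theorem integrable_inv_add_mul_sq {α β : ℝ} (hα : 0 < α) (hβ : 0 < β) :
    Integrable (fun p : ℝ => (α + β * p ^ 2)⁻¹) ∧
      ∫ p : ℝ, (α + β * p ^ 2)⁻¹ = Real.pi / Real.sqrt (α * β) := by
  set c := Real.sqrt (β / α) with hc
  have hc0 : 0 < c := Real.sqrt_pos.2 (by positivity)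
  have hc2 : c ^ 2 = β / α := Real.sq_sqrt (by positivity)
  have e : ∀ p : ℝ, (α + β * p ^ 2)⁻¹ = α⁻¹ * (1 + (c * p) ^ 2)⁻¹ := by
    intro p
    rw [mul_pow, hc2, ← mul_inv]
    congr 1
    field_simp
  simp only [e]
  constructor
  · exact (integrable_inv_one_add_sq.comp_mul_left' hc0.ne').const_mul _
  · rw [integral_const_mul, Measure.integral_comp_mul_left (fun p : ℝ => (1 + p ^ 2)⁻¹),
      integral_univ_inv_one_add_sq, smul_eq_mul, abs_of_pos (inv_pos.2 hc0)]
    have : Real.sqrt (α * β) = α * c := by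
      rw [show α * β = (α * c) ^ 2 by rw [mul_pow, hc2]; field_simp, Real.sqrt_sq (by positivity)]
    rw [this]
    field_simp

theorem lintegral_inv_add_mul_sq {α β : ℝ} (hα : 0 < α) (hβ : 0 < β) :
    ∫⁻ p : ℝ, ENNReal.ofReal (α + β * p ^ 2)⁻¹ =
      ENNReal.ofReal (Real.pi / Real.sqrt (α * β)) := by
  obtain ⟨h1, h2⟩ := integrable_inv_add_mul_sq hα hβ
  rw [← h2, ofReal_integral_eq_lintegral_ofReal h1]
  exact Filter.Eventually.of_forall fun p => by positivity

theorem lintegral_lintegral_radial {g : ℝ → ℝ≥0∞} (hg : Measurable g) :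
    ∫⁻ x : ℝ, ∫⁻ y : ℝ, g (x ^ 2 + y ^ 2) =
      ENNReal.ofReal Real.pi * ∫⁻ R in Ioi (0 : ℝ), g R := by
  have h := lintegral_lintegral_comp_sq_add_sq (W := fun _ => 1) measurable_const hg
  have h1 := lintegral_inv_add_mul_sq one_pos one_pos
  simp only [one_mul, mul_one, Real.sqrt_one, div_one] at h h1
  rw [h, h1, lintegral_const_mul' _ _ (by simp)]

/-- For the weight `√b / (b + x²)` the integral over the slope `p` becomes `√b ∫ dp / ((b + R) +
bp²)`. Hence a radial integral with weight `1/√(b + R)` is an average of integrals along vertical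
lines. -/
theorem lintegral_lintegral_poisson {b : ℝ} (hb : 0 < b) {g : ℝ → ℝ≥0∞} (hg : Measurable g) :
    ∫⁻ x : ℝ, ∫⁻ y : ℝ, ENNReal.ofReal (Real.sqrt b * (b + x ^ 2)⁻¹) * g (x ^ 2 + y ^ 2) =
      ∫⁻ R in Ioi (0 : ℝ), ENNReal.ofReal (Real.pi / Real.sqrt (b + R)) * g R := by
  have h := lintegral_lintegral_comp_sq_add_sq
    (W := fun q => ENNReal.ofReal (Real.sqrt b * (b + q)⁻¹)) (by fun_prop) hg
  rw [h]
  refine setLIntegral_congr_fun measurableSet_Ioi fun R hR => ?_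
  have hR' : 0 < R := hR
  congr 1
  have e : ∀ p : ℝ, ENNReal.ofReal (1 + p ^ 2)⁻¹ *
      ENNReal.ofReal (Real.sqrt b * (b + (1 + p ^ 2)⁻¹ * R)⁻¹) =
      ENNReal.ofReal (Real.sqrt b) * ENNReal.ofReal ((b + R) + b * p ^ 2)⁻¹ := by
    intro p
    rw [← ENNReal.ofReal_mul (by positivity), ← ENNReal.ofReal_mul (by positivity)]
    congr 1
    have : 0 < 1 + p ^ 2 := by positivity
    field_simp
    ring
  simp only [e]
  rw [lintegral_const_mul' _ _ (by simp), lintegral_inv_add_mul_sq (by linarith) hb,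
    ← ENNReal.ofReal_mul (by positivity)]
  congr 1
  rw [Real.sqrt_mul (by linarith)]
  have := Real.sqrt_pos.2 hb
  have := Real.sqrt_pos.2 (show 0 < b + R by linarith)
  field_simp

/-- The hypothesis says that two weighted image measures on `ℝ` coincide, so the identity passes to
signed functions, with no integrability to check. -/
theorem integral_eq_of_lintegral_eq {X Y : Type*} [MeasurableSpace X] [MeasurableSpace Y]
    {μ : Measure X} {ν : Measure Y} {S : X → ℝ} {T : Y → ℝ} {v : X → ℝ} {w : Y → ℝ}
    (hS : Measurable S) (hT : Measurable T) (hv : Measurable v) (hw : Measurable w)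
    (hv0 : ∀ x, 0 ≤ v x) (hw0 : ∀ y, 0 ≤ w y)
    (h : ∀ g : ℝ → ℝ≥0∞, Measurable g →
      ∫⁻ x, ENNReal.ofReal (v x) * g (S x) ∂μ = ∫⁻ y, ENNReal.ofReal (w y) * g (T y) ∂ν)
    {f : ℝ → ℝ} (hf : Measurable f) :
    ∫ x, v x * f (S x) ∂μ = ∫ y, w y * f (T y) ∂ν := by
  have hm : (μ.withDensity fun x => ENNReal.ofReal (v x)).map S =
      (ν.withDensity fun y => ENNReal.ofReal (w y)).map T := by
    refine Measure.ext_of_lintegral _ fun g hg => ?_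
    rw [lintegral_map hg hS, lintegral_map hg hT]
    exact ((lintegral_withDensity_eq_lintegral_mul μ hv.ennreal_ofReal (hg.comp hS)).trans
      (h g hg)).trans
      (lintegral_withDensity_eq_lintegral_mul ν hw.ennreal_ofReal (hg.comp hT)).symm
  have h1 : ∫ r, f r ∂((μ.withDensity fun x => ENNReal.ofReal (v x)).map S) =
      ∫ r, f r ∂((ν.withDensity fun y => ENNReal.ofReal (w y)).map T) := by rw [hm]
  rw [integral_map hS.aemeasurable hf.aestronglyMeasurable,
    integral_map hT.aemeasurable hf.aestronglyMeasurable,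
    integral_withDensity_eq_integral_toReal_smul hv.ennreal_ofReal (by simp),
    integral_withDensity_eq_integral_toReal_smul hw.ennreal_ofReal (by simp)] at h1
  simpa only [ENNReal.toReal_ofReal (hv0 _), ENNReal.toReal_ofReal (hw0 _), smul_eq_mul] using h1

/-- The integral over the plane against the Poisson kernel in one variable. -/
theorem integral_poisson {b : ℝ} (hb : 0 < b) {f : ℝ → ℝ} (hf : Measurable f) :
    ∫ p : ℝ × ℝ, Real.sqrt b * (b + p.1 ^ 2)⁻¹ * f (p.1 ^ 2 + p.2 ^ 2) =
      ∫ R in Ioi (0 : ℝ), Real.pi / Real.sqrt (b + R) * f R := by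
  refine integral_eq_of_lintegral_eq (T := fun R => R) (by fun_prop) (by fun_prop) (by fun_prop)
    (by fun_prop) (fun p => by positivity) (fun R => by positivity) (fun g hg => ?_) hf
  rw [← lintegral_lintegral_poisson hb hg, Measure.volume_eq_prod, lintegral_prod]
  fun_prop

theorem integral_radial {f : ℝ → ℝ} (hf : Measurable f) :
    ∫ p : ℝ × ℝ, f (p.1 ^ 2 + p.2 ^ 2) = Real.pi * ∫ R in Ioi (0 : ℝ), f R := by
  have h := integral_eq_of_lintegral_eq (μ := (volume : Measure (ℝ × ℝ)))
    (ν := volume.restrict (Ioi (0 : ℝ)))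
    (S := fun p => p.1 ^ 2 + p.2 ^ 2) (T := fun R => R) (v := fun _ => 1) (w := fun _ => Real.pi)
    (by fun_prop) (by fun_prop) (by fun_prop)
    (by fun_prop) (fun p => by positivity) (fun R => by positivity) (fun g hg => by
      rw [lintegral_const_mul' _ _ (by simp), lintegral_const_mul' _ _ (by simp),
        ← lintegral_lintegral_radial hg, Measure.volume_eq_prod, lintegral_prod _ (by fun_prop)]
      simp) hf
  simpa [integral_const_mul] using h

/-- The distribution of `cH - 1` on the upper half plane. -/
theorem lintegral_comp_cosh {g : ℝ → ℝ≥0∞} (hg : Measurable g) :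
    ∫⁻ t : ℝ, ∫⁻ x : ℝ, g (Real.cosh t - 1 + Real.exp t * x ^ 2 / 2) =
      ENNReal.ofReal (2 * Real.pi) * ∫⁻ R in Ioi (0 : ℝ), g R := by
  set h : ℝ → ℝ≥0∞ := fun z => ∫⁻ y : ℝ, g (z + y ^ 2) with hh
  have hhm : Measurable h := by
    have : Measurable fun q : ℝ × ℝ => g (q.1 + q.2 ^ 2) := by fun_prop
    exact this.lintegral_prod_right'
  have h2 : (0 : ℝ) < Real.sqrt 2 := by positivity
  have hs2 : Real.sqrt 2 * Real.sqrt 2 = 2 := Real.mul_self_sqrt (by norm_num)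
  have h1 : ∀ t : ℝ, ∫⁻ x : ℝ, g (Real.cosh t - 1 + Real.exp t * x ^ 2 / 2) =
      ENNReal.ofReal (Real.sqrt 2 * Real.exp (-t / 2)) * h (Real.cosh t - 1) := by
    intro t
    have hc : Real.exp (t / 2) / Real.sqrt 2 ≠ 0 := by positivity
    have h := lintegral_comp_mul_left (g := fun y => g (Real.cosh t - 1 + y ^ 2)) (by fun_prop) hc
    have e : ∀ x : ℝ, (Real.exp (t / 2) / Real.sqrt 2 * x) ^ 2 = Real.exp t * x ^ 2 / 2 := by
      intro x
      rw [mul_pow, div_pow, exp_half_sq, Real.sq_sqrt (by norm_num)]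
      ring
    simp only [e] at h
    rw [h]
    congr 2
    rw [abs_of_pos (by positivity), inv_div, neg_div, Real.exp_neg]
    rfl
  simp only [h1]
  have hneg : ∫⁻ t : ℝ, ENNReal.ofReal (Real.sqrt 2 * Real.exp (-t / 2)) * h (Real.cosh t - 1) =
      ∫⁻ t : ℝ, ENNReal.ofReal (Real.sqrt 2 * Real.exp (t / 2)) * h (Real.cosh t - 1) := by
    rw [← lintegral_neg_eq_self]
    simp
  -- Averaging over `t ↦ -t` replaces the exponential by `cosh(t/2)`, which up to a constant is the
  -- derivative of `z = √2 sinh(t/2)`; and `z² = cosh t - 1`.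
  have hsum : 2 * ∫⁻ t : ℝ, ENNReal.ofReal (Real.sqrt 2 * Real.exp (-t / 2)) * h (Real.cosh t - 1) =
      2 * ∫⁻ t : ℝ, ENNReal.ofReal (Real.sqrt 2 * Real.cosh (t / 2)) * h (Real.cosh t - 1) := by
    rw [two_mul]
    nth_rewrite 2 [hneg]
    rw [← lintegral_add_left (by fun_prop), ← lintegral_const_mul' _ _ (by simp)]
    refine lintegral_congr fun t => ?_
    rw [← add_mul, ← mul_assoc, ← ENNReal.ofReal_add (by positivity) (by positivity),
      show (2 : ℝ≥0∞) = ENNReal.ofReal 2 by simp, ← ENNReal.ofReal_mul (by positivity),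
      Real.cosh_eq (t / 2), neg_div]
    congr 2
    ring
  have hkey := (ENNReal.mul_right_inj (by simp) (by simp)).1 hsum
  rw [hkey]
  have himg : (fun t : ℝ => Real.sqrt 2 * Real.sinh (t / 2)) '' univ = univ := by
    rw [image_univ, range_eq_univ]
    intro z
    refine ⟨2 * Real.arsinh (z / Real.sqrt 2), ?_⟩
    simp only
    rw [mul_div_cancel_left₀ _ two_ne_zero, Real.sinh_arsinh]
    field_simp
  have hcv := lintegral_image_eq_lintegral_abs_deriv_mul
    (f := fun t : ℝ => Real.sqrt 2 * Real.sinh (t / 2))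
    (f' := fun t => Real.sqrt 2 * (Real.cosh (t / 2) * (1 / 2))) MeasurableSet.univ (fun t _ =>
      ((((hasDerivAt_id t).div_const 2).sinh).const_mul (Real.sqrt 2)).hasDerivWithinAt) (fun x _ y _ hxy => by
      have := mul_left_cancel₀ h2.ne' hxy
      have := Real.sinh_injective this
      linarith) (fun z => h (z ^ 2))
  rw [himg, Measure.restrict_univ] at hcv
  have hz : ∀ t : ℝ, (Real.sqrt 2 * Real.sinh (t / 2)) ^ 2 = Real.cosh t - 1 := by
    intro t
    have e : Real.cosh t = Real.cosh (2 * (t / 2)) := by ring_nf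
    rw [mul_pow, Real.sq_sqrt (by norm_num), e, Real.cosh_two_mul, Real.cosh_sq]
    ring
  simp only [hz] at hcv
  have h3 : ∫⁻ t : ℝ, ENNReal.ofReal (Real.sqrt 2 * Real.cosh (t / 2)) * h (Real.cosh t - 1) =
      2 * ∫⁻ z : ℝ, h (z ^ 2) := by
    rw [hcv, ← lintegral_const_mul' _ _ (by simp)]
    refine lintegral_congr fun t => ?_
    have hc := Real.cosh_pos (t / 2)
    rw [← mul_assoc, show (2 : ℝ≥0∞) = ENNReal.ofReal 2 by simp,
      ← ENNReal.ofReal_mul (by positivity), abs_of_pos (by positivity)]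
    congr 2
    ring
  rw [h3, ENNReal.ofReal_mul (by norm_num), mul_assoc, ← lintegral_lintegral_radial hg]
  simp [hh]

end PlaneIntegrals
end SL2
end

noncomputable section

namespace SL2

/-! ### Radial geometry of `SL₂(ℝ)` and the integrals behind elliptic orbits. -/

section Elliptic

open Set

/-- An element of `SO₂(ℝ)`. -/
def rot (c s : ℝ) (h : c ^ 2 + s ^ 2 = 1) : G ℝ :=
  ⟨!![c, -s; s, c], by rw [Matrix.det_fin_two_of]; linarith⟩

theorem rot_apply (c s : ℝ) (h : c ^ 2 + s ^ 2 = 1) : rot c s h 0 0 = c ∧ rot c s h 0 1 = -s ∧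
    rot c s h 1 0 = s ∧ rot c s h 1 1 = c := by
  simp [rot]

theorem rot_mem_K (c s : ℝ) (h : c ^ 2 + s ^ 2 = 1) : rot c s h ∈ K ℝ := by
  obtain ⟨h1, h2, h3, h4⟩ := rot_apply c s h
  rw [mem_K_iff_entries, h1, h2, h3, h4]
  simp

theorem weyl_conj_a (t : ℝ) : weyl ℝ * a ℝ t * (weyl ℝ)⁻¹ = a ℝ (-t) := by
  obtain ⟨h1, h2, h3, h4⟩ := weyl_apply (𝕂 := ℝ)
  obtain ⟨i1, i2, i3, i4⟩ := inv_apply (weyl ℝ)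
  obtain ⟨k1, k2, k3, k4⟩ := a_apply (𝕂 := ℝ) t
  obtain ⟨l1, l2, l3, l4⟩ := a_apply (𝕂 := ℝ) (-t)
  apply G_ext <;> simp only [mul_apply', h1, h2, h3, h4, i1, i2, i3, i4, k1, k2, k3, k4, l1, l2,
    l3, l4] <;> simp

/-- The Cartan decomposition of `SL₂(ℝ)`. -/
theorem exists_cartan (g : G ℝ) : ∃ k₁ ∈ K ℝ, ∃ k₂ ∈ K ℝ, ∃ r : ℝ, 0 ≤ r ∧
    g = k₁ * a ℝ r * k₂ := by
  -- `F θ` is the scalar product of the rows of the rotated matrix, that is, its unipotent Iwasawa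
  -- coordinate. It changes sign when `θ` moves by `π/2`, so it vanishes for some rotation, which
  -- leaves only `A` and `K`.
  set F : ℝ → ℝ := fun θ => (Real.cos θ * g 0 0 - Real.sin θ * g 1 0) *
      (Real.sin θ * g 0 0 + Real.cos θ * g 1 0) + (Real.cos θ * g 0 1 - Real.sin θ * g 1 1) *
      (Real.sin θ * g 0 1 + Real.cos θ * g 1 1) with hF
  have hFc : Continuous F := by simp only [hF]; fun_prop
  have h0 : F 0 = g 0 0 * g 1 0 + g 0 1 * g 1 1 := by simp [hF]
  have h1 : F (Real.pi / 2) = -F 0 := by simp [hF]; ring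
  have hpi : (0 : ℝ) ≤ Real.pi / 2 := by positivity
  obtain ⟨θ, hθ⟩ : ∃ θ, F θ = 0 := by
    rcases le_total (F 0) 0 with h | h
    · obtain ⟨θ, -, e⟩ := intermediate_value_Icc hpi hFc.continuousOn
        (show (0 : ℝ) ∈ Icc (F 0) (F (Real.pi / 2)) from ⟨h, by rw [h1]; linarith⟩)
      exact ⟨θ, e⟩
    · obtain ⟨θ, -, e⟩ := intermediate_value_Icc' hpi hFc.continuousOn
        (show (0 : ℝ) ∈ Icc (F (Real.pi / 2)) (F 0) from ⟨by rw [h1]; linarith, h⟩)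
      exact ⟨θ, e⟩
  have hcs := Real.cos_sq_add_sin_sq θ
  set k := rot (Real.cos θ) (Real.sin θ) hcs with hk
  have hkK : k ∈ K ℝ := rot_mem_K _ _ _
  obtain ⟨r1, r2, r3, r4⟩ := rot_apply _ _ hcs
  obtain ⟨l, hl, e⟩ := exists_iwasawa (k * g)
  have hx : (k * g) 0 0 * conj ((k * g) 1 0) + (k * g) 0 1 * conj ((k * g) 1 1) = 0 := by
    simp only [mul_apply', hk, r1, r2, r3, r4, conj_trivial]
    rw [← hθ]
    simp only [hF]
    ring
  rw [hx, n_zero, mul_one] at e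
  set t := Real.log (iwasawaY (k * g))
  have e' : g = k⁻¹ * a ℝ t * l := by rw [mul_assoc, ← e, inv_mul_cancel_left]
  rcases le_total 0 t with ht | ht
  · exact ⟨k⁻¹, inv_mem hkK, l, hl, t, ht, e'⟩
  · refine ⟨k⁻¹ * weyl ℝ, mul_mem (inv_mem hkK) weyl_mem_K, (weyl ℝ)⁻¹ * l,
      mul_mem (inv_mem weyl_mem_K) hl, -t, by linarith, ?_⟩
    have hw := weyl_conj_a (-t)
    rw [neg_neg] at hw
    rw [e', ← hw]
    group

theorem cH_a {r : ℝ} : cH (a ℝ r) = Real.cosh r := by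
  have := cH_an r (0 : ℝ)
  rw [n_zero, mul_one] at this
  simpa using this

/-- A bi-`K`-invariant function on `SL₂(ℝ)` as a function of `cH`. -/
def profile (f : G ℝ → ℝ) (v : ℝ) : ℝ := f (a ℝ (Real.arcosh (max 1 v)))

variable {f : G ℝ → ℝ}

theorem profile_cH (hK : ∀ k₁ ∈ K ℝ, ∀ k₂ ∈ K ℝ, ∀ g, f (k₁ * g * k₂) = f g) (g : G ℝ) :
    profile f (cH g) = f g := by
  obtain ⟨k₁, h₁, k₂, h₂, r, hr, e⟩ := exists_cartan g
  have hc : cH g = Real.cosh r := by rw [e, cH_mul_K _ h₂, cH_K_mul _ h₁, cH_a]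
  rw [profile, hc, max_eq_right (Real.one_le_cosh r), Real.arcosh_cosh hr, e, hK _ h₁ _ h₂]

theorem continuous_profile (hf : Continuous f) : Continuous (profile f) := by
  have h : Continuous fun v : ℝ => Real.arcosh (max 1 v) :=
    Real.continuousOn_arcosh.comp_continuous (by fun_prop) fun v => le_max_left 1 v
  exact hf.comp (continuous_a.comp h)

theorem profile_eq_zero {R : ℝ} (hR : 1 ≤ R) (h : ∀ g, R < cH g → f g = 0) {v : ℝ} (hv : R < v) :
    profile f v = 0 := by
  apply h
  rw [cH_a, max_eq_right (by linarith), Real.cosh_arcosh (by linarith)]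
  exact hv

/-- This is the hyperbolic law of cosines: a point at distance `r` from the centre of a rotation by
`2θ` is moved by a distance `d` with `cosh d = 1 + 2 sin²θ sinh² r`. Iwasawa coordinates reduce it
to a computation for `a(t)n(x)`. -/
theorem cH_conj_rot (c s : ℝ) (h : c ^ 2 + s ^ 2 = 1) (g : G ℝ) :
    cH (g⁻¹ * rot c s h * g) = 1 + 2 * s ^ 2 * (cH g ^ 2 - 1) := by
  have key : ∀ (t x : ℝ), cH ((a ℝ t * n x)⁻¹ * rot c s h * (a ℝ t * n x)) =
      1 + 2 * s ^ 2 * (cH (a ℝ t * n x) ^ 2 - 1) := by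
    intro t x
    obtain ⟨r1, r2, r3, r4⟩ := rot_apply c s h
    obtain ⟨l1, l2, l3, l4⟩ := an_apply t x
    obtain ⟨i1, i2, i3, i4⟩ := inv_apply (a ℝ t * n x)
    have hE := exp_half_mul t
    simp only [RCLike.ofReal_real_eq_id, id_eq] at l1 l2 l3 l4
    generalize Real.exp (t / 2) = E at *
    generalize Real.exp (-t / 2) = E' at *
    have e1 : ((a ℝ t * n x)⁻¹ * rot c s h * (a ℝ t * n x)) 0 0 = c - E ^ 2 * x * s := by
      simp only [mul_apply' (_ * _), mul_apply' (_⁻¹), r1, r2, r3, r4, i1, i2, l1, l2, l3, l4]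
      linear_combination c * hE
    have e2 : ((a ℝ t * n x)⁻¹ * rot c s h * (a ℝ t * n x)) 0 1 =
        -s * (E' ^ 2 + E ^ 2 * x ^ 2) := by
      simp only [mul_apply' (_ * _), mul_apply' (_⁻¹), r1, r2, r3, r4, i1, i2, l2, l4]
      ring
    have e3 : ((a ℝ t * n x)⁻¹ * rot c s h * (a ℝ t * n x)) 1 0 = E ^ 2 * s := by
      simp only [mul_apply' (_ * _), mul_apply' (_⁻¹), r1, r2, r3, r4, i3, i4, l1, l3]
      ring
    have e4 : ((a ℝ t * n x)⁻¹ * rot c s h * (a ℝ t * n x)) 1 1 = c + E ^ 2 * x * s := by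
      simp only [mul_apply' (_ * _), mul_apply' (_⁻¹), r1, r2, r3, r4, i3, i4, l1, l2, l3, l4]
      linear_combination c * hE
    rw [cH, e1, e2, e3, e4, cH, l1, l2, l3, l4]
    simp only [Real.norm_eq_abs, sq_abs]
    have hE2 : E ^ 2 * E' ^ 2 = 1 := by rw [← mul_pow, hE, one_pow]
    linear_combination h - s ^ 2 * hE2
  obtain ⟨k, hk, e⟩ := exists_iwasawa g
  rw [e, cH_mul_K _ hk, mul_inv_rev]
  have e2 : ∀ b : G ℝ, k⁻¹ * b⁻¹ * rot c s h * (b * k) = k⁻¹ * (b⁻¹ * rot c s h * b) * k := by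
    intro b; group
  rw [e2, cH_mul_K _ hk, cH_K_mul _ (inv_mem hk), key]

theorem integral_comp_div_sqrt_two (g : ℝ → ℝ) :
    ∫ y : ℝ, g (y ^ 2) = (Real.sqrt 2)⁻¹ * ∫ x : ℝ, g (x ^ 2 / 2) := by
  have h := Measure.integral_comp_mul_left (fun y : ℝ => g (y ^ 2)) (Real.sqrt 2)⁻¹
  have e : ∀ x : ℝ, ((Real.sqrt 2)⁻¹ * x) ^ 2 = x ^ 2 / 2 := by
    intro x
    rw [mul_pow, inv_pow, Real.sq_sqrt (by norm_num)]
    ring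
  simp only [e] at h
  rw [h, inv_inv, abs_of_pos (by positivity), smul_eq_mul, inv_mul_cancel_left₀ (by positivity)]

theorem integral_profile
    (hK : ∀ k₁ ∈ K ℝ, ∀ k₂ ∈ K ℝ, ∀ g, f (k₁ * g * k₂) = f g) (s : ℝ) :
    ∫ y : ℝ, profile f (Real.cosh s + y ^ 2) = (Real.sqrt 2)⁻¹ * abel f s := by
  have e : f = fun g => profile f (cH g) := funext fun g => (profile_cH hK g).symm
  rw [integral_comp_div_sqrt_two fun q => profile f (Real.cosh s + q)]
  conv_rhs => rw [e, abel_radial]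
  simp only [Real.norm_eq_abs, sq_abs]

/-- The integral of a function of `cH` over the upper half plane. -/
theorem integral_comp_cH_an {g : ℝ → ℝ} (hg : Measurable g) :
    ∫ p : ℝ × ℝ, g (cH (a ℝ p.1 * n p.2) - 1) = 2 * Real.pi * ∫ R in Ioi (0 : ℝ), g R := by
  have e : ∀ p : ℝ × ℝ, cH (a ℝ p.1 * n p.2) - 1 =
      Real.cosh p.1 - 1 + Real.exp p.1 * p.2 ^ 2 / 2 := by
    intro p
    rw [cH_an, Real.norm_eq_abs, sq_abs]
    ring
  simp only [e]
  have h := integral_eq_of_lintegral_eq (μ := (volume : Measure (ℝ × ℝ)))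
    (ν := volume.restrict (Ioi (0 : ℝ)))
    (S := fun p => Real.cosh p.1 - 1 + Real.exp p.1 * p.2 ^ 2 / 2) (T := fun R => R)
    (v := fun _ => 1) (w := fun _ => 2 * Real.pi)
    (by fun_prop) (by fun_prop) (by fun_prop)
    (by fun_prop) (fun p => by positivity) (fun R => by positivity) (fun g hg => by
      rw [lintegral_const_mul' _ _ ENNReal.ofReal_ne_top,
        lintegral_const_mul' _ _ ENNReal.ofReal_ne_top, ← lintegral_comp_cosh hg, Measure.volume_eq_prod, lintegral_prod _ (by fun_prop)]
      simp) hg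
  simpa [integral_const_mul] using h

/-- With `S = b((1 + R)² - 1)` one has `b + S = b(1 + R)²`, so `dS = 2√b √(b + S) dR`. The weight is
that of `integral_poisson`. -/
theorem integral_comp_sq_sub_one {b : ℝ} (hb : 0 < b) (g : ℝ → ℝ) :
    ∫ R in Ioi (0 : ℝ), g (b * ((1 + R) ^ 2 - 1)) =
      (2 * Real.pi * Real.sqrt b)⁻¹ * ∫ S in Ioi (0 : ℝ), Real.pi / Real.sqrt (b + S) * g S := by
  have himg : (fun R : ℝ => b * ((1 + R) ^ 2 - 1)) '' Ioi 0 = Ioi 0 := by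
    ext y
    constructor
    · rintro ⟨x, hx, rfl⟩
      have : 0 < x := hx
      exact mul_pos hb (by nlinarith)
    · intro hy
      have hy' : 0 < y := hy
      refine ⟨Real.sqrt (1 + y / b) - 1, ?_, ?_⟩
      · have : 1 < Real.sqrt (1 + y / b) := by
          rw [Real.lt_sqrt (by norm_num)]
          have : 0 < y / b := by positivity
          linarith
        rw [mem_Ioi]; linarith
      · simp only [add_sub_cancel]
        rw [Real.sq_sqrt (by positivity)]
        field_simp
        ring
  have h := integral_image_eq_integral_abs_deriv_smul
    (f := fun R : ℝ => b * ((1 + R) ^ 2 - 1)) (f' := fun R => b * (2 * (1 + R)))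
    (measurableSet_Ioi (a := (0 : ℝ))) (fun x _ => by
      have := ((((hasDerivAt_id x).const_add 1).pow 2).sub_const 1).const_mul b
      simpa using this.hasDerivWithinAt) (fun x hx y hy hxy => by
      have hx' : 0 < x := hx
      have hy' : 0 < y := hy
      have h1 := mul_left_cancel₀ hb.ne' hxy
      have h2 : (1 + x) ^ 2 = (1 + y) ^ 2 := by linarith
      have h3 := (pow_left_inj₀ (by linarith) (by linarith) two_ne_zero).1 h2
      linarith) (fun S => (2 * Real.pi * Real.sqrt b)⁻¹ * (Real.pi / Real.sqrt (b + S) * g S))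
  rw [himg, integral_const_mul] at h
  rw [h]
  refine setIntegral_congr_fun measurableSet_Ioi fun R hR => ?_
  have hR' : 0 < R := hR
  have e : b + b * ((1 + R) ^ 2 - 1) = b * (1 + R) ^ 2 := by ring
  simp only [smul_eq_mul]
  rw [e, Real.sqrt_mul hb.le, Real.sqrt_sq (by linarith), abs_of_pos (by positivity)]
  have hs := Real.sqrt_pos.2 hb
  have hs2 := Real.mul_self_sqrt hb.le
  have hpi := Real.pi_pos
  field_simp
  rw [Real.sq_sqrt hb.le]
  ring

/-- For fixed `x` the integral over `y` is a line integral of size at most `B`, and the kernel `√b /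
(b + x²)` has total mass `π`, independently of `b`. -/
theorem abs_integral_poisson_le {φ : ℝ → ℝ} (hφ : Continuous φ) {R : ℝ}
    (hR : ∀ v, R < v → φ v = 0) {B : ℝ}
    (hB : ∀ v, 1 ≤ v → |∫ y : ℝ, φ (v + y ^ 2)| ≤ B) {b : ℝ} (hb : 0 < b) :
    |∫ p : ℝ × ℝ, Real.sqrt b * (b + p.1 ^ 2)⁻¹ * φ (1 + (p.1 ^ 2 + p.2 ^ 2))| ≤ Real.pi * B := by
  have hc : Continuous fun p : ℝ × ℝ =>
      Real.sqrt b * (b + p.1 ^ 2)⁻¹ * φ (1 + (p.1 ^ 2 + p.2 ^ 2)) := by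
    have : ∀ p : ℝ × ℝ, b + p.1 ^ 2 ≠ 0 := fun p => by positivity
    fun_prop (disch := assumption)
  have hs : HasCompactSupport fun p : ℝ × ℝ =>
      Real.sqrt b * (b + p.1 ^ 2)⁻¹ * φ (1 + (p.1 ^ 2 + p.2 ^ 2)) := by
    refine HasCompactSupport.intro ((isCompact_closedBall (0 : ℝ) (|R| + 1)).prod
      (isCompact_closedBall (0 : ℝ) (|R| + 1))) ?_
    rintro ⟨x, y⟩ hp
    simp only
    rw [hR, mul_zero]
    by_contra hle
    have hR' := le_abs_self R
    have h0 := abs_nonneg R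
    refine hp ⟨?_, ?_⟩ <;> rw [mem_closedBall_zero_iff, Real.norm_eq_abs] <;>
      refine abs_le_of_sq_le_sq ?_ (by linarith) <;> nlinarith [sq_nonneg x, sq_nonneg y]
  rw [Measure.volume_eq_prod, integral_prod _ (hc.integrable_of_hasCompactSupport hs)]
  obtain ⟨hi, hv⟩ := integrable_inv_add_mul_sq hb one_pos
  simp only [one_mul, mul_one] at hi hv
  have h1 : ∀ x : ℝ, ‖∫ y : ℝ, Real.sqrt b * (b + x ^ 2)⁻¹ * φ (1 + (x ^ 2 + y ^ 2))‖ ≤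
      Real.sqrt b * B * (b + x ^ 2)⁻¹ := by
    intro x
    have hx : 0 ≤ Real.sqrt b * (b + x ^ 2)⁻¹ := by positivity
    rw [integral_const_mul, Real.norm_eq_abs, abs_mul, abs_of_nonneg hx]
    simp only [← add_assoc]
    have := mul_le_mul_of_nonneg_left (hB (1 + x ^ 2) (by nlinarith [sq_nonneg x])) hx
    linarith
  have h2 := norm_integral_le_of_norm_le (hi.const_mul (Real.sqrt b * B))
    (Filter.Eventually.of_forall h1)
  rw [integral_const_mul, hv] at h2
  refine h2.trans (le_of_eq ?_)
  have := Real.sqrt_pos.2 hb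
  field_simp

end Elliptic
end SL2
end

noncomputable section

namespace SL2

/-! ### Orbital integrals of elliptic elements. -/

section EllipticOrbit

/-- An element of `SL₂(ℝ)` with negative discriminant is conjugate to a rotation. -/
theorem exists_conj_eq_rot {γ : G ℝ} (hγ : weylDisc γ < 0) : ∃ (x : G ℝ) (c s : ℝ)
    (h : c ^ 2 + s ^ 2 = 1), s ≠ 0 ∧ x * γ * x⁻¹ = rot c s h := by
  rw [weylDisc_eq] at hγ
  have hd := det_eq γ
  have hr : γ 1 0 ≠ 0 := by
    intro h
    rw [h] at hd
    nlinarith [sq_nonneg (γ 0 0 - γ 1 1)]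
  set c := (γ 0 0 + γ 1 1) / 2 with hc
  have hc2 : 0 < 1 - c ^ 2 := by rw [hc]; linarith
  -- `X + iY` is the fixed point of `γ` in the upper half plane, and `n(X) a(log Y)` moves `i`
  -- there. The sine `γ₁₀ Y` may have either sign.
  set Y := Real.sqrt (1 - c ^ 2) / |γ 1 0| with hY
  have hY0 : 0 < Y := div_pos (Real.sqrt_pos.2 hc2) (abs_pos.2 hr)
  have hY2 : (γ 1 0 * Y) ^ 2 = 1 - c ^ 2 := by
    rw [hY, mul_pow, div_pow, sq_abs, Real.sq_sqrt hc2.le]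
    field_simp
  set X := (γ 0 0 - γ 1 1) / (2 * γ 1 0) with hX
  have hrX : γ 1 0 * X = (γ 0 0 - γ 1 1) / 2 := by rw [hX]; field_simp
  have hrot : c ^ 2 + (γ 1 0 * Y) ^ 2 = 1 := by rw [hY2]; ring
  refine ⟨(n X * a ℝ (Real.log Y))⁻¹, c, γ 1 0 * Y, hrot, mul_ne_zero hr hY0.ne', ?_⟩
  rw [inv_inv, mul_assoc, inv_mul_eq_iff_eq_mul]
  set e := Real.exp (Real.log Y / 2) with he
  set e' := Real.exp (-Real.log Y / 2) with he'
  have hee : e * e' = 1 := by rw [he, he', ← Real.exp_add]; simp [neg_div]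
  have he2 : e ^ 2 = Y := by
    rw [he, ← Real.exp_nat_mul]
    conv_rhs => rw [← Real.exp_log hY0]
    congr 1
    push_cast
    ring
  obtain ⟨k1, k2, k3, k4⟩ := a_apply (𝕂 := ℝ) (Real.log Y)
  obtain ⟨l1, l2, l3, l4⟩ := n_apply X
  obtain ⟨r1, r2, r3, r4⟩ := rot_apply _ _ hrot
  simp only [RCLike.ofReal_real_eq_id, id_eq, ← he, ← he'] at k1 k2 k3 k4
  have heY : e' * Y = e := by rw [← he2]; linear_combination e * hee
  clear_value e e' X Y c
  have h00 : γ 0 0 = c + γ 1 0 * X := by rw [hrX, hc]; ring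
  have h11 : γ 1 1 = c - γ 1 0 * X := by rw [hrX, hc]; ring
  have h01 : γ 0 1 = -(γ 1 0 * Y ^ 2) - γ 1 0 * X ^ 2 := by
    apply mul_left_cancel₀ hr
    rw [h00, h11] at hd
    linear_combination -hd + hY2
  apply G_ext <;> simp only [mul_apply', k1, k2, k3, k4, l1, l2, l3, l4, r1, r2, r3, r4]
  · rw [h00]; linear_combination -X * γ 1 0 * heY
  · rw [h00, h01]; linear_combination -γ 1 0 * Y * heY
  · linear_combination -γ 1 0 * heY
  · rw [h11]; ring

theorem K_real_mul_comm {k l : G ℝ} (hk : k ∈ K ℝ) (hl : l ∈ K ℝ) : k * l = l * k := by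
  rw [mem_K_iff_entries] at hk hl
  obtain ⟨h1, h2⟩ := hk
  obtain ⟨h3, h4⟩ := hl
  simp only [conj_trivial] at h1 h2 h3 h4
  apply G_ext <;> simp only [mul_apply', h1, h2, h3, h4] <;> ring

theorem mem_centr_rot_iff {c s : ℝ} (h : c ^ 2 + s ^ 2 = 1) (hs : s ≠ 0) (g : G ℝ) :
    g ∈ centr (rot c s h) ↔ g ∈ K ℝ := by
  rw [centr, Subgroup.mem_centralizer_singleton_iff]
  refine ⟨fun e => ?_, fun hg => K_real_mul_comm hg (rot_mem_K _ _ _)⟩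
  obtain ⟨r1, r2, r3, r4⟩ := rot_apply c s h
  have e1 := congrArg (fun x : G ℝ => x 0 0) e
  have e2 := congrArg (fun x : G ℝ => x 0 1) e
  simp only [mul_apply', r1, r2, r3, r4] at e1 e2
  rw [mem_K_iff_entries]
  simp only [conj_trivial]
  constructor <;> apply mul_left_cancel₀ hs <;> linarith

/-- The Haar probability measure of `x⁻¹ K x`. -/
def conjHaarK (x : G ℝ) : Measure (G ℝ) := Measure.map (fun k => x⁻¹ * k * x) (haarK ℝ)

theorem lintegral_conjHaarK (x : G ℝ) {f : G ℝ → ℝ≥0∞} (hf : Measurable f) :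
    ∫⁻ h, f h ∂conjHaarK x = ∫⁻ k : K ℝ, f (x⁻¹ * k * x) ∂haarProb (K ℝ) := by
  rw [conjHaarK, lintegral_map hf (measurable_conj x), haarK]
  exact lintegral_map (hf.comp (measurable_conj x)) measurable_subtype_coe

instance instIsProbabilityMeasureConjHaarK (x : G ℝ) : IsProbabilityMeasure (conjHaarK x) :=
  ⟨by rw [← lintegral_one, lintegral_conjHaarK x measurable_const]; simp⟩

theorem lintegral_conjHaarK_mul_right (x : G ℝ) {h₀ : G ℝ} (hh : x * h₀ * x⁻¹ ∈ K ℝ)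
    {f : G ℝ → ℝ≥0∞} (hf : Measurable f) :
    ∫⁻ h, f (h * h₀) ∂conjHaarK x = ∫⁻ h, f h ∂conjHaarK x := by
  rw [lintegral_conjHaarK x hf]
  refine (lintegral_conjHaarK x (hf.comp (measurable_mul_const h₀))).trans ?_
  have e : ∀ k : K ℝ, x⁻¹ * k * x * h₀ = x⁻¹ * ((⟨x * h₀ * x⁻¹, hh⟩ * k : K ℝ) : G ℝ) * x := by
    intro k
    rw [Subgroup.coe_mul, K_real_mul_comm hh k.2]
    group
  simp only [Function.comp, e]
  exact lintegral_mul_left_eq_self (fun k : K ℝ => f (x⁻¹ * (k : G ℝ) * x)) _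

/-- The centralizer is compact of total mass `1`, so `G` itself, with its Haar measure, can serve as
the parameter space of the cosets. -/
theorem lintegral_haarG_eq_conjHaarK (x : G ℝ) {f : G ℝ → ℝ≥0∞} (hf : Measurable f) :
    ∫⁻ g, f g ∂haarG ℝ = ∫⁻ g, ∫⁻ h, f (h * g) ∂conjHaarK x ∂haarG ℝ := by
  have hm : Measurable fun p : G ℝ × G ℝ => f (p.2 * p.1) :=
    hf.comp (measurable_snd.mul measurable_fst)
  rw [lintegral_lintegral_swap hm.aemeasurable]
  simp only [lintegral_mul_left_eq_self]
  simp

variable {f : G ℝ → ℝ}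

/-- In the radial coordinate the orbit of a rotation is `1 + b(v² - 1)` with `b = 2s²`. The change
of variables produces the weight `1/√(b + S)`, hence a Poisson average of line integrals of `profile
f`, and these are values of `abel f` divided by `√2`. The remaining factor `1/√b` is compensated by
`2|s| = |Δ|^{1/2}`, so the bound is uniform as `s` tends to `0`. -/
theorem abs_integral_conj_rot_le (hf : Continuous f) (hs : HasCompactSupport f)
    (hK : ∀ k₁ ∈ K ℝ, ∀ k₂ ∈ K ℝ, ∀ g, f (k₁ * g * k₂) = f g) {B : ℝ}
    (hB : ∀ s, |abel f s| ≤ B) {c s : ℝ} (h : c ^ 2 + s ^ 2 = 1) (h0 : s ≠ 0) :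
    Integrable (fun g => f (g⁻¹ * rot c s h * g)) (haarG ℝ) ∧
      2 * |s| * |∫ g, f (g⁻¹ * rot c s h * g) ∂haarG ℝ| ≤ Real.pi * B := by
  obtain ⟨R, hR⟩ := IsCompact.bddAbove_image hs continuous_cH.continuousOn
  have hR' : ∀ g, max 1 R < cH g → f g = 0 := by
    intro g hg
    by_contra hne
    exact absurd (hR ⟨g, subset_closure hne, rfl⟩) (not_le.2 (lt_of_le_of_lt (le_max_right _ _) hg))
  have hp : ∀ v, max 1 R < v → profile f v = 0 := fun v hv =>
    profile_eq_zero (le_max_left _ _) hR' hv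
  have hpc := continuous_profile hf
  set b := 2 * s ^ 2 with hb
  have hb0 : 0 < b := by positivity
  have hval : ∀ g, f (g⁻¹ * rot c s h * g) = profile f (1 + b * (cH g ^ 2 - 1)) := fun g => by
    rw [← profile_cH hK, cH_conj_rot]
  have hcont : Continuous fun g => f (g⁻¹ * rot c s h * g) := hf.comp (by fun_prop)
  have hsupp : HasCompactSupport fun g => f (g⁻¹ * rot c s h * g) := by
    refine hasCompactSupport_of_cH (R := 1 + max 1 R / b) fun g hg => ?_
    rw [hval]
    apply hp
    have h1 : 0 < max 1 R := lt_of_lt_of_le one_pos (le_max_left _ _)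
    have h2 : 0 < max 1 R / b := by positivity
    have h3 : max 1 R = b * (max 1 R / b) := by field_simp
    have h4 : max 1 R / b < cH g ^ 2 - 1 := by nlinarith
    have := mul_lt_mul_of_pos_left h4 hb0
    linarith
  refine ⟨hcont.integrable_of_hasCompactSupport hsupp, ?_⟩
  rw [integral_haarG hcont (fun g k hk => by rw [hval, hval, cH_mul_K _ hk]) hsupp]
  have e1 : ∀ p : ℝ × ℝ, f ((a ℝ p.1 * n p.2)⁻¹ * rot c s h * (a ℝ p.1 * n p.2)) =
      profile f (1 + b * ((1 + (cH (a ℝ p.1 * n p.2) - 1)) ^ 2 - 1)) := by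
    intro p; rw [hval, add_sub_cancel]
  simp only [e1]
  rw [integral_comp_cH_an (g := fun R => profile f (1 + b * ((1 + R) ^ 2 - 1)))
    (hpc.comp (by fun_prop)).measurable,
    integral_comp_sq_sub_one hb0 fun S => profile f (1 + S),
    ← integral_poisson hb0 (f := fun S => profile f (1 + S)) (hpc.comp (by fun_prop)).measurable]
  have hbd := abs_integral_poisson_le hpc hp (B := (Real.sqrt 2)⁻¹ * B) (fun v hv => by
    have e := integral_profile hK (Real.arcosh v)
    rw [Real.cosh_arcosh hv] at e
    rw [e, abs_mul, abs_of_nonneg (by positivity)]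
    exact mul_le_mul_of_nonneg_left (hB _) (by positivity)) hb0
  set J := ∫ p : ℝ × ℝ, Real.sqrt b * (b + p.1 ^ 2)⁻¹ * profile f (1 + (p.1 ^ 2 + p.2 ^ 2))
  have hsb : Real.sqrt b = Real.sqrt 2 * |s| := by
    rw [hb, Real.sqrt_mul (by norm_num), Real.sqrt_sq_eq_abs]
  have hs0 := abs_pos.2 h0
  have h2 : (0 : ℝ) < Real.sqrt 2 := by positivity
  have h22 : Real.sqrt 2 * Real.sqrt 2 = 2 := Real.mul_self_sqrt (by norm_num)
  have hpi := Real.pi_pos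
  have e2 : 2 * |s| * |2 * Real.pi * ((2 * Real.pi * Real.sqrt b)⁻¹ * J)| = Real.sqrt 2 * |J| := by
    rw [abs_mul (2 * Real.pi), abs_mul (2 * Real.pi * Real.sqrt b)⁻¹, abs_of_pos (by positivity : (0 : ℝ) < 2 * Real.pi),
      abs_of_pos (by positivity : 0 < (2 * Real.pi * Real.sqrt b)⁻¹), hsb]
    field_simp
    linear_combination -|J| * h22
  rw [e2]
  calc Real.sqrt 2 * |J| ≤ Real.sqrt 2 * (Real.pi * ((Real.sqrt 2)⁻¹ * B)) :=
        mul_le_mul_of_nonneg_left hbd h2.le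
    _ = Real.pi * B := by field_simp

theorem exists_hasOrbitalIntegral_of_elliptic (hf : Continuous f) (hs : HasCompactSupport f)
    (hK : ∀ k₁ ∈ K ℝ, ∀ k₂ ∈ K ℝ, ∀ g, f (k₁ * g * k₂) = f g) {B : ℝ}
    (hB : ∀ s, |abel f s| ≤ B) {γ : G ℝ} (hγ : weylDisc γ < 0) :
    ∃ O : ℂ, HasOrbitalIntegral γ (fun g => ((f g : ℝ) : ℂ)) O ∧
      absK (weylDisc γ) ^ (1 / 2 : ℝ) * ‖O‖ ≤ Real.pi * B := by
  obtain ⟨x, c, s, h, h0, e⟩ := exists_conj_eq_rot hγ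
  obtain ⟨hi, hle⟩ := abs_integral_conj_rot_le hf hs hK hB h h0
  have e1 : ∀ g, g⁻¹ * γ * g = (x * g)⁻¹ * rot c s h * (x * g) := by
    intro g; rw [← e]; group
  have hcentr : ∀ g, g ∈ centr γ ↔ x * g * x⁻¹ ∈ K ℝ := fun g => by
    rw [mem_centr_conj_iff x, e, mem_centr_rot_iff h h0]
  have hμ : IsCentralizerMeasure γ (conjHaarK x) := Or.inr ⟨x, hcentr, rfl⟩
  have hi' : Integrable (fun g => f (g⁻¹ * γ * g)) (haarG ℝ) := by
    simp only [e1]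
    exact hi.comp_mul_left x
  have horb := hasOrbitalIntegral_of_param hμ
    (fun h₀ hh₀ f hf => lintegral_conjHaarK_mul_right x ((hcentr h₀).1 hh₀) hf)
    (haarG ℝ) measurable_id (fun f hf => lintegral_haarG_eq_conjHaarK x hf)
    (f := fun g => ((f g : ℝ) : ℂ)) (Complex.continuous_ofReal.comp hf) hi'.ofReal
  refine ⟨_, horb, ?_⟩
  simp only [id_eq]
  rw [integral_complex_ofReal, Complex.norm_real, Real.norm_eq_abs]
  simp only [e1]
  rw [integral_mul_left_eq_self (fun g => f (g⁻¹ * rot c s h * g)) x]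
  refine le_trans (le_of_eq ?_) hle
  congr 1
  obtain ⟨r1, r2, r3, r4⟩ := rot_apply c s h
  have e2 : weylDisc γ = -(2 * s) ^ 2 := by
    rw [← weylDisc_conj x γ, e, weylDisc_eq, r1, r4]
    linear_combination 4 * h
  have e3 : rho ℝ = 1 := Module.finrank_self ℝ
  rw [absK, e3, pow_one, e2, norm_neg, norm_pow, ← Real.sqrt_eq_rpow,
    Real.sqrt_sq (norm_nonneg _), Real.norm_eq_abs, abs_mul, abs_two]

end EllipticOrbit
end SL2
end

noncomputable section

namespace SL2

open Filter Topology Set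

/-! ### Smooth even functions of `s` as smooth functions of `cosh s`. -/

section CoshCoordinate

/-- The entire function `∑ xⁿ / (2n)!`. -/
def coshSqrt : ℝ → ℝ := FormalMultilinearSeries.ofScalarsSum fun n : ℕ => ((2 * n).factorial : ℝ)⁻¹

theorem hasFPowerSeriesOnBall_coshSqrt : HasFPowerSeriesOnBall coshSqrt
    (FormalMultilinearSeries.ofScalars ℝ fun n : ℕ => ((2 * n).factorial : ℝ)⁻¹) 0 ⊤ := by
  have hr : (FormalMultilinearSeries.ofScalars ℝ
      fun n : ℕ => ((2 * n).factorial : ℝ)⁻¹).radius = ⊤ := by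
    refine FormalMultilinearSeries.ofScalars_radius_eq_top_of_tendsto ℝ _
      (Eventually.of_forall fun n => by positivity) ?_
    refine squeeze_zero (fun n => by positivity) (fun n => ?_)
      tendsto_one_div_add_atTop_nhds_zero_nat
    have h1 : ((2 * n.succ).factorial : ℝ) = (2 * n + 2) * (2 * n + 1) * (2 * n).factorial := by
      rw [Nat.mul_succ, Nat.factorial_succ, Nat.factorial_succ]
      push_cast
      ring
    rw [h1, norm_inv, norm_inv, Real.norm_of_nonneg (by positivity),
      Real.norm_of_nonneg (by positivity)]
    have h2 : (0 : ℝ) < (2 * n).factorial := by positivity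
    rw [div_le_div_iff₀ (by positivity) (by positivity)]
    field_simp
    nlinarith [(Nat.cast_nonneg n : (0 : ℝ) ≤ n)]
  have h := FormalMultilinearSeries.hasFPowerSeriesOnBall (FormalMultilinearSeries.ofScalars ℝ
      fun n : ℕ => ((2 * n).factorial : ℝ)⁻¹) (by rw [hr]; exact ENNReal.zero_lt_top)
  rwa [hr] at h

theorem analyticAt_coshSqrt (x : ℝ) : AnalyticAt ℝ coshSqrt x :=
  hasFPowerSeriesOnBall_coshSqrt.analyticAt_of_mem (by simp)

theorem contDiff_coshSqrt : ContDiff ℝ ∞ coshSqrt :=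
  contDiff_iff_contDiffAt.2 fun x => (analyticAt_coshSqrt x).contDiffAt

theorem coshSqrt_eq (x : ℝ) : coshSqrt x = ∑' n : ℕ, x ^ n / ((2 * n).factorial : ℝ) := by
  rw [coshSqrt, FormalMultilinearSeries.ofScalarsSum_eq_tsum]
  simp only [smul_eq_mul, div_eq_inv_mul]

theorem coshSqrt_sq (s : ℝ) : coshSqrt (s ^ 2) = Real.cosh s := by
  simp only [coshSqrt_eq, Real.cosh_eq_tsum, pow_mul]

theorem coshSqrt_neg_sq (s : ℝ) : coshSqrt (-s ^ 2) = Real.cos s := by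
  rw [coshSqrt_eq, Real.cos_eq_tsum]
  refine tsum_congr fun n => ?_
  rw [neg_pow, pow_mul]

theorem deriv_coshSqrt_zero : deriv coshSqrt 0 = 1 / 2 := by
  rw [hasFPowerSeriesOnBall_coshSqrt.hasFPowerSeriesAt.deriv]
  simp [FormalMultilinearSeries.ofScalars]

/-- `arcosh ^ 2` extends to a smooth function on a neighbourhood of `[1, ∞)`. -/
theorem exists_arcosh_sq_extension : ∃ ε > (0 : ℝ), ∃ q : ℝ → ℝ,
    ContDiffOn ℝ ∞ q (Ioi (1 - ε)) ∧ ∀ s, q (Real.cosh s) = s ^ 2 := by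
  have h0 : deriv coshSqrt 0 ≠ 0 := by rw [deriv_coshSqrt_zero]; norm_num
  have hE0 : coshSqrt 0 = 1 := by simpa using coshSqrt_sq 0
  -- `arcosh` is not smooth at `1`, but its square inverts `coshSqrt`, whose derivative at `0` is
  -- nonzero. The local inverse continues it analytically below `1`.
  set q₀ := (analyticAt_coshSqrt 0).hasStrictDerivAt.localInverse _ _ _ h0
  have hq : AnalyticAt ℝ q₀ 1 := hE0 ▸ (analyticAt_coshSqrt 0).analyticAt_localInverse h0
  have hl : ∀ᶠ x in 𝓝 (0 : ℝ), q₀ (coshSqrt x) = x :=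
    HasStrictDerivAt.eventually_left_inverse ..
  have hc : Tendsto (fun v => Real.arcosh v ^ 2) (𝓝[≥] 1) (𝓝 0) := by
    have h : Tendsto (fun v => Real.arcosh v ^ 2) (𝓝[≥] 1) (𝓝 (Real.arcosh 1 ^ 2)) :=
      ((Real.continuousOn_arcosh 1 self_mem_Ici).pow 2).tendsto
    rwa [Real.arcosh_zero, zero_pow two_ne_zero] at h
  have h1 : ∀ᶠ v in 𝓝 (1 : ℝ), 1 ≤ v → q₀ v = Real.arcosh v ^ 2 := by
    refine (eventually_nhdsWithin_iff (s := Ici (1 : ℝ))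
      (p := fun v => q₀ v = Real.arcosh v ^ 2)).1 ?_
    filter_upwards [hc.eventually hl, self_mem_nhdsWithin] with v hv hv1
    rwa [coshSqrt_sq, Real.cosh_arcosh hv1] at hv
  obtain ⟨ε, hε, hball⟩ := Metric.eventually_nhds_iff.1 (h1.and hq.eventually_analyticAt)
  refine ⟨ε, hε, fun v => if 1 ≤ v then Real.arcosh v ^ 2 else q₀ v, ?_, fun s => ?_⟩
  · intro v hv
    rcases lt_or_ge 1 v with h | h
    · refine (((Real.contDiffAt_arcosh h).pow 2).congr_of_eventuallyEq ?_).contDiffWithinAt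
      filter_upwards [lt_mem_nhds h] with w hw
      rw [if_pos hw.le]
    · have hv' : 1 - ε < v := hv
      have hd : dist v 1 < ε := by rw [Real.dist_eq, abs_lt]; constructor <;> linarith
      refine ((hball hd).2.contDiffAt.congr_of_eventuallyEq ?_).contDiffWithinAt
      filter_upwards [Metric.isOpen_ball.mem_nhds (show v ∈ Metric.ball (1 : ℝ) ε from hd)]
        with w hw
      split_ifs with h2
      · exact ((hball hw).1 h2).symm
      · rfl
  · simp only [if_pos (Real.one_le_cosh s)]
    rw [← Real.cosh_abs, Real.arcosh_cosh (abs_nonneg s), sq_abs]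

/-- A smooth cutoff. -/
def cutoff (x : ℝ) : ℝ := Real.smoothTransition (1 - 4 * x)

theorem contDiff_cutoff : ContDiff ℝ ∞ cutoff := Real.smoothTransition.contDiff.comp (by fun_prop)

theorem cutoff_nonneg (x : ℝ) : 0 ≤ cutoff x := Real.smoothTransition.nonneg _

theorem cutoff_le_one (x : ℝ) : cutoff x ≤ 1 := Real.smoothTransition.le_one _

theorem cutoff_zero : cutoff 0 = 1 := by simp [cutoff]

theorem cutoff_of_le {x : ℝ} (hx : 1 / 4 ≤ x) : cutoff x = 0 :=
  Real.smoothTransition.zero_of_nonpos (by linarith)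

theorem antitone_cutoff : Antitone cutoff := fun x y h =>
  Real.smoothTransition.monotone (by linarith)

/-- The function `cos (ξ s) * cutoff (s ^ 2)` is a smooth function of `cosh s`. -/
theorem exists_cosh_profile (ξ : ℝ) : ∃ ψ : ℝ → ℝ, ContDiff ℝ ∞ ψ ∧
    (∀ s, ψ (Real.cosh s) = Real.cos (ξ * s) * cutoff (s ^ 2)) ∧
    ∀ v, Real.cosh (1 / 2) ≤ v → ψ v = 0 := by
  obtain ⟨ε, hε, q, hq, hqs⟩ := exists_arcosh_sq_extension
  -- `χ` is `1` for `v ≥ 1 - ε/2` and `0` for `v ≤ 1 - 3ε/4`: it leaves `[1, ∞)` untouched and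
  -- removes the region where `q` is not controlled.
  set χ : ℝ → ℝ := fun v => Real.smoothTransition (4 * (v - 1) / ε + 3) with hχ
  have hχc : ContDiff ℝ ∞ χ := Real.smoothTransition.contDiff.comp (by fun_prop)
  -- The cosine is even, so it is the entire function `coshSqrt` of `-ξ²s²`, and `s²` is smooth in
  -- `v` through `q`.
  set ψ : ℝ → ℝ := fun v => coshSqrt (-(ξ ^ 2 * q v)) * cutoff (q v) * χ v with hψ
  have hval : ∀ s, ψ (Real.cosh s) = Real.cos (ξ * s) * cutoff (s ^ 2) := by
    intro s
    have h1 : χ (Real.cosh s) = 1 := by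
      refine Real.smoothTransition.one_of_one_le ?_
      have : 0 ≤ 4 * (Real.cosh s - 1) / ε :=
        div_nonneg (by linarith [Real.one_le_cosh s]) hε.le
      linarith
    simp only [hψ]
    rw [h1, hqs, mul_one, ← mul_pow, coshSqrt_neg_sq]
  refine ⟨ψ, contDiff_iff_contDiffAt.2 fun v => ?_, hval, fun v hv => ?_⟩
  · rcases lt_or_ge (1 - ε) v with h | h
    · have hqv := hq.contDiffAt (Ioi_mem_nhds h)
      exact ((contDiff_coshSqrt.contDiffAt.comp v (contDiffAt_const.mul hqv).neg).mul
        (contDiff_cutoff.contDiffAt.comp v hqv)).mul hχc.contDiffAt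
    · refine (contDiffAt_const (c := (0 : ℝ))).congr_of_eventuallyEq ?_
      filter_upwards [gt_mem_nhds (show v < 1 - 3 * ε / 4 by linarith)] with w hw
      have h1 : χ w = 0 := by
        refine Real.smoothTransition.zero_of_nonpos ?_
        have : 4 * (w - 1) / ε ≤ -3 := by
          rw [div_le_iff₀ hε]; linarith
        linarith
      simp only [hψ]
      rw [h1, mul_zero]
  · have h1 := (Real.one_le_cosh (1 / 2)).trans hv
    have h2 := hval (Real.arcosh v)
    rw [Real.cosh_arcosh h1] at h2
    have h3 : 1 / 2 ≤ Real.arcosh v := by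
      rw [← Real.arcosh_cosh (show (0 : ℝ) ≤ 1 / 2 by norm_num)]
      exact (Real.arcosh_le_arcosh (Real.cosh_pos _) (by linarith)).2 hv
    rw [h2, cutoff_of_le (by nlinarith), mul_zero]

end CoshCoordinate

end SL2
end

noncomputable section

namespace SL2

open Filter Topology Set

/-! ### Bounds for `ψ`, its derivative, and line integrals of the derivative. -/

section ProfileBounds

variable {ψ : ℝ → ℝ} {V : ℝ}

theorem deriv_eq_zero_of_lt (hV : ∀ v, V ≤ v → ψ v = 0) {v : ℝ} (hv : V < v) : deriv ψ v = 0 := by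
  have : ψ =ᶠ[𝓝 v] fun _ => 0 := by
    filter_upwards [lt_mem_nhds hv] with w hw using hV w hw.le
  rw [this.deriv_eq, deriv_const]

theorem continuous_deriv_of_contDiff (hψ : ContDiff ℝ ∞ ψ) : Continuous (deriv ψ) :=
  hψ.continuous_deriv (by simp)

theorem contDiff_deriv (hψ : ContDiff ℝ ∞ ψ) : ContDiff ℝ ∞ (deriv ψ) :=
  (contDiff_infty_iff_deriv.1 hψ).2

theorem integral_Ioi_deriv_comp (hψ : ContDiff ℝ ∞ ψ) (hV : ∀ v, V ≤ v → ψ v = 0) (v : ℝ)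
    {c : ℝ} (hc : 0 < c) : ∫ R in Ioi (0 : ℝ), deriv ψ (v + c * R) = -(c⁻¹ * ψ v) := by
  have hd : ∀ R : ℝ, HasDerivAt (fun R => c⁻¹ * ψ (v + c * R)) (deriv ψ (v + c * R)) R := by
    intro R
    have h1 : HasDerivAt (fun R : ℝ => v + c * R) c R := by
      simpa using ((hasDerivAt_id R).const_mul c).const_add v
    have h2 := ((hψ.differentiable (by simp) (v + c * R)).hasDerivAt.comp R h1).const_mul c⁻¹
    exact h2.congr_deriv (by field_simp)
  have hz : ∀ R, |V - v| / c ≤ R → V ≤ v + c * R := by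
    intro R hR
    rw [div_le_iff₀ hc] at hR
    linarith [le_abs_self (V - v)]
  have ht : Tendsto (fun R => c⁻¹ * ψ (v + c * R)) atTop (𝓝 0) := by
    refine tendsto_const_nhds.congr' ?_
    filter_upwards [eventually_ge_atTop (|V - v| / c)] with R hR
    rw [hV _ (hz R hR), mul_zero]
  have hi : IntegrableOn (fun R => deriv ψ (v + c * R)) (Ioi 0) := by
    have hcont : Continuous fun R => deriv ψ (v + c * R) :=
      (continuous_deriv_of_contDiff hψ).comp (by fun_prop)
    have h1 : IntegrableOn (fun R => deriv ψ (v + c * R)) (Ioc 0 (|V - v| / c)) :=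
      hcont.integrableOn_Ioc
    refine h1.of_forall_sdiff_eq_zero measurableSet_Ioi fun R hR => ?_
    have hR2 : |V - v| / c < R := by
      by_contra h
      exact hR.2 ⟨hR.1, not_lt.1 h⟩
    rw [div_lt_iff₀ hc] at hR2
    exact deriv_eq_zero_of_lt hV (by linarith [le_abs_self (V - v)])
  have h := integral_Ioi_of_hasDerivAt_of_tendsto' (fun R _ => hd R) hi ht
  rw [h]
  simp

/-- The function `s ↦ cutoff (s ^ 2)`. -/
def bump (s : ℝ) : ℝ := cutoff (s ^ 2)

theorem contDiff_bump : ContDiff ℝ ∞ bump := contDiff_cutoff.comp (by fun_prop)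

theorem bump_of_le {s : ℝ} (hs : 1 / 2 ≤ |s|) : bump s = 0 :=
  cutoff_of_le (by rw [← sq_abs]; nlinarith)

theorem hasCompactSupport_bump : HasCompactSupport bump :=
  HasCompactSupport.intro (isCompact_Icc (a := (-1 : ℝ)) (b := 1)) fun s hs => by
    refine bump_of_le ?_
    by_contra h
    rw [not_le, abs_lt] at h
    exact hs ⟨by linarith, by linarith⟩

theorem exists_deriv_bump_le : ∃ M : ℝ, 1 ≤ M ∧ ∀ s, |deriv bump s| ≤ M := by
  obtain ⟨M, hM⟩ := hasCompactSupport_bump.deriv.exists_bound_of_continuous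
    (continuous_deriv_of_contDiff contDiff_bump)
  exact ⟨max 1 M, le_max_left _ _, fun s => (hM s).trans (le_max_right _ _)⟩

theorem abs_profile_le {ξ : ℝ} (h : ∀ s, ψ (Real.cosh s) = Real.cos (ξ * s) * bump s) {v : ℝ}
    (hv : 1 ≤ v) : |ψ v| ≤ 1 := by
  rw [← Real.cosh_arcosh hv, h, abs_mul, bump, abs_of_nonneg (cutoff_nonneg _)]
  exact mul_le_one₀ (Real.abs_cos_le_one _) (cutoff_nonneg _) (cutoff_le_one _)

/-- Differentiating `ψ(cosh s)` yields `ψ'(v) sinh s`, bounded by `|ξ| + M`, and `sinh s = √(v² - 1)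
≥ √(v - 1)`. -/
theorem abs_deriv_profile_le (hψ : ContDiff ℝ ∞ ψ) {ξ M : ℝ} (hM : ∀ s, |deriv bump s| ≤ M)
    (h : ∀ s, ψ (Real.cosh s) = Real.cos (ξ * s) * bump s) {v : ℝ} (hv : 1 < v) :
    |deriv ψ v| * Real.sqrt (v - 1) ≤ |ξ| + M := by
  set s := Real.arcosh v with hs
  have hc : Real.cosh s = v := Real.cosh_arcosh hv.le
  have h1 : HasDerivAt (fun s => ψ (Real.cosh s)) (deriv ψ v * Real.sinh s) s := by
    have := (hψ.differentiable (by simp) (Real.cosh s)).hasDerivAt.comp s (Real.hasDerivAt_cosh s)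
    rwa [hc] at this
  have h2 : HasDerivAt (fun s => Real.cos (ξ * s) * bump s)
      (-Real.sin (ξ * s) * ξ * bump s + Real.cos (ξ * s) * deriv bump s) s := by
    have h3 : HasDerivAt (fun s : ℝ => ξ * s) ξ s := by
      simpa using (hasDerivAt_id s).const_mul ξ
    exact h3.cos.mul (contDiff_bump.differentiable (by simp) s).hasDerivAt
  have e : deriv ψ v * Real.sinh s =
      -Real.sin (ξ * s) * ξ * bump s + Real.cos (ξ * s) * deriv bump s :=
    h1.unique (by simpa only [h] using h2)
  have hb : |bump s| ≤ 1 := by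
    rw [bump, abs_of_nonneg (cutoff_nonneg _)]; exact cutoff_le_one _
  have h4 : |deriv ψ v * Real.sinh s| ≤ |ξ| + M := by
    rw [e]
    refine (abs_add_le _ _).trans (add_le_add ?_ ?_)
    · rw [abs_mul, abs_mul, abs_neg]
      have := mul_le_mul (mul_le_of_le_one_left (abs_nonneg ξ) (Real.abs_sin_le_one (ξ * s))) hb
        (abs_nonneg _) (abs_nonneg ξ)
      linarith
    · rw [abs_mul]
      exact (mul_le_of_le_one_left (abs_nonneg _) (Real.abs_cos_le_one _)).trans (hM s)
  refine le_trans ?_ h4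
  rw [abs_mul]
  refine mul_le_mul_of_nonneg_left ?_ (abs_nonneg _)
  rw [hs, Real.sinh_arcosh hv.le, abs_of_nonneg (Real.sqrt_nonneg _)]
  exact Real.sqrt_le_sqrt (by nlinarith)

/-- Splitting the integral at `|y| = δ` and integrating by parts beyond it. -/
theorem abs_integral_deriv_le (hψ : ContDiff ℝ ∞ ψ) (hV : ∀ v, V ≤ v → ψ v = 0) {v L δ : ℝ}
    (h1 : ∀ w, v ≤ w → |ψ w| ≤ 1) (h2 : ∀ w, v ≤ w → |deriv ψ w| ≤ L) (hδ : 0 < δ) :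
    |∫ y : ℝ, deriv ψ (v + y ^ 2)| ≤ 2 * (L * δ + δ⁻¹) := by
  have hcont : Continuous fun y : ℝ => deriv ψ (v + y ^ 2) :=
    (continuous_deriv_of_contDiff hψ).comp (by fun_prop)
  have hcψ : Continuous fun y : ℝ => ψ (v + y ^ 2) := hψ.continuous.comp (by fun_prop)
  have hlarge : ∀ y : ℝ, |V - v| + 1 ≤ y → V < v + y ^ 2 := by
    intro y hy
    nlinarith [le_abs_self (V - v), abs_nonneg (V - v)]
  have hi : ∀ c, IntegrableOn (fun y : ℝ => deriv ψ (v + y ^ 2)) (Ioi c) := by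
    intro c
    have h1 : IntegrableOn (fun y : ℝ => deriv ψ (v + y ^ 2)) (Ioc c (|V - v| + 1)) :=
      hcont.integrableOn_Ioc
    refine h1.of_forall_sdiff_eq_zero measurableSet_Ioi fun y hy => ?_
    refine deriv_eq_zero_of_lt hV (hlarge y ?_)
    by_contra h
    exact hy.2 ⟨hy.1, (not_le.1 h).le⟩
  have e1 : ∫ y : ℝ, deriv ψ (v + y ^ 2) = 2 * ∫ y in Ioi (0 : ℝ), deriv ψ (v + y ^ 2) := by
    rw [← integral_comp_abs (f := fun y => deriv ψ (v + y ^ 2))]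
    simp only [sq_abs]
  have e2 := intervalIntegral.integral_interval_add_Ioi (hi 0) (hi δ)
  have b1 : |∫ y in (0 : ℝ)..δ, deriv ψ (v + y ^ 2)| ≤ L * δ := by
    have := intervalIntegral.norm_integral_le_of_norm_le_const (a := (0 : ℝ)) (b := δ)
      (f := fun y => deriv ψ (v + y ^ 2)) (C := L) fun y _ => h2 _ (by nlinarith [sq_nonneg y])
    rwa [sub_zero, abs_of_pos hδ] at this
  have hr := integral_Ioi_rpow_of_lt (a := -2) (by norm_num) hδ
  have hri := integrableOn_Ioi_rpow_of_lt (a := -2) (by norm_num) hδ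
  have hrp : ∀ y : ℝ, y ^ (-2 : ℝ) = (y ^ 2)⁻¹ := by
    intro y
    have h := Real.rpow_intCast y (-2)
    push_cast at h
    rw [h, zpow_neg]
    norm_cast
  have hr' : ∫ y in Ioi δ, y ^ (-2 : ℝ) = δ⁻¹ := by
    rw [hr]
    norm_num [Real.rpow_neg_one]
  have hg : IntegrableOn (fun y : ℝ => ψ (v + y ^ 2) * (2 * y ^ 2)⁻¹) (Ioi δ) := by
    refine (hri.mono' (f := fun y : ℝ => ψ (v + y ^ 2) * (2 * y ^ 2)⁻¹) ?_ ?_)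
    · exact (hcψ.measurable.mul (by fun_prop)).aestronglyMeasurable
    · refine Eventually.of_forall fun y => ?_
      rw [norm_mul, hrp, mul_inv, Real.norm_eq_abs, Real.norm_of_nonneg (by positivity)]
      have := h1 (v + y ^ 2) (by nlinarith [sq_nonneg y])
      have h3 : 0 ≤ (y ^ 2)⁻¹ := by positivity
      nlinarith [abs_nonneg (ψ (v + y ^ 2))]
  have hgb : |∫ y in Ioi δ, ψ (v + y ^ 2) * (2 * y ^ 2)⁻¹| ≤ δ⁻¹ / 2 := by
    have : ∀ᵐ y ∂volume.restrict (Ioi δ), ‖ψ (v + y ^ 2) * (2 * y ^ 2)⁻¹‖ ≤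
        y ^ (-2 : ℝ) / 2 := by
      refine Eventually.of_forall fun y => ?_
      rw [norm_mul, hrp, mul_inv, Real.norm_eq_abs, Real.norm_of_nonneg (by positivity)]
      have := h1 (v + y ^ 2) (by nlinarith [sq_nonneg y])
      have h3 : 0 ≤ (y ^ 2)⁻¹ := by positivity
      nlinarith [abs_nonneg (ψ (v + y ^ 2))]
    have := norm_integral_le_of_norm_le (hri.div_const 2) this
    rwa [integral_div, hr'] at this
  -- `ψ'(v + y²)` is `(2y)⁻¹` times the `y`-derivative of `ψ(v + y²)`. The boundary term and the
  -- remaining integral each contribute at most `δ⁻¹/2`.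
  have hd : ∀ y ∈ Ici δ, HasDerivAt (fun y : ℝ => ψ (v + y ^ 2) * (2 * y)⁻¹)
      (deriv ψ (v + y ^ 2) - ψ (v + y ^ 2) * (2 * y ^ 2)⁻¹) y := by
    intro y hy
    have hy0 : 0 < y := lt_of_lt_of_le hδ hy
    have h3 : HasDerivAt (fun y : ℝ => v + y ^ 2) (2 * y) y := by
      simpa using (hasDerivAt_pow 2 y).const_add v
    have h4 : HasDerivAt (fun y : ℝ => (2 * y)⁻¹) (-2 / (2 * y) ^ 2) y := by
      have : HasDerivAt (fun y : ℝ => 2 * y) 2 y := by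
        simpa using (hasDerivAt_id y).const_mul (2 : ℝ)
      exact this.inv (by positivity)
    have h5 := ((hψ.differentiable (by simp) (v + y ^ 2)).hasDerivAt.comp y h3).mul h4
    refine h5.congr_deriv ?_
    simp only [Function.comp]
    field_simp
    ring
  have ht : Tendsto (fun y : ℝ => ψ (v + y ^ 2) * (2 * y)⁻¹) atTop (𝓝 0) := by
    refine tendsto_const_nhds.congr' ?_
    filter_upwards [eventually_ge_atTop (|V - v| + 1)] with y hy
    rw [hV _ (hlarge y hy).le, zero_mul]
  have e3 := integral_Ioi_of_hasDerivAt_of_tendsto' hd ((hi δ).sub hg) ht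
  rw [integral_sub (hi δ) hg] at e3
  have b2 : |ψ (v + δ ^ 2) * (2 * δ)⁻¹| ≤ δ⁻¹ / 2 := by
    rw [abs_mul, mul_inv, abs_of_pos (by positivity : 0 < 2⁻¹ * δ⁻¹)]
    have := h1 (v + δ ^ 2) (by nlinarith [sq_nonneg δ])
    have h3 : 0 < δ⁻¹ := by positivity
    nlinarith [abs_nonneg (ψ (v + δ ^ 2))]
  rw [e1, abs_mul, abs_two, ← e2]
  refine mul_le_mul_of_nonneg_left ((abs_add_le _ _).trans (add_le_add b1 ?_)) zero_le_two
  have e4 : ∫ y in Ioi δ, deriv ψ (v + y ^ 2) =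
      (∫ y in Ioi δ, ψ (v + y ^ 2) * (2 * y ^ 2)⁻¹) - ψ (v + δ ^ 2) * (2 * δ)⁻¹ := by linarith
  rw [e4]
  refine (abs_sub _ _).trans ?_
  linarith

end ProfileBounds

end SL2
end

noncomputable section

namespace SL2

open Filter Topology Set

/-! ### `L²` norms of radial functions with a singularity at the identity. -/

section NormBounds

theorem cosh_half_le_two : Real.cosh (1 / 2) ≤ 2 := by
  refine (Real.cosh_le_exp_half_sq _).trans ?_
  have h1 := Real.exp_one_lt_d9
  have h2 : Real.exp ((1 / 2) ^ 2 / 2) ^ 8 = Real.exp 1 := by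
    rw [← Real.exp_nat_mul]; norm_num
  by_contra h
  have := pow_lt_pow_left₀ (not_le.1 h) (by norm_num) (n := 8) (by norm_num)
  norm_num at this
  linarith

theorem one_add_sq_div_two_le_cosh (t : ℝ) : 1 + t ^ 2 / 2 ≤ Real.cosh t := by
  have h1 := Real.cosh_sq' (t / 2)
  have h2 := Real.cosh_two_mul (t / 2)
  have h3 := Real.self_le_sinh_iff.2 (show 0 ≤ |t / 2| by positivity)
  have h4 : |Real.sinh (t / 2)| = Real.sinh |t / 2| := Real.abs_sinh _
  have h5 : (t / 2) ^ 2 ≤ Real.sinh (t / 2) ^ 2 := by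
    rw [← sq_abs (t / 2), ← sq_abs (Real.sinh _), h4]
    exact pow_le_pow_left₀ (abs_nonneg _) h3 2
  rw [mul_div_cancel₀ t two_ne_zero] at h2
  nlinarith

variable {𝕂 : Type} [RCLike 𝕂]

/-- On this ball `|t| ≤ 1/2`, hence `e^t ≥ 1/2`, and `cH - 1` dominates the squared Euclidean
distance from the identity. -/
theorem cH_an_le_cosh_half {t : ℝ} {x : 𝕂} (h : cH (a 𝕂 t * n x) ≤ Real.cosh (1 / 2)) :
    |t| ≤ 2 ∧ ‖x‖ ≤ 2 ∧ (t ^ 2 + ‖x‖ ^ 2) / 4 ≤ cH (a 𝕂 t * n x) - 1 := by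
  rw [cH_an] at h ⊢
  have h1 : Real.cosh t ≤ Real.cosh (1 / 2) := by
    have : 0 ≤ Real.exp t * ‖x‖ ^ 2 / 2 := by positivity
    linarith
  rw [Real.cosh_le_cosh, abs_of_pos (by norm_num : (0 : ℝ) < 1 / 2)] at h1
  have h2 : 1 / 2 ≤ Real.exp t := by
    have := Real.add_one_le_exp t
    linarith [neg_abs_le t]
  have h3 := one_add_sq_div_two_le_cosh t
  have h4 := cosh_half_le_two
  have h5 : ‖x‖ ^ 2 / 4 ≤ Real.exp t * ‖x‖ ^ 2 / 2 := by nlinarith [sq_nonneg ‖x‖]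
  refine ⟨by linarith, abs_le_of_sq_le_sq' (a := ‖x‖) (b := 2) ?_ (by norm_num) |>.2, ?_⟩
  · nlinarith [sq_nonneg t]
  · nlinarith [sq_nonneg t]

/-- The function `|y| ^ (-r)`, cut off at `|y| ≤ 2`. -/
def sing (r y : ℝ) : ℝ := (Icc (-2 : ℝ) 2).indicator (fun y => |y| ^ (-r)) y

theorem sing_nonneg (r y : ℝ) : 0 ≤ sing r y := indicator_nonneg (fun _ _ => by positivity) _

theorem sing_of_abs_le {r y : ℝ} (h : |y| ≤ 2) : sing r y = |y| ^ (-r) :=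
  indicator_of_mem (show y ∈ Icc (-2 : ℝ) 2 from abs_le.1 h) _

theorem integrable_sing {r : ℝ} (hr : r < 1) : Integrable (sing r) := by
  refine (integrable_indicator_iff measurableSet_Icc).2 ?_
  have h1 : IntervalIntegrable (fun y : ℝ => |y| ^ (-r)) volume 0 2 := by
    refine (intervalIntegral.intervalIntegrable_rpow' (r := -r) (by linarith)).congr ?_
    intro y hy
    rw [uIoc_of_le (by norm_num)] at hy
    simp only [abs_of_pos hy.1]
  have h2 : IntervalIntegrable (fun y : ℝ => |y| ^ (-r)) volume (-2) 0 := by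
    have := (IntervalIntegrable.iff_comp_neg (f := fun y : ℝ => |y| ^ (-r)) (a := 0) (b := 2)
      (by simp)).1 h1
    simpa using this.symm
  have := h2.trans h1
  rwa [intervalIntegrable_iff_integrableOn_Icc_of_le (by norm_num)] at this

variable {φ : ℝ → ℝ}

theorem integral_sq_cH_le [MeasureSpace 𝕂] [BorelSpace 𝕂]
    [(volume : Measure 𝕂).IsAddHaarMeasure] (hφ : Continuous φ) {V : ℝ}
    (hV : ∀ v, V < v → φ v = 0) {m : ℝ × 𝕂 → ℝ} (hm : Integrable m)
    (h : ∀ᵐ p : ℝ × 𝕂, φ (cH (a 𝕂 p.1 * n p.2)) ^ 2 ≤ m p) :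
    ∫ g, φ (cH g) ^ 2 ∂haarG 𝕂 ≤ ∫ p, m p := by
  rw [integral_haarG (f := fun g => φ (cH g) ^ 2) ((hφ.comp continuous_cH).pow 2)
    (fun g k hk => by rw [cH_mul_K _ hk])
    (hasCompactSupport_of_cH (R := V) fun g hg => by rw [hV _ hg, zero_pow two_ne_zero])]
  exact integral_mono_of_nonneg (Eventually.of_forall fun p => sq_nonneg _) hm h

/-- AM-GM gives `v - 1 ≥ |t||x|/2`, so `(v - 1)^{-1/2}` is at most `2|t|^{-1/2}|x|^{-1/2}`, a
product of integrable functions of one variable. -/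
theorem exists_integral_sq_cH_le_real : ∃ C : ℝ, 0 ≤ C ∧ ∀ (φ : ℝ → ℝ) (N : ℝ), Continuous φ →
    (∀ v, Real.cosh (1 / 2) < v → φ v = 0) → 0 ≤ N →
    (∀ v, 1 < v → φ v ^ 2 * Real.sqrt (v - 1) ≤ N) →
    ∫ g, φ (cH g) ^ 2 ∂haarG ℝ ≤ C * N := by
  have hm : Integrable (fun p : ℝ × ℝ => sing (1 / 2) p.1 * sing (1 / 2) p.2) :=
    (integrable_sing (by norm_num)).mul_prod (integrable_sing (by norm_num))
  refine ⟨2 * ∫ p : ℝ × ℝ, sing (1 / 2) p.1 * sing (1 / 2) p.2, mul_nonneg zero_le_two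
    (integral_nonneg fun p => mul_nonneg (sing_nonneg _ _) (sing_nonneg _ _)),
    fun φ N hφ hV hN h => ?_⟩
  have h1 : ∀ᵐ p : ℝ × ℝ, p.1 ≠ 0 := by
    rw [Measure.volume_eq_prod]
    exact Measure.quasiMeasurePreserving_fst.ae (Measure.ae_ne volume 0)
  have h2 : ∀ᵐ p : ℝ × ℝ, p.2 ≠ 0 := by
    rw [Measure.volume_eq_prod]
    exact Measure.quasiMeasurePreserving_snd.ae (Measure.ae_ne volume 0)
  refine (integral_sq_cH_le hφ hV (hm.const_mul (2 * N)) ?_).trans (le_of_eq ?_)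
  · filter_upwards [h1, h2] with p hp1 hp2
    obtain ⟨t, x⟩ := p
    simp only at hp1 hp2 ⊢
    have hs : 0 ≤ sing (1 / 2) t * sing (1 / 2) x := mul_nonneg (sing_nonneg _ _) (sing_nonneg _ _)
    rcases lt_or_ge (Real.cosh (1 / 2)) (cH (a ℝ t * n x)) with hlt | hle
    · rw [hV _ hlt, zero_pow two_ne_zero]
      exact mul_nonneg (by positivity) hs
    · obtain ⟨b1, b2, b3⟩ := cH_an_le_cosh_half hle
      rw [Real.norm_eq_abs] at b2 b3
      rw [sing_of_abs_le b1, sing_of_abs_le b2]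
      have ht := abs_pos.2 hp1
      have hx := abs_pos.2 hp2
      set A := |t| ^ (-(1 / 2 : ℝ)) with hA
      set B := |x| ^ (-(1 / 2 : ℝ)) with hB
      have hA0 : 0 < A := by positivity
      have hB0 : 0 < B := by positivity
      have hA2 : A ^ 2 * |t| = 1 := by
        rw [hA, ← Real.rpow_natCast, ← Real.rpow_mul ht.le]; norm_num
        rw [Real.rpow_neg_one, inv_mul_cancel₀ ht.ne']
      have hB2 : B ^ 2 * |x| = 1 := by
        rw [hB, ← Real.rpow_natCast, ← Real.rpow_mul hx.le]; norm_num
        rw [Real.rpow_neg_one, inv_mul_cancel₀ hx.ne']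
      have hw : |t| * |x| / 2 ≤ cH (a ℝ t * n x) - 1 := by
        rw [← sq_abs t] at b3
        nlinarith [sq_nonneg (|t| - |x|)]
      have hw0 : 0 < |t| * |x| / 2 := by positivity
      have hN' := h (cH (a ℝ t * n x)) (by linarith)
      have hsq : (2 * A * B)⁻¹ ≤ Real.sqrt (cH (a ℝ t * n x) - 1) := by
        refine Real.le_sqrt_of_sq_le (le_trans ?_ hw)
        rw [inv_pow, inv_le_iff_one_le_mul₀ (by positivity)]
        have : |t| * |x| / 2 * (2 * A * B) ^ 2 = 2 * (A ^ 2 * |t|) * (B ^ 2 * |x|) := by ring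
        rw [this, hA2, hB2]; norm_num
      have h3 := (mul_le_mul_of_nonneg_left hsq (sq_nonneg (φ (cH (a ℝ t * n x))))).trans hN'
      rw [← div_eq_mul_inv, div_le_iff₀ (by positivity)] at h3
      linarith
  · rw [integral_const_mul]; ring

/-- The dimension is now three, and AM-GM for `t²`, `(re x)²`, `(im x)²` bounds `(v - 1)⁻¹` by a
product of powers with exponent `-2/3`, still integrable in each variable. -/
theorem exists_integral_sq_cH_le_complex : ∃ C : ℝ, 0 ≤ C ∧ ∀ (φ : ℝ → ℝ) (N : ℝ), Continuous φ →
    (∀ v, Real.cosh (1 / 2) < v → φ v = 0) → 0 ≤ N →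
    (∀ v, 1 < v → φ v ^ 2 * (v - 1) ≤ N) →
    ∫ g, φ (cH g) ^ 2 ∂haarG ℂ ≤ C * N := by
  have hs1 := integrable_sing (r := 2 / 3) (by norm_num)
  have hm2 : Integrable (fun z : ℂ => sing (2 / 3) z.re * sing (2 / 3) z.im) := by
    have := (Complex.volume_preserving_equiv_real_prod.integrable_comp_emb
      Complex.measurableEquivRealProd.measurableEmbedding).2 (hs1.mul_prod hs1)
    exact this
  have hm : Integrable (fun p : ℝ × ℂ =>
      sing (2 / 3) p.1 * (sing (2 / 3) p.2.re * sing (2 / 3) p.2.im)) := hs1.mul_prod hm2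
  have hpos : ∀ p : ℝ × ℂ, 0 ≤ sing (2 / 3) p.1 * (sing (2 / 3) p.2.re * sing (2 / 3) p.2.im) :=
    fun p => mul_nonneg (sing_nonneg _ _) (mul_nonneg (sing_nonneg _ _) (sing_nonneg _ _))
  refine ⟨2 * ∫ p : ℝ × ℂ, sing (2 / 3) p.1 * (sing (2 / 3) p.2.re * sing (2 / 3) p.2.im),
    mul_nonneg zero_le_two (integral_nonneg hpos), fun φ N hφ hV hN h => ?_⟩
  have h1 : ∀ᵐ p : ℝ × ℂ, p.1 ≠ 0 := by
    rw [Measure.volume_eq_prod]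
    exact Measure.quasiMeasurePreserving_fst.ae (Measure.ae_ne volume 0)
  have h0 : ∀ᵐ z : ℂ, z.re ≠ 0 ∧ z.im ≠ 0 := by
    refine Complex.volume_preserving_equiv_real_prod.quasiMeasurePreserving.ae
      (p := fun q : ℝ × ℝ => q.1 ≠ 0 ∧ q.2 ≠ 0) ?_
    rw [Measure.volume_eq_prod]
    exact (Measure.quasiMeasurePreserving_fst.ae (Measure.ae_ne volume 0)).and
      (Measure.quasiMeasurePreserving_snd.ae (Measure.ae_ne volume 0))
  have h2 : ∀ᵐ p : ℝ × ℂ, p.2.re ≠ 0 ∧ p.2.im ≠ 0 := by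
    rw [Measure.volume_eq_prod]
    exact Measure.quasiMeasurePreserving_snd.ae h0
  refine (integral_sq_cH_le hφ hV (hm.const_mul (2 * N)) ?_).trans (le_of_eq ?_)
  · filter_upwards [h1, h2] with p hp1 hp2
    obtain ⟨t, x⟩ := p
    have hs := hpos (t, x)
    simp only at hp1 hp2 hs ⊢
    rcases lt_or_ge (Real.cosh (1 / 2)) (cH (a ℂ t * n x)) with hlt | hle
    · rw [hV _ hlt, zero_pow two_ne_zero]
      exact mul_nonneg (by positivity) hs
    · obtain ⟨b1, b2, b3⟩ := cH_an_le_cosh_half hle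
      rw [Complex.sq_norm, Complex.normSq_apply, ← sq, ← sq] at b3
      rw [sing_of_abs_le b1, sing_of_abs_le ((Complex.abs_re_le_norm x).trans b2),
        sing_of_abs_le ((Complex.abs_im_le_norm x).trans b2)]
      have key : ∀ {y : ℝ}, y ≠ 0 → 0 < |y| ^ (-(2 / 3 : ℝ)) ∧
          (y ^ 2) ^ (1 / 3 : ℝ) * |y| ^ (-(2 / 3 : ℝ)) = 1 := by
        intro y hy
        have hy' := abs_pos.2 hy
        refine ⟨by positivity, ?_⟩
        rw [← sq_abs, ← Real.rpow_natCast, ← Real.rpow_mul hy'.le, ← Real.rpow_add hy']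
        norm_num
      obtain ⟨A0, A1⟩ := key hp1
      obtain ⟨B0, B1⟩ := key hp2.1
      obtain ⟨D0, D1⟩ := key hp2.2
      have hgm := Real.geom_mean_le_arith_mean3_weighted (w₁ := 1 / 3) (w₂ := 1 / 3) (w₃ := 1 / 3)
        (by norm_num) (by norm_num) (by norm_num) (sq_nonneg t) (sq_nonneg x.re)
        (sq_nonneg x.im) (by norm_num)
      set A := |t| ^ (-(2 / 3 : ℝ))
      set B := |x.re| ^ (-(2 / 3 : ℝ))
      set D := |x.im| ^ (-(2 / 3 : ℝ))
      set P := (t ^ 2) ^ (1 / 3 : ℝ) * (x.re ^ 2) ^ (1 / 3 : ℝ) * (x.im ^ 2) ^ (1 / 3 : ℝ)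
      have hP : P * (A * (B * D)) = 1 := by
        calc P * (A * (B * D)) = ((t ^ 2) ^ (1 / 3 : ℝ) * A) * ((x.re ^ 2) ^ (1 / 3 : ℝ) * B) *
              ((x.im ^ 2) ^ (1 / 3 : ℝ) * D) := by ring
          _ = 1 := by rw [A1, B1, D1]; norm_num
      have hABD : 0 < A * (B * D) := by positivity
      have hP0 : 0 < P := by
        by_contra hn
        nlinarith
      have hw : P / 2 ≤ cH (a ℂ t * n x) - 1 := by linarith
      have hN' := h (cH (a ℂ t * n x)) (by linarith)
      have h3 := (mul_le_mul_of_nonneg_left hw (sq_nonneg (φ (cH (a ℂ t * n x))))).trans hN'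
      have h4 := mul_le_mul_of_nonneg_right h3 hABD.le
      have h5 : φ (cH (a ℂ t * n x)) ^ 2 * (P / 2) * (A * (B * D)) =
          φ (cH (a ℂ t * n x)) ^ 2 / 2 := by
        linear_combination φ (cH (a ℂ t * n x)) ^ 2 / 2 * hP
      rw [h5] at h4
      linarith
  · rw [integral_const_mul]; ring

end NormBounds

end SL2
end

noncomputable section

namespace SL2

open Filter Topology Set

/-! ### Inversion of the Abel transform and the resulting functions `u`. -/

section AbelInversion

variable {ψ : ℝ → ℝ} {V : ℝ}

/-- The inverse of the Abel transform on `SL₂(ℝ)`. -/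
def abelInvReal (ψ : ℝ → ℝ) (v : ℝ) : ℝ :=
  -(Real.pi * Real.sqrt 2)⁻¹ * ∫ y : ℝ, deriv ψ (v + y ^ 2)

theorem contDiff_abelInvReal (hψ : ContDiff ℝ ∞ ψ) (hV : ∀ v, V ≤ v → ψ v = 0) :
    ContDiff ℝ ∞ (abelInvReal ψ) := by
  refine contDiff_const.mul (contDiff_iff_contDiffAt.2 fun v => ?_)
  refine (contDiffOn_integral_param (g := fun v y => deriv ψ (v + y ^ 2)) (isOpen_Ioi (a := v - 1))
    (isCompact_Icc (a := -(|V - v| + 2)) (b := |V - v| + 2)) (fun p y hp hy => ?_) ?_).contDiffAt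
    (Ioi_mem_nhds (by linarith))
  · refine deriv_eq_zero_of_lt hV ?_
    have h1 : |V - v| + 2 < |y| := by
      by_contra h
      exact hy (abs_le.1 (not_lt.1 h))
    have hp' : v - 1 < p := hp
    rw [← sq_abs]
    nlinarith [le_abs_self (V - v), abs_nonneg (V - v)]
  · exact ((contDiff_deriv hψ).comp (by fun_prop)).contDiffOn

theorem abelInvReal_eq_zero (hV : ∀ v, V ≤ v → ψ v = 0) {v : ℝ} (hv : V < v) :
    abelInvReal ψ v = 0 := by
  have h : ∀ y : ℝ, deriv ψ (v + y ^ 2) = 0 := fun y =>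
    deriv_eq_zero_of_lt hV (by nlinarith [sq_nonneg y])
  simp [abelInvReal, h]

/-- The integral over `x` and the one in the inversion formula combine to a plane integral of `ψ'(v
+ x² + y²)`, which in polar coordinates is `π ∫₀^∞ ψ'(v + R) dR = -π ψ(v)`. The factor `√2` accounts
for `x²/2`. -/
theorem integral_abelInvReal (hψ : ContDiff ℝ ∞ ψ) (hV : ∀ v, V ≤ v → ψ v = 0) (v : ℝ) :
    ∫ x : ℝ, abelInvReal ψ (v + ‖x‖ ^ 2 / 2) = ψ v := by
  have hc : Continuous fun p : ℝ × ℝ => deriv ψ (v + (p.1 ^ 2 + p.2 ^ 2)) :=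
    (continuous_deriv_of_contDiff hψ).comp (by fun_prop)
  have hs : HasCompactSupport fun p : ℝ × ℝ => deriv ψ (v + (p.1 ^ 2 + p.2 ^ 2)) := by
    refine HasCompactSupport.intro ((isCompact_closedBall (0 : ℝ) (|V - v| + 1)).prod
      (isCompact_closedBall (0 : ℝ) (|V - v| + 1))) ?_
    rintro ⟨x, y⟩ hp
    refine deriv_eq_zero_of_lt hV ?_
    simp only
    by_contra hle
    have h1 := le_abs_self (V - v)
    have h0 := abs_nonneg (V - v)
    refine hp ⟨?_, ?_⟩ <;> rw [mem_closedBall_zero_iff, Real.norm_eq_abs] <;>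
      refine abs_le_of_sq_le_sq ?_ (by linarith) <;> nlinarith [sq_nonneg x, sq_nonneg y]
  have h := integral_radial (f := fun R => deriv ψ (v + R))
    ((continuous_deriv_of_contDiff hψ).comp (by fun_prop)).measurable
  rw [Measure.volume_eq_prod, integral_prod _ (hc.integrable_of_hasCompactSupport hs)] at h
  have h1 := integral_Ioi_deriv_comp hψ hV v one_pos
  simp only [one_mul, inv_one] at h1
  rw [h1] at h
  have h2 := integral_comp_div_sqrt_two fun q => abelInvReal ψ (v + q)
  have h3 : ∫ y : ℝ, abelInvReal ψ (v + y ^ 2) = -(Real.pi * Real.sqrt 2)⁻¹ *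
      ∫ x : ℝ, ∫ y : ℝ, deriv ψ (v + (x ^ 2 + y ^ 2)) := by
    simp only [abelInvReal, integral_const_mul, add_assoc]
  rw [h3, h] at h2
  simp only [Real.norm_eq_abs, sq_abs]
  have hpi := Real.pi_pos
  have h2' : (0 : ℝ) < Real.sqrt 2 := by positivity
  set J := ∫ x : ℝ, abelInvReal ψ (v + x ^ 2 / 2)
  field_simp at h2
  exact h2.symm

/-- The inverse transform is a half-derivative, so its square is controlled by the product of the
bounds `1` for `ψ` and `N/√(v - 1)` for `ψ'`. The choice of `δ` balances the two terms of
`abs_integral_deriv_le`; the final constant is `16/(2π²) < 1`. -/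
theorem abelInvReal_sq_le (hψ : ContDiff ℝ ∞ ψ) (hV : ∀ v, V ≤ v → ψ v = 0) {N : ℝ} (hN : 0 < N)
    (h1 : ∀ v, 1 ≤ v → |ψ v| ≤ 1) (h2 : ∀ v, 1 < v → |deriv ψ v| * Real.sqrt (v - 1) ≤ N) {v : ℝ}
    (hv : 1 < v) : abelInvReal ψ v ^ 2 * Real.sqrt (v - 1) ≤ N := by
  set w := Real.sqrt (v - 1) with hw
  have hw0 : 0 < w := Real.sqrt_pos.2 (by linarith)
  set δ := Real.sqrt (w / N) with hδ
  have hδ0 : 0 < δ := Real.sqrt_pos.2 (by positivity)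
  have hδ2 : δ ^ 2 = w / N := Real.sq_sqrt (by positivity)
  have hb := abs_integral_deriv_le hψ hV (v := v) (L := N / w) (fun u hu => h1 u (by linarith))
    (fun u hu => by
      rw [le_div_iff₀ hw0]
      refine le_trans ?_ (h2 u (by linarith))
      exact mul_le_mul_of_nonneg_left (Real.sqrt_le_sqrt (by linarith)) (abs_nonneg _)) hδ0
  set I := ∫ y : ℝ, deriv ψ (v + y ^ 2) with hI
  have e1 : N / w * δ = δ⁻¹ := by
    rw [← one_div, eq_div_iff hδ0.ne', mul_assoc, ← sq, hδ2]
    field_simp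
  rw [e1] at hb
  have hI2 : I ^ 2 ≤ 16 * (N / w) := by
    have h3 : I ^ 2 ≤ (2 * (δ⁻¹ + δ⁻¹)) ^ 2 := by
      rw [← sq_abs]; exact pow_le_pow_left₀ (abs_nonneg _) hb 2
    have h4 : (2 * (δ⁻¹ + δ⁻¹)) ^ 2 = 16 * (δ ^ 2)⁻¹ := by rw [← inv_pow]; ring
    rwa [h4, hδ2, inv_div] at h3
  have e2 : abelInvReal ψ v ^ 2 * w = (2 * Real.pi ^ 2)⁻¹ * (I ^ 2 * w) := by
    rw [abelInvReal, ← hI, mul_pow, neg_sq, inv_pow, mul_pow, Real.sq_sqrt (by norm_num)]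
    ring
  have h5 : I ^ 2 * w ≤ 16 * N := by
    calc I ^ 2 * w ≤ 16 * (N / w) * w := mul_le_mul_of_nonneg_right hI2 hw0.le
      _ = 16 * N := by field_simp
  rw [e2, inv_mul_le_iff₀ (by positivity)]
  nlinarith [Real.pi_gt_three, mul_pos hN Real.pi_pos]

theorem exists_radial_real : ∃ C > (0 : ℝ), ∀ ξ : ℝ, ∃ φ : ℝ → ℝ, ContDiff ℝ ∞ φ ∧
    (∀ v, Real.cosh (1 / 2) < v → φ v = 0) ∧
    (∀ s, ∫ x : ℝ, φ (Real.cosh s + ‖x‖ ^ 2 / 2) = Real.cos (ξ * s) * bump s) ∧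
    ∫ g, φ (cH g) ^ 2 ∂haarG ℝ ≤ C * (1 + |ξ|) := by
  obtain ⟨C, hC, h⟩ := exists_integral_sq_cH_le_real
  obtain ⟨M, hM1, hM⟩ := exists_deriv_bump_le
  refine ⟨(C + 1) * M, by positivity, fun ξ => ?_⟩
  obtain ⟨ψ, hψ, hval, hV⟩ := exists_cosh_profile ξ
  have hval' : ∀ s, ψ (Real.cosh s) = Real.cos (ξ * s) * bump s := hval
  have hN : 0 < |ξ| + M := by positivity
  refine ⟨abelInvReal ψ, contDiff_abelInvReal hψ hV, fun v hv => abelInvReal_eq_zero hV hv,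
    fun s => by rw [integral_abelInvReal hψ hV, hval'], ?_⟩
  refine (h _ _ (contDiff_abelInvReal hψ hV).continuous (fun v hv => abelInvReal_eq_zero hV hv)
    hN.le fun v hv => abelInvReal_sq_le hψ hV hN (fun v hv => abs_profile_le hval' hv)
    (fun v hv => abs_deriv_profile_le hψ hM hval' hv) hv).trans ?_
  have h1 : |ξ| + M ≤ M * (1 + |ξ|) := by nlinarith [abs_nonneg ξ]
  rw [mul_assoc]
  exact mul_le_mul (by linarith) h1 hN.le (by positivity)

theorem integral_complex_radial {f : ℝ → ℝ} (hf : Measurable f) :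
    ∫ z : ℂ, f (‖z‖ ^ 2) = Real.pi * ∫ R in Ioi (0 : ℝ), f R := by
  rw [← integral_radial hf, ← Complex.volume_preserving_equiv_real_prod.integral_comp
    Complex.measurableEquivRealProd.measurableEmbedding]
  refine integral_congr_ae (Eventually.of_forall fun z => ?_)
  simp only [Complex.measurableEquivRealProd_apply]
  rw [Complex.sq_norm, Complex.normSq_apply, sq, sq]

/-- The inverse of the Abel transform on `SL₂(ℂ)`. -/
def abelInvComplex (ψ : ℝ → ℝ) (v : ℝ) : ℝ := -(2 * Real.pi)⁻¹ * deriv ψ v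

theorem contDiff_abelInvComplex (hψ : ContDiff ℝ ∞ ψ) : ContDiff ℝ ∞ (abelInvComplex ψ) :=
  contDiff_const.mul (contDiff_deriv hψ)

theorem abelInvComplex_eq_zero (hV : ∀ v, V ≤ v → ψ v = 0) {v : ℝ} (hv : V < v) :
    abelInvComplex ψ v = 0 := by
  rw [abelInvComplex, deriv_eq_zero_of_lt hV hv, mul_zero]

theorem integral_abelInvComplex (hψ : ContDiff ℝ ∞ ψ) (hV : ∀ v, V ≤ v → ψ v = 0) (v : ℝ) :
    ∫ x : ℂ, abelInvComplex ψ (v + ‖x‖ ^ 2 / 2) = ψ v := by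
  have h := integral_complex_radial (f := fun R => abelInvComplex ψ (v + R / 2))
    ((contDiff_abelInvComplex hψ).continuous.comp (by fun_prop)).measurable
  have h1 := integral_Ioi_deriv_comp hψ hV v (c := 1 / 2) (by norm_num)
  rw [h]
  simp only [abelInvComplex, integral_const_mul]
  have e : ∀ R : ℝ, v + R / 2 = v + 1 / 2 * R := fun R => by ring
  rw [funext fun R => congrArg (deriv ψ) (e R), h1]
  have hpi := Real.pi_pos
  field_simp

theorem abelInvComplex_sq_le {N v : ℝ}
    (h2 : |deriv ψ v| * Real.sqrt (v - 1) ≤ N) (hv : 1 < v) :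
    abelInvComplex ψ v ^ 2 * (v - 1) ≤ N ^ 2 := by
  have h3 := pow_le_pow_left₀ (by positivity) h2 2
  rw [mul_pow, sq_abs, Real.sq_sqrt (by linarith)] at h3
  have e : abelInvComplex ψ v ^ 2 * (v - 1) =
      ((2 * Real.pi) ^ 2)⁻¹ * (deriv ψ v ^ 2 * (v - 1)) := by
    rw [abelInvComplex, mul_pow, neg_sq, inv_pow]; ring
  rw [e, inv_mul_le_iff₀ (by positivity)]
  refine h3.trans (le_mul_of_one_le_left (sq_nonneg N) (one_le_pow₀ ?_))
  linarith [Real.pi_gt_three]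

theorem exists_radial_complex : ∃ C > (0 : ℝ), ∀ ξ : ℝ, ∃ φ : ℝ → ℝ, ContDiff ℝ ∞ φ ∧
    (∀ v, Real.cosh (1 / 2) < v → φ v = 0) ∧
    (∀ s, ∫ x : ℂ, φ (Real.cosh s + ‖x‖ ^ 2 / 2) = Real.cos (ξ * s) * bump s) ∧
    ∫ g, φ (cH g) ^ 2 ∂haarG ℂ ≤ C * (1 + |ξ|) ^ 2 := by
  obtain ⟨C, hC, h⟩ := exists_integral_sq_cH_le_complex
  obtain ⟨M, hM1, hM⟩ := exists_deriv_bump_le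
  refine ⟨(C + 1) * M ^ 2, by positivity, fun ξ => ?_⟩
  obtain ⟨ψ, hψ, hval, hV⟩ := exists_cosh_profile ξ
  have hval' : ∀ s, ψ (Real.cosh s) = Real.cos (ξ * s) * bump s := hval
  have hN : 0 < |ξ| + M := by positivity
  refine ⟨abelInvComplex ψ, contDiff_abelInvComplex hψ, fun v hv => abelInvComplex_eq_zero hV hv,
    fun s => by rw [integral_abelInvComplex hψ hV, hval'], ?_⟩
  refine (h _ _ (contDiff_abelInvComplex hψ).continuous
    (fun v hv => abelInvComplex_eq_zero hV hv) (sq_nonneg (|ξ| + M)) fun v hv =>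
    abelInvComplex_sq_le (abs_deriv_profile_le hψ hM hval' hv) hv).trans ?_
  have h1 : |ξ| + M ≤ M * (1 + |ξ|) := by nlinarith [abs_nonneg ξ]
  have h2 := pow_le_pow_left₀ hN.le h1 2
  rw [mul_pow] at h2
  rw [mul_assoc]
  exact mul_le_mul (by linarith) h2 (sq_nonneg _) (by positivity)

end AbelInversion

/-! ### Lower bounds for the cosine transform of the bump. -/

section CosineIntegrals

theorem bump_nonneg (s : ℝ) : 0 ≤ bump s := cutoff_nonneg _

theorem bump_le_one (s : ℝ) : bump s ≤ 1 := cutoff_le_one _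

theorem integral_bump_pos : 0 < ∫ s, bump s :=
  contDiff_bump.continuous.integral_pos_of_hasCompactSupport_nonneg_nonzero
    hasCompactSupport_bump (fun s => bump_nonneg s) (x := 0) (by simp [bump, cutoff_zero])

theorem integrable_mul_bump {f : ℝ → ℝ} (hf : Continuous f) : Integrable fun s => f s * bump s :=
  (hf.mul contDiff_bump.continuous).integrable_of_hasCompactSupport hasCompactSupport_bump.mul_left

theorem neg_div_three_le_sin {x : ℝ} (hx : 0 ≤ x) : -(x / 3) ≤ Real.sin x := by
  rcases le_total x 3 with h | h
  · have := Real.sin_nonneg_of_nonneg_of_le_pi hx (h.trans Real.pi_gt_three.le)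
    linarith
  · linarith [Real.neg_one_le_sin x]

theorem deriv_bump_mul_self_nonpos (s : ℝ) : s * deriv bump s ≤ 0 := by
  have h : HasDerivAt bump (deriv cutoff (s ^ 2) * (2 * s)) s := by
    have h1 : HasDerivAt (fun s : ℝ => s ^ 2) (2 * s) s := by simpa using hasDerivAt_pow 2 s
    exact (contDiff_cutoff.differentiable (by simp) (s ^ 2)).hasDerivAt.comp s h1
  have h2 : deriv cutoff (s ^ 2) ≤ 0 := antitone_cutoff.deriv_nonpos
  rw [h.deriv]
  nlinarith [sq_nonneg s]

/-- An even bump decreasing in `|s|` is a superposition of intervals `[-r, r]`, and the cosine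
transform `2 sin(ξr)/ξ` of an interval is at least `-1/3` of its length. Integration by parts
expresses this: the primitive of `cos(ξs) + 1/3` has the sign of `s`, while the derivative of the
bump has the opposite sign. -/
theorem integral_cos_mul_bump_ge (ξ : ℝ) :
    -((∫ s, bump s) / 3) ≤ ∫ s, Real.cos (ξ * s) * bump s := by
  rcases eq_or_ne ξ 0 with rfl | hξ
  · simp only [zero_mul, Real.cos_zero, one_mul]
    linarith [integral_bump_pos]
  have hd : ∀ s, HasDerivAt (fun s => Real.sin (ξ * s) / ξ + s / 3)
      (Real.cos (ξ * s) + 1 / 3) s := by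
    intro s
    have h3 : HasDerivAt (fun s : ℝ => ξ * s) ξ s := by
      simpa using (hasDerivAt_id s).const_mul ξ
    refine ((h3.sin.div_const ξ).add ((hasDerivAt_id s).div_const 3)).congr_deriv ?_
    field_simp
  have hcd := continuous_deriv_of_contDiff contDiff_bump
  have h1 : Integrable fun s => (Real.sin (ξ * s) / ξ + s / 3) * deriv bump s :=
    ((by fun_prop : Continuous fun s => Real.sin (ξ * s) / ξ + s / 3).mul
      hcd).integrable_of_hasCompactSupport hasCompactSupport_bump.deriv.mul_left
  have h := integral_mul_deriv_eq_deriv_mul_of_integrable (fun s _ => hd s)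
    (fun s _ => (contDiff_bump.differentiable (by simp) s).hasDerivAt) h1
    (integrable_mul_bump (by fun_prop)) (integrable_mul_bump (by fun_prop))
  have h2 : ∫ s, (Real.sin (ξ * s) / ξ + s / 3) * deriv bump s ≤ 0 := by
    refine integral_nonpos fun s => ?_
    have e : Real.sin (ξ * s) / ξ + s / 3 = s * (Real.sin |ξ * s| / |ξ * s| + 1 / 3) ∨ s = 0 := by
      rcases eq_or_ne s 0 with hs | hs
      · exact Or.inr hs
      · left
        rcases abs_cases (ξ * s) with ⟨h, -⟩ | ⟨h, -⟩ <;> rw [h]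
        · field_simp
        · rw [Real.sin_neg, neg_div_neg_eq]; field_simp
    rcases e with e | e
    · have hp : 0 ≤ Real.sin |ξ * s| / |ξ * s| + 1 / 3 := by
        rcases (abs_nonneg (ξ * s)).eq_or_lt with h0 | h0
        · rw [← h0]; norm_num
        · have := neg_div_three_le_sin h0.le
          have h4 : -(1 / 3) ≤ Real.sin |ξ * s| / |ξ * s| := by
            rw [le_div_iff₀ h0]; linarith
          linarith
      have := deriv_bump_mul_self_nonpos s
      simp only [Pi.zero_apply]
      rw [e]
      nlinarith
    · simp [e]
  have e2 : ∫ s, (Real.cos (ξ * s) + 1 / 3) * bump s =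
      (∫ s, Real.cos (ξ * s) * bump s) + (∫ s, bump s) / 3 := by
    simp only [add_mul]
    rw [integral_add (integrable_mul_bump (by fun_prop)) (integrable_mul_bump (by fun_prop)),
      integral_const_mul]
    ring
  rw [e2] at h
  linarith

/-- The product of cosines splits into frequencies `α - β` and `α + β`. On the support of the bump
`|(α - β)s| ≤ 1`, so the first term gives at least `1/4` of the mass; the second loses at most
`1/6`, and `1/4 - 1/6 = 1/12`. -/
theorem integral_cos_mul_cos_mul_bump_ge {α β : ℝ} (h : |α - β| ≤ 2) :
    (∫ s, bump s) / 12 ≤ ∫ s, Real.cos (α * s) * bump s * Real.cos (β * s) := by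
  have e : ∀ s, Real.cos (α * s) * bump s * Real.cos (β * s) =
      1 / 2 * (Real.cos ((α - β) * s) * bump s) + 1 / 2 * (Real.cos ((α + β) * s) * bump s) := by
    intro s
    rw [sub_mul, add_mul, Real.cos_sub, Real.cos_add]
    ring
  simp only [e]
  rw [integral_add ((integrable_mul_bump (by fun_prop)).const_mul _)
    ((integrable_mul_bump (by fun_prop)).const_mul _), integral_const_mul, integral_const_mul]
  have h1 := integral_cos_mul_bump_ge (α + β)
  have h2 : (∫ s, bump s) / 2 ≤ ∫ s, Real.cos ((α - β) * s) * bump s := by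
    rw [← integral_div]
    refine integral_mono ((contDiff_bump.continuous.integrable_of_hasCompactSupport
      hasCompactSupport_bump).div_const 2) (integrable_mul_bump (by fun_prop)) fun s => ?_
    rcases le_or_gt (1 / 2) |s| with hs | hs
    · simp [bump_of_le hs]
    · have h3 : |(α - β) * s| ≤ 1 := by
        rw [abs_mul]; nlinarith [abs_nonneg s, abs_nonneg (α - β)]
      have h4 := Real.one_sub_sq_div_two_le_cos (x := (α - β) * s)
      have h5 : ((α - β) * s) ^ 2 ≤ 1 := by rw [← sq_abs]; nlinarith [abs_nonneg ((α - β) * s)]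
      have := mul_le_mul_of_nonneg_right (show 1 / 2 ≤ Real.cos ((α - β) * s) by linarith)
        (bump_nonneg s)
      simp only
      linarith
  linarith

end CosineIntegrals

end SL2
end

noncomputable section

namespace SL2

/-! ### Assembly of the properties of `F`. -/

section MainProperties

variable {𝕂 : Type} [RCLike 𝕂] [MeasureSpace 𝕂] [BorelSpace 𝕂]
  [(volume : Measure 𝕂).IsAddHaarMeasure] {φ : ℝ → ℝ} {V ξ : ℝ}

theorem continuous_cos_mul_bump (ξ : ℝ) : Continuous fun s => Real.cos (ξ * s) * bump s :=
  (by fun_prop : Continuous fun s => Real.cos (ξ * s)).mul contDiff_bump.continuous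

/-- `abel F` is the autocorrelation of a function bounded by `1` and supported in an interval of
length `1`. No trace of the frequency `ξ` is left. -/
theorem abs_abel_autocorr_le_one (hφ : Continuous φ) (hV : ∀ v, V < v → φ v = 0)
    (hA : ∀ s, ∫ x : 𝕂, φ (Real.cosh s + ‖x‖ ^ 2 / 2) = Real.cos (ξ * s) * bump s) (s : ℝ) :
    |abel (autocorr 𝕂 φ) s| ≤ 1 := by
  rw [abel_autocorr hφ hV]
  simp only [abel_radial, hA]
  have hle : ∀ r, |Real.cos (ξ * r) * bump r| ≤ 1 := fun r => by
    rw [abs_mul, abs_of_nonneg (bump_nonneg r)]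
    exact mul_le_one₀ (Real.abs_cos_le_one _) (bump_nonneg r) (bump_le_one r)
  have hi : Integrable ((Set.Icc (-(1 / 2) : ℝ) (1 / 2)).indicator fun _ => (1 : ℝ)) :=
    (integrable_indicator_iff measurableSet_Icc).2 (integrableOn_const (by simp))
  have h := norm_integral_le_of_norm_le hi (f := fun r => Real.cos (ξ * r) * bump r *
    (Real.cos (ξ * (r - s)) * bump (r - s))) (Filter.Eventually.of_forall fun r => by
      by_cases hr : r ∈ Set.Icc (-(1 / 2) : ℝ) (1 / 2)
      · rw [Set.indicator_of_mem hr, norm_mul]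
        exact mul_le_one₀ (hle r) (norm_nonneg _) (hle _)
      · rw [Set.indicator_of_notMem hr, bump_of_le (by
          by_contra hn
          exact hr (abs_le.1 (not_le.1 hn).le))]
        simp)
  rw [integral_indicator measurableSet_Icc] at h
  refine h.trans (le_of_eq ?_)
  simp
  norm_num

theorem sphericalTransform_autocorr (hφ : ContDiff ℝ ∞ φ) (hV : ∀ v, V < v → φ v = 0)
    (hA : ∀ s, ∫ x : 𝕂, φ (Real.cosh s + ‖x‖ ^ 2 / 2) = Real.cos (ξ * s) * bump s) {τ : ℝ}
    (hτ : |ξ - rho 𝕂 * τ| ≤ 2) :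
    (sphericalTransform (fun g : G 𝕂 => ((autocorr 𝕂 φ g : ℝ) : ℂ)) (Complex.I * (τ : ℂ))).im = 0 ∧
      ((∫ s, bump s) / 12) ^ 2 ≤
      (sphericalTransform (fun g : G 𝕂 => ((autocorr 𝕂 φ g : ℝ) : ℂ)) (Complex.I * (τ : ℂ))).re := by
  have hAc := continuous_cos_mul_bump ξ
  have hAs : HasCompactSupport fun s => Real.cos (ξ * s) * bump s :=
    hasCompactSupport_bump.mul_left
  have h1 := sphericalTransform_eq_abel (continuous_autocorr (𝕂 := 𝕂) hφ hV)
    (hasCompactSupport_autocorr hV) (fun k₁ h₁ k₂ h₂ g => autocorr_biinvariant φ h₁ h₂ g) τ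
  simp only [abel_autocorr hφ.continuous hV, abel_radial, hA] at h1
  rw [h1, integral_autocorrelation hAc (M := 1 / 2)
    (fun r hr => by rw [bump_of_le hr.le, mul_zero])]
  refine ⟨Complex.ofReal_im _, ?_⟩
  rw [Complex.ofReal_re]
  refine le_trans ?_ (sq_integral_cos_le_normSq hAc hAs _)
  exact pow_le_pow_left₀ (div_nonneg integral_bump_pos.le (by norm_num))
    (integral_cos_mul_cos_mul_bump_ge hτ) 2

/-- Submultiplicativity gives `cH ≤ 2 cosh²(1/2) = 1 + cosh 1` on the support, and this is below
`cosh 2`. -/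
theorem support_autocorr_subset (hV : ∀ v, Real.cosh (1 / 2) < v → φ v = 0) :
    Function.support (fun g : G 𝕂 => ((autocorr 𝕂 φ g : ℝ) : ℂ)) ⊆ ball 𝕂 2 := by
  intro g hg
  refine (height_le_iff g zero_le_two).2 ?_
  by_contra hlt
  refine hg ?_
  have h1 : 2 * Real.cosh (1 / 2) ^ 2 ≤ Real.cosh 2 := by
    have h2 := Real.cosh_two_mul (1 / 2)
    have h3 := Real.cosh_sq' (1 / 2)
    have h4 := Real.cosh_two_mul 1
    have h5 := Real.cosh_sq' 1
    have h6 := one_add_sq_div_two_le_cosh 1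
    norm_num at h2 h4
    nlinarith
  simp only
  rw [autocorr_eq_zero hV (lt_of_le_of_lt h1 (not_le.1 hlt)), Complex.ofReal_zero]

/-- All properties of `u` and `F = u * ǔ` for `u = φ ∘ cH`, given the Abel transform of `u`, the
`L²`-norm of `u`, and the orbital integrals of `F`. -/
theorem exists_test_function (hφ : ContDiff ℝ ∞ φ)
    (hV : ∀ v, Real.cosh (1 / 2) < v → φ v = 0) {t C : ℝ}
    (hA : ∀ s, ∫ x : 𝕂, φ (Real.cosh s + ‖x‖ ^ 2 / 2) = Real.cos (rho 𝕂 * t * s) * bump s)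
    (hρ : rho 𝕂 ≤ 2)
    (hn : ∫ g, φ (cH g) ^ 2 ∂haarG 𝕂 ≤ C * (1 + |t|) ^ rho 𝕂)
    (ho : ∀ γ : G 𝕂, IsRegularSemisimple γ → ∃ O : ℂ,
      HasOrbitalIntegral γ (fun g => ((autocorr 𝕂 φ g : ℝ) : ℂ)) O ∧
        absK (weylDisc γ) ^ (1 / 2 : ℝ) * ‖O‖ ≤ C) :
    ∃ u F : G 𝕂 → ℂ, IsSphericalTestFunction u ∧ F = conv u (check u) ∧
        IsSphericalTestFunction F ∧ IsPositiveDefinite F ∧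
        (∀ τ ∈ Set.Icc (t - 1) (t + 1),
          (sphericalTransform F (Complex.I * (τ : ℂ))).im = 0 ∧
          ((∫ s, bump s) / 12) ^ 2 ≤ (sphericalTransform F (Complex.I * (τ : ℂ))).re) ∧
        Function.support F ⊆ ball 𝕂 2 ∧
        (∀ g : G 𝕂, ‖F g‖ ≤ C * (1 + |t|) ^ rho 𝕂) ∧
        (∀ γ : G 𝕂, IsRegularSemisimple γ → ∃ O : ℂ, HasOrbitalIntegral γ F O ∧
          absK (weylDisc γ) ^ (1 / 2 : ℝ) * ‖O‖ ≤ C) := by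
  refine ⟨fun g => ((φ (cH g) : ℝ) : ℂ), fun g => ((autocorr 𝕂 φ g : ℝ) : ℂ),
    isSphericalTestFunction_radial hφ hV, conv_check φ, isSphericalTestFunction_autocorr hφ hV,
    isPositiveDefinite_autocorr hφ.continuous hV,
    fun τ hτ => sphericalTransform_autocorr hφ hV hA ?_, support_autocorr_subset hV, fun g => ?_,
    ho⟩
  -- The frequency gap is `ρ|t - τ| ≤ 2`, the range allowed in `integral_cos_mul_cos_mul_bump_ge`.
  · have h1 : |t - τ| ≤ 1 := abs_le.2 ⟨by linarith [hτ.2], by linarith [hτ.1]⟩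
    have h2 : (rho 𝕂 : ℝ) ≤ 2 := by exact_mod_cast hρ
    rw [← mul_sub, abs_mul, Nat.abs_cast]
    nlinarith [abs_nonneg (t - τ), (Nat.cast_nonneg (rho 𝕂) : (0 : ℝ) ≤ _)]
  · rw [Complex.norm_real]
    exact (abs_autocorr_le hφ.continuous hV g).trans hn

theorem exists_hasOrbitalIntegral_autocorr_le (hφ : ContDiff ℝ ∞ φ)
    (hV : ∀ v, V < v → φ v = 0)
    (hA : ∀ s, ∫ x : 𝕂, φ (Real.cosh s + ‖x‖ ^ 2 / 2) = Real.cos (ξ * s) * bump s)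
    {γ : G 𝕂} (hγ : IsRegularSemisimple γ) {δ : 𝕂} (hδ : δ ^ 2 = weylDisc γ) :
    ∃ O : ℂ, HasOrbitalIntegral γ (fun g => ((autocorr 𝕂 φ g : ℝ) : ℂ)) O ∧
        absK (weylDisc γ) ^ (1 / 2 : ℝ) * ‖O‖ ≤ 1 := by
  have h0 : δ ≠ 0 := by
    rintro rfl
    exact hγ (by rw [← hδ, zero_pow two_ne_zero])
  obtain ⟨x, hx⟩ := exists_conj_mem_D hδ h0
  obtain ⟨s, O, hO, e⟩ := exists_hasOrbitalIntegral_of_diagonalizable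
    (continuous_autocorr (𝕂 := 𝕂) hφ hV) (hasCompactSupport_autocorr hV)
    (fun k₁ h₁ k₂ h₂ g => autocorr_biinvariant φ h₁ h₂ g) hγ hx
  exact ⟨O, hO, e.le.trans (abs_abel_autocorr_le_one hφ.continuous hV hA s)⟩

theorem exists_hasOrbitalIntegral_autocorr_real_le (hφ : ContDiff ℝ ∞ φ)
    (hV : ∀ v, V < v → φ v = 0)
    (hA : ∀ s, ∫ x : ℝ, φ (Real.cosh s + ‖x‖ ^ 2 / 2) = Real.cos (ξ * s) * bump s)
    {γ : G ℝ} (hγ : IsRegularSemisimple γ) :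
    ∃ O : ℂ, HasOrbitalIntegral γ (fun g => ((autocorr ℝ φ g : ℝ) : ℂ)) O ∧
        absK (weylDisc γ) ^ (1 / 2 : ℝ) * ‖O‖ ≤ Real.pi := by
  rcases lt_or_gt_of_ne (show weylDisc γ ≠ 0 from hγ) with h | h
  · have := exists_hasOrbitalIntegral_of_elliptic (continuous_autocorr (𝕂 := ℝ) hφ hV)
      (hasCompactSupport_autocorr hV) (fun k₁ h₁ k₂ h₂ g => autocorr_biinvariant φ h₁ h₂ g)
      (abs_abel_autocorr_le_one hφ.continuous hV hA) h
    rwa [mul_one] at this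
  · obtain ⟨O, hO, hle⟩ := exists_hasOrbitalIntegral_autocorr_le hφ hV hA hγ (Real.sq_sqrt h.le)
    exact ⟨O, hO, hle.trans (by linarith [Real.pi_gt_three])⟩

end MainProperties

end SL2
end

theorem mainTheorem4 :
    ∃ c > (0 : ℝ), ∃ C > (0 : ℝ), ∀ t : ℝ,
      (∃ u F : SL2.G ℝ → ℂ, SL2.IsSphericalTestFunction u ∧ F = SL2.conv u (SL2.check u) ∧
        SL2.IsSphericalTestFunction F ∧ SL2.IsPositiveDefinite F ∧
        (∀ τ ∈ Set.Icc (t - 1) (t + 1),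
          (SL2.sphericalTransform F (Complex.I * (τ : ℂ))).im = 0 ∧
          c ≤ (SL2.sphericalTransform F (Complex.I * (τ : ℂ))).re) ∧
        Function.support F ⊆ SL2.ball ℝ 2 ∧
        (∀ g : SL2.G ℝ, ‖F g‖ ≤ C * (1 + |t|) ^ SL2.rho ℝ) ∧
        (∀ γ : SL2.G ℝ, SL2.IsRegularSemisimple γ → ∃ O : ℂ, SL2.HasOrbitalIntegral γ F O ∧
          SL2.absK (SL2.weylDisc γ) ^ (1 / 2 : ℝ) * ‖O‖ ≤ C)) ∧
      (∃ u F : SL2.G ℂ → ℂ, SL2.IsSphericalTestFunction u ∧ F = SL2.conv u (SL2.check u) ∧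
        SL2.IsSphericalTestFunction F ∧ SL2.IsPositiveDefinite F ∧
        (∀ τ ∈ Set.Icc (t - 1) (t + 1),
          (SL2.sphericalTransform F (Complex.I * (τ : ℂ))).im = 0 ∧
          c ≤ (SL2.sphericalTransform F (Complex.I * (τ : ℂ))).re) ∧
        Function.support F ⊆ SL2.ball ℂ 2 ∧
        (∀ g : SL2.G ℂ, ‖F g‖ ≤ C * (1 + |t|) ^ SL2.rho ℂ) ∧
        (∀ γ : SL2.G ℂ, SL2.IsRegularSemisimple γ → ∃ O : ℂ, SL2.HasOrbitalIntegral γ F O ∧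
          SL2.absK (SL2.weylDisc γ) ^ (1 / 2 : ℝ) * ‖O‖ ≤ C)) := by
  obtain ⟨C₁, hC₁, h₁⟩ := SL2.exists_radial_real
  obtain ⟨C₂, hC₂, h₂⟩ := SL2.exists_radial_complex
  have hb := SL2.integral_bump_pos
  have hpi := Real.pi_gt_three
  have r1 : SL2.rho ℝ = 1 := Module.finrank_self ℝ
  have r2 : SL2.rho ℂ = 2 := Complex.finrank_real_complex
  -- `C₁` and `4 * C₂` serve the sup norms over `ℝ` and `ℂ`; the `4` comes from the frequency `2t`
  -- over `ℂ`, through `(1 + 2|t|)² ≤ 4(1 + |t|)²`. `π` serves the orbital integrals.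
  refine ⟨((∫ s, SL2.bump s) / 12) ^ 2, by positivity, C₁ + 4 * C₂ + Real.pi, by positivity,
    fun t => ⟨?_, ?_⟩⟩
  · obtain ⟨φ, hφ, hV, hA, hn⟩ := h₁ (SL2.rho ℝ * t)
    refine SL2.exists_test_function hφ hV hA (by omega) (hn.trans ?_) fun γ hγ => ?_
    · rw [r1, Nat.cast_one, one_mul, pow_one]
      exact mul_le_mul_of_nonneg_right (by linarith) (by positivity)
    · obtain ⟨O, hO, hle⟩ := SL2.exists_hasOrbitalIntegral_autocorr_real_le hφ hV hA hγ
      exact ⟨O, hO, hle.trans (by linarith)⟩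
  · obtain ⟨φ, hφ, hV, hA, hn⟩ := h₂ (SL2.rho ℂ * t)
    refine SL2.exists_test_function hφ hV hA (by omega) (hn.trans ?_) fun γ hγ => ?_
    · rw [r2, abs_mul, Nat.abs_cast, Nat.cast_ofNat]
      have h0 := abs_nonneg t
      have h3 : (1 + 2 * |t|) ^ 2 ≤ 4 * (1 + |t|) ^ 2 := by nlinarith
      have h4 := mul_le_mul_of_nonneg_left h3 hC₂.le
      have h5 : (0 : ℝ) ≤ (C₁ + Real.pi) * (1 + |t|) ^ 2 := by positivity
      linarith
    -- Over `ℂ` every discriminant is a square, so all regular elements are diagonalizable.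
    · obtain ⟨δ, hδ⟩ := IsAlgClosed.exists_pow_nat_eq (SL2.weylDisc γ) two_pos
      obtain ⟨O, hO, hle⟩ := SL2.exists_hasOrbitalIntegral_autocorr_le hφ hV hA hγ hδ
      exact ⟨O, hO, hle.trans (by linarith)⟩
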